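/- Let $n\ge 1$ and let $M$ be a smooth $n$-dimensional manifold-with-boundary (Hausdorff, second countable), with interior $\mathring M$ and boundary $\partial M$, equipped with a smooth free action of the circle group $S^1$ on an open neighbourhood $U_M$ of $\partial M$. Let $M_{\mathrm{cut}}=M/{\sim}$, with the quotient topology and quotient map $c\colon M\to M_{\mathrm{cut}}$, where distinct points are equivalent if and only if they both lie in $\partial M$ and are in the same $S^1$-orbit. An *invariant boundary defining function* is a smooth $f\colon M\to\mathbb R_{\ge 0}$ with $f^{-1}(0)=\partial M$, with $df\neq 0$ at every point of $\partial M$, and which is $S^1$-invariant on some $S^1$-invariant neighbourhood of $\partial M$ in $U_M$. Given such an $f$, let $\mathcal F_M$ be the set of functions $h\colon M_{\mathrm{cut}}\to\mathbb R$ such that $h\circ c$ is smooth on $\mathring M$ and such that there exist an $S^1$-invariant open neighbourhood $V$ of $\partial M$ in $U_M$ and a smooth function $H\colon V\times\mathbb C\to\mathbb R$ with $H(a\cdot x,z)=H(x,az)$ for all $a\in S^1$, $(x,z)\in V\times\mathbb C$, and $h(c(x))=H\big(x,\sqrt{f(x)}\big)$ for all $x\in V$. Then an invariant boundary defining function $f$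 exists, and for every such $f$ there is a structure of a smooth $n$-dimensional manifold (Hausdorff, second countable, without boundary) on the topological space $M_{\mathrm{cut}}$ whose set of smooth real valued functions is $\mathcal F_M$. With respect to any such structure, $c|_{\mathring M}$ is smooth and the following holds. Let $k\ge 0$ and let $\beta$ be a smooth differential $k$-form on $M$ whose pullback to $\partial M$ is basic (it is $S^1$-invariant, and its contraction with the vector field generating the action vanishes) and whose restriction to some $S^1$-invariant neighbourhood of $\partial M$ in $U_M$ is $S^1$-invariant. Then there exists a unique smooth differential $k$-form $\beta_{\mathrm{cut}}$ on $M_{\mathrm{cut}}$ whose pullback through $c|_{\mathring M}\colon \mathring M\to M_{\mathrm{cut}}$ coincides with $\beta$ on $\mathring M$. -/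

import Mathlib

open scoped Manifold ContDiff Topology

noncomputable section

namespace SmoothCut

/-! ### Differential forms on manifolds, possibly with boundary -/

section Forms

variable {E : Type*} [NormedAddCommGroup E] [NormedSpace ℝ E]
  {H : Type*} [TopologicalSpace H] {I : ModelWithCorners ℝ E H}
  {M : Type*} [TopologicalSpace M] [ChartedSpace H M]
  {E' : Type*} [NormedAddCommGroup E'] [NormedSpace ℝ E']
  {H' : Type*} [TopologicalSpace H'] {I' : ModelWithCorners ℝ E' H'}
  {M' : Type*} [TopologicalSpace M'] [ChartedSpace H' M']

variable (I M) in
/-- A field of alternating `k`-linear forms on the tangent spaces of `M`, with no regularity. -/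
abbrev FormField (k : ℕ) : Type _ :=
  (x : M) → TangentSpace I x [⋀^Fin k]→L[ℝ] ℝ

/-- The expression of a field of `k`-forms in the preferred chart around `x₀`: its pullback, to
the model vector space, by the inverse of the chart. -/
def FormField.inChart {k : ℕ} (β : FormField I M k) (x₀ : M) (y : E) : E [⋀^Fin k]→L[ℝ] ℝ :=
  (β ((extChartAt I x₀).symm y)).compContinuousLinearMap
    (mfderivWithin 𝓘(ℝ, E) I (extChartAt I x₀).symm (Set.range I) y)

variable (I M) in
/-- Smooth differential `k`-forms: in every chart the coefficients are smooth (up to the boundary,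
where there is one). -/
structure DifferentialForm (k : ℕ) where
  /-- The value of the form at a point. -/
  toFun : FormField I M k
  /-- Smoothness in charts. -/
  smooth' : ∀ x₀ : M, ContDiffOn ℝ ∞ (toFun.inChart x₀) (extChartAt I x₀).target

/-- The value at `x` of the pullback of a field of forms by a map `g` that is differentiable
at `x`: `(g^*β)_x (v₁, …, v_k) = β_{g x} (dg v₁, …, dg v_k)`. -/
def FormField.pullbackAt {k : ℕ} (β : FormField I' M' k) (g : M → M') (x : M) :
    TangentSpace I x [⋀^Fin k]→L[ℝ] ℝ :=
  (β (g x)).compContinuousLinearMap (mfderiv I I' g x)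

end Forms

/-! ### Circle actions near the boundary, and the cut space -/

section Cut

variable {n : ℕ} [NeZero n] {M : Type*} [TopologicalSpace M] [ChartedSpace (EuclideanHalfSpace n) M]
  (U : TopologicalSpace.Opens M) [MulAction Circle U]

variable (n) in
/-- The action of the circle on the open set `U` is smooth and free, and `U` is a neighbourhood of
the boundary of `M`. -/
structure IsFreeActionNearBoundary : Prop where
  boundary_subset : (𝓡∂ n).boundary M ⊆ (U : Set M)
  smooth : ContMDiff ((𝓡 1).prod (𝓡∂ n)) (𝓡∂ n) ∞ (fun p : Circle × U ↦ p.1 • p.2)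
  free : ∀ (a : Circle) (x : U), a • x = x → a = 1

variable (n) in
/-- `V` is a circle-invariant open neighbourhood of the boundary of `M`, contained in `U`. -/
structure IsInvariantNhd (V : Set M) : Prop where
  isOpen : IsOpen V
  boundary_subset : (𝓡∂ n).boundary M ⊆ V
  subset : V ⊆ (U : Set M)
  invariant : ∀ (a : Circle) (x : U), (x : M) ∈ V → ((a • x : U) : M) ∈ V

/-- The action of `a` as a self-map of `M`. Only its values on the open set `U` matter; it is
extended by the identity outside `U`. -/
def act (a : Circle) (x : M) : M :=
  open Classical in if hx : x ∈ U then ((a • (⟨x, hx⟩ : U) : U) : M) else x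

variable (n) in
/-- Two points are equivalent if they are equal, or both are in the boundary and they are in the
same circle orbit. -/
def cutSetoid : Setoid M where
  r x y := x = y ∨ (x ∈ (𝓡∂ n).boundary M ∧ y ∈ (𝓡∂ n).boundary M ∧
    ∃ (u v : U) (a : Circle), (u : M) = x ∧ (v : M) = y ∧ a • u = v)
  iseqv :=
    { refl := fun _ ↦ Or.inl rfl
      symm := by
        rintro x y (h | ⟨hx, hy, u, v, a, hu, hv, h⟩)
        · exact Or.inl h.symm
        · exact Or.inr ⟨hy, hx, v, u, a⁻¹, hv, hu, by rw [← h, inv_smul_smul]⟩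
      trans := by
        rintro x y z (h | ⟨hx, hy, u, v, a, hu, hv, h⟩) (h' | ⟨hy', hz, u', v', a', hu', hv', h'⟩)
        · exact Or.inl (h.trans h')
        · subst h
          exact Or.inr ⟨hy', hz, u', v', a', hu', hv', h'⟩
        · subst h'
          exact Or.inr ⟨hx, hy, u, v, a, hu, hv, h⟩
        · refine Or.inr ⟨hx, hz, u, v', a' * a, hu, hv', ?_⟩
          have e : v = u' := Subtype.ext (hv.trans hu'.symm)
          rw [mul_smul, h, e, h'] }

variable (n) in
/-- The cut space `M_cut`, the quotient of `M` by the above relation. -/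
def CutSpace : Type _ := Quotient (cutSetoid n U)

/-- The cut space carries the quotient topology. -/
instance : TopologicalSpace (CutSpace n U) :=
  inferInstanceAs (TopologicalSpace (Quotient (cutSetoid n U)))

variable (n) in
/-- The quotient map `c : M → M_cut`. -/
def cutMap (x : M) : CutSpace n U := Quotient.mk (cutSetoid n U) x

variable (n) in
/-- Invariant boundary defining functions. -/
structure IsInvariantBoundaryDefining (f : M → ℝ) : Prop where
  smooth : ContMDiff (𝓡∂ n) 𝓘(ℝ, ℝ) ∞ f
  nonneg : ∀ x, 0 ≤ f x
  zero_iff : ∀ x, f x = 0 ↔ x ∈ (𝓡∂ n).boundary M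
  deriv_ne_zero : ∀ x ∈ (𝓡∂ n).boundary M, mfderiv (𝓡∂ n) 𝓘(ℝ, ℝ) f x ≠ 0
  invariant : ∃ V : Set M, IsInvariantNhd n U V ∧
    ∀ (a : Circle) (x : U), (x : M) ∈ V → f ((a • x : U) : M) = f (x : M)

variable (n) in
/-- The set `F_M` of real valued functions on the cut space: those `h` such that `h ∘ c` is smooth
in the interior of `M` and, on an invariant neighbourhood `V` of the boundary,
`h (c x) = G (x, √(f x))` for a smooth `G : V × ℂ → ℝ` with `G (a • x, z) = G (x, a z)`. -/
def cutFunctions (f : M → ℝ) : Set (CutSpace n U → ℝ) :=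
  {h | ContMDiffOn (𝓡∂ n) 𝓘(ℝ, ℝ) ∞ (h ∘ cutMap n U) ((𝓡∂ n).interior M) ∧
    ∃ (V : Set M) (G : M × ℂ → ℝ), IsInvariantNhd n U V ∧
      ContMDiffOn ((𝓡∂ n).prod 𝓘(ℝ, ℂ)) 𝓘(ℝ, ℝ) ∞ G (V ×ˢ Set.univ) ∧
      (∀ (a : Circle) (x : U) (z : ℂ), (x : M) ∈ V →
        G (((a • x : U) : M), z) = G ((x : M), (a : ℂ) * z)) ∧
      ∀ x ∈ V, h (cutMap n U x) = G (x, (Real.sqrt (f x) : ℂ))}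

variable (n) in
/-- An atlas on the cut space (with its quotient topology) makes it the smooth manifold `M_cut`:
it is a smooth `n`-manifold without boundary whose smooth real valued functions are exactly
the members of `F_M`. -/
structure IsCutManifold (f : M → ℝ) [ChartedSpace (EuclideanSpace ℝ (Fin n)) (CutSpace n U)] :
    Prop where
  t2 : T2Space (CutSpace n U)
  secondCountable : SecondCountableTopology (CutSpace n U)
  isManifold : IsManifold (𝓡 n) ∞ (CutSpace n U)
  smooth_iff : ∀ h : CutSpace n U → ℝ,
    ContMDiff (𝓡 n) 𝓘(ℝ, ℝ) ∞ h ↔ h ∈ cutFunctions n U f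

/-! ### Forms that are basic on the boundary and invariant near the boundary -/

variable (n) in
/-- The tangent space of the boundary at a boundary point `x`, as a subspace of the tangent space
of `M`: the kernel of the differential of the coordinate `y₀` of a chart around `x` with
values in the half space `y₀ ≥ 0`. -/
def boundaryTangent (x : M) : Set (TangentSpace (𝓡∂ n) x) :=
  {v | mfderiv (𝓡∂ n) 𝓘(ℝ, ℝ) (fun y : M ↦ extChartAt (𝓡∂ n) x y 0) x v = 0}

variable (n) in
/-- The vector field on `U` that generates the circle action, `d/dt exp(it) • x` at `t = 0`. -/
def generator (x : M) : TangentSpace (𝓡∂ n) x :=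
  (mfderiv 𝓘(ℝ, ℝ) (𝓡∂ n) (fun t : ℝ ↦ act U (Circle.exp t) x) 0 (1 : ℝ) : EuclideanSpace ℝ (Fin n))

/-- The pullback of `β` to the boundary is basic: horizontal (it vanishes when one argument is the
generating vector field) and invariant. -/
structure IsBasicOnBoundary {k : ℕ} (β : FormField (𝓡∂ n) M k) : Prop where
  horizontal : ∀ x ∈ (𝓡∂ n).boundary M, ∀ v : Fin k → TangentSpace (𝓡∂ n) x,
    (∀ i, v i ∈ boundaryTangent n x) → (∃ i, v i = generator n U x) → β x v = 0
  invariant : ∀ (a : Circle), ∀ x ∈ (𝓡∂ n).boundary M, ∀ v : Fin k → TangentSpace (𝓡∂ n) x,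
    (∀ i, v i ∈ boundaryTangent n x) →
      β.pullbackAt (I := 𝓡∂ n) (act U a) x v = β x v

/-- On some invariant neighbourhood of the boundary, `β` is invariant: `a^*β = β` for all `a`. -/
def IsInvariantNearBoundary {k : ℕ} (β : FormField (𝓡∂ n) M k) : Prop :=
  ∃ V : Set M, IsInvariantNhd n U V ∧
    ∀ (a : Circle), ∀ x ∈ V, β.pullbackAt (I := 𝓡∂ n) (act U a) x = β x

end Cut

end SmoothCut

end

noncomputable section

set_option linter.unusedSectionVars false

namespace SmoothCut

/-! ### Integrals depending smoothly on a parameter -/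

section ParametricIntegral

open Set intervalIntegral

universe u

variable {E F : Type u} [NormedAddCommGroup E] [NormedSpace ℝ E]
  [NormedAddCommGroup F] [NormedSpace ℝ F]

/-! Near the image of the boundary, the cut space is the quotient of a smooth hypersurface. Let V be
an invariant neighbourhood of the boundary on which f is invariant, and let Z be the set of (x, z)
in V × ℂ with f x = ‖z‖². The circle acts on Z by a·(x, z) = (a⁻¹x, az), and (x, z) ↦ c(phase(z)·x)
(`twistMap`) has exactly the orbits as fibres: an orbit with z ≠ 0 contains one point with z = √(f
x), and an orbit with z = 0 is a collapsed boundary orbit (`twistMap_act`, `exists_of_twistMap_eq`).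
The functions in F_M are those that are smooth on the interior and whose pullback to Z extends to a
smooth function with the matching symmetry.

Charts. Near a boundary point f is the transverse coordinate times a positive function, so on Z the
point x is a smooth function of its tangential coordinates and of z (`exists_tube_parametrization`).
A complement K, of dimension n − 2, to the orbit direction gives a slice (k, ζ) ↦ (X(k, ζ), ζ) of
the free action, with X depending on ζ only through ‖ζ‖ (`exists_sliceModel`). In the chart that it
defines, local extendability on Z is smoothness of the coordinate expression
(`SliceModel.isChartFor`). With the charts of the interior this yields an atlas (`exists_chart`,
`exists_chartedSpace`). A partition of unity on M × ℂ followed by averaging turns local extensions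
into one equivariant G (`mem_cutFunctions_of_smoothNear`). Conversely, on any manifold structure
with these smooth functions, bump functions show that the same charts are diffeomorphisms
(`IsChartFor.contMDiffOn`, `IsChartFor.contMDiffOn_symm`), so an arbitrary structure can be studied
in them.

Forms. Invariance turns the expression of β in a slice chart, off ζ = 0, into the form with value
β_X(dX v₁ + dθ(v₁)ξ, …, dX v_k + dθ(v_k)ξ), where ξ generates the action and dθ is singular at ζ =
0. Rotation invariance of X makes its derivative along ℂ equal to r dr times a smooth vector e. A
term with both factors involves r dr ∧ dθ = dx ∧ dy and is smooth. A term with dθ alone has a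
rotation invariant coefficient that vanishes at ζ = 0 because β is horizontal on the boundary; it is
therefore divisible by r², and r² dθ = x dy − y dx (`exists_smooth_quotient`,
`exists_form_extension`). Since c is a local diffeomorphism on the interior, with dense image, the
local forms are unique and glue (`existsUnique_form`).

A boundary defining function arises by gluing first chart coordinates with a partition of unity,
averaging over the circle, and gluing the average to a positive function away from the boundary. -/

theorem hasFDerivWithinAt_slice {g : E × ℝ → F} {s : Set E} {J : Set ℝ}
    (hg : DifferentiableOn ℝ g (s ×ˢ J)) {y : E} {t : ℝ} (hy : y ∈ s) (ht : t ∈ J) :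
    HasFDerivWithinAt (fun y' ↦ g (y', t))
      ((fderivWithin ℝ g (s ×ˢ J) (y, t)).comp (ContinuousLinearMap.inl ℝ E ℝ)) s y := by
  have h := (hg (y, t) ⟨hy, ht⟩).hasFDerivWithinAt
  have h2 : HasFDerivWithinAt (fun y' : E ↦ (y', t)) (ContinuousLinearMap.inl ℝ E ℝ) s y :=
    (hasFDerivWithinAt_id y s).prodMk (hasFDerivWithinAt_const t y s)
  exact HasFDerivWithinAt.comp (t := s ×ˢ J) y h h2 (fun y' hy' ↦ ⟨hy', ht⟩)

theorem integrable_slice [CompleteSpace F] {g : E × ℝ → F} {s : Set E}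
    (hg : ContinuousOn g (s ×ˢ Icc (0 : ℝ) 1)) {y : E} (hy : y ∈ s) :
    IntervalIntegrable (fun t ↦ g (y, t)) MeasureTheory.volume 0 1 := by
  apply ContinuousOn.intervalIntegrable
  rw [uIcc_of_le zero_le_one]
  exact hg.comp (by fun_prop) (fun t ht ↦ ⟨hy, ht⟩)

/-- Continuity on a product with the compact interval is uniform in the second variable; this
controls the integrands below. -/
theorem eventually_forall_norm_sub_le {D : E × ℝ → F} {s : Set E}
    (hDc : ContinuousOn D (s ×ˢ Icc (0 : ℝ) 1)) {y : E} (hy : y ∈ s) {ε : ℝ} (hε : 0 < ε) :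
    ∀ᶠ y' in 𝓝 y, ∀ t ∈ Icc (0 : ℝ) 1, t ∈ Icc (0 : ℝ) 1 → y' ∈ s →
      ‖D (y', t) - D (y, t)‖ ≤ ε := by
  -- The condition t ∈ [0, 1] is repeated inside `P` because the compactness argument uses full
  -- neighbourhoods of (y, t), in which t may leave the interval.
  refine isCompact_Icc.eventually_forall_of_forall_eventually
    (P := fun y' t ↦ t ∈ Icc (0 : ℝ) 1 → y' ∈ s → ‖D (y', t) - D (y, t)‖ ≤ ε) ?_
  intro t ht
  have h1 : ∀ᶠ p in 𝓝 (y, t), p ∈ s ×ˢ Icc (0 : ℝ) 1 → dist (D p) (D (y, t)) < ε / 2 :=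
    eventually_nhdsWithin_iff.1 (Metric.tendsto_nhds.1 (hDc (y, t) ⟨hy, ht⟩) (ε / 2) (half_pos hε))
  have h2 : Filter.Tendsto (fun p : E × ℝ ↦ (y, p.2)) (𝓝 (y, t)) (𝓝 (y, t)) :=
    (by fun_prop : Continuous (fun p : E × ℝ ↦ (y, p.2))).tendsto' _ _ rfl
  have h3 : ∀ᶠ p : E × ℝ in 𝓝 (y, t), p.2 ∈ Icc (0 : ℝ) 1 → p.1 ∈ s →
      ‖D (p.1, p.2) - D (y, p.2)‖ ≤ ε := by
    filter_upwards [h1, h2.eventually h1] with p hp hp' hp2 hp1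
    rw [← dist_eq_norm]
    refine (dist_triangle_right _ _ (D (y, t))).trans ?_
    linarith [hp ⟨hp1, hp2⟩, hp' ⟨hy, hp2⟩]
  exact h3

/-- The mean value inequality on the convex set s, applied for each t, bounds the remainder
uniformly in t. Derivatives are taken within s so that the result applies in half space charts. -/
theorem hasFDerivWithinAt_integral [CompleteSpace F] {g : E × ℝ → F} {s : Set E}
    (hs : Convex ℝ s) (hu : UniqueDiffOn ℝ s)
    (hg : ContDiffOn ℝ 1 g (s ×ˢ Icc (0 : ℝ) 1)) {y : E} (hy : y ∈ s) :
    HasFDerivWithinAt (fun y' ↦ ∫ t in (0 : ℝ)..1, g (y', t))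
      (∫ t in (0 : ℝ)..1, (fderivWithin ℝ g (s ×ˢ Icc (0 : ℝ) 1) (y, t)).comp
        (ContinuousLinearMap.inl ℝ E ℝ)) s y := by
  have hU : UniqueDiffOn ℝ (s ×ˢ Icc (0 : ℝ) 1) := hu.prod (uniqueDiffOn_Icc zero_lt_one)
  set D : E × ℝ → E →L[ℝ] F := fun p ↦ (fderivWithin ℝ g (s ×ˢ Icc (0 : ℝ) 1) p).comp
    (ContinuousLinearMap.inl ℝ E ℝ) with hD
  have hDc : ContinuousOn D (s ×ˢ Icc (0 : ℝ) 1) :=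
    (hg.continuousOn_fderivWithin hU le_rfl).clm_comp continuousOn_const
  have hd : DifferentiableOn ℝ g (s ×ˢ Icc (0 : ℝ) 1) := hg.differentiableOn one_ne_zero
  rw [hasFDerivWithinAt_iff_isLittleO, Asymptotics.isLittleO_iff]
  intro ε hε
  have key : ∀ᶠ y' in 𝓝 y, ∀ t ∈ Icc (0 : ℝ) 1, t ∈ Icc (0 : ℝ) 1 → y' ∈ s →
      ‖D (y', t) - D (y, t)‖ ≤ ε := eventually_forall_norm_sub_le hDc hy hε
  obtain ⟨δ, hδ, hball⟩ := Metric.eventually_nhds_iff_ball.1 key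
  have hB : s ∩ Metric.ball y δ ∈ 𝓝[s] y :=
    Filter.inter_mem self_mem_nhdsWithin (mem_nhdsWithin_of_mem_nhds (Metric.ball_mem_nhds y hδ))
  filter_upwards [hB] with y' hy'
  have hi : ∀ z ∈ s, IntervalIntegrable (fun t ↦ g (z, t)) MeasureTheory.volume 0 1 :=
    fun z hz ↦ integrable_slice hg.continuousOn hz
  have hiD : IntervalIntegrable (fun t ↦ D (y, t)) MeasureTheory.volume 0 1 :=
    integrable_slice hDc hy
  have e1 : (∫ t in (0 : ℝ)..1, D (y, t)) (y' - y) = ∫ t in (0 : ℝ)..1, D (y, t) (y' - y) :=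
    ContinuousLinearMap.intervalIntegral_apply hiD _
  rw [e1, ← integral_sub (hi _ hy'.1) (hi _ hy), ← integral_sub
    ((hi _ hy'.1).sub (hi _ hy)) ?_]
  · have := norm_integral_le_of_norm_le_const (a := (0 : ℝ)) (b := 1) (C := ε * ‖y' - y‖)
      (f := fun t ↦ g (y', t) - g (y, t) - D (y, t) (y' - y)) ?_
    · simpa using this
    intro t ht
    rw [uIoc_of_le zero_le_one] at ht
    have ht' : t ∈ Icc (0 : ℝ) 1 := ⟨ht.1.le, ht.2⟩
    refine Convex.norm_image_sub_le_of_norm_hasFDerivWithin_le' (s := s ∩ Metric.ball y δ)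
      (f := fun z ↦ g (z, t)) (f' := fun z ↦ D (z, t)) ?_ ?_ (hs.inter (convex_ball _ _))
      ⟨hy, Metric.mem_ball_self hδ⟩ hy'
    · intro z hz
      exact (hasFDerivWithinAt_slice hd hz.1 ht').mono inter_subset_left
    · intro z hz
      exact hball z hz.2 t ht' ht' hz.1
  · exact ((ContinuousLinearMap.apply ℝ F (y' - y)).integrable_comp hiD.1 |> fun h ↦
      ⟨h, by simp⟩)

/-- The target F is quantified inside the induction because the derivative takes values in E →L[ℝ]
F, to which the induction hypothesis is applied. -/
theorem contDiffOn_nat_integral {s : Set E} (hs : Convex ℝ s) (hu : UniqueDiffOn ℝ s) (m : ℕ) :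
    ∀ {F : Type u} [NormedAddCommGroup F] [NormedSpace ℝ F] [CompleteSpace F] {g : E × ℝ → F},
    ContDiffOn ℝ m g (s ×ˢ Icc (0 : ℝ) 1) →
    ContDiffOn ℝ m (fun y ↦ ∫ t in (0 : ℝ)..1, g (y, t)) s := by
  have hU : UniqueDiffOn ℝ (s ×ˢ Icc (0 : ℝ) 1) := hu.prod (uniqueDiffOn_Icc zero_lt_one)
  induction m with
  | zero =>
    intro F _ _ _ g hg
    rw [Nat.cast_zero, contDiffOn_zero] at *
    intro y hy
    rw [Metric.continuousWithinAt_iff']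
    intro ε hε
    have key : ∀ᶠ y' in 𝓝 y, ∀ t ∈ Icc (0 : ℝ) 1, t ∈ Icc (0 : ℝ) 1 → y' ∈ s →
        ‖g (y', t) - g (y, t)‖ ≤ ε / 2 :=
      eventually_forall_norm_sub_le hg hy (half_pos hε)
    have hi : ∀ z ∈ s, IntervalIntegrable (fun t ↦ g (z, t)) MeasureTheory.volume 0 1 :=
      fun z hz ↦ integrable_slice hg hz
    filter_upwards [mem_nhdsWithin_of_mem_nhds key, self_mem_nhdsWithin] with y' hy' hys
    rw [dist_eq_norm, ← integral_sub (hi _ hys) (hi _ hy)]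
    have := norm_integral_le_of_norm_le_const (a := (0 : ℝ)) (b := 1) (C := ε / 2)
      (f := fun t ↦ g (y', t) - g (y, t)) ?_
    · rw [sub_zero, abs_one, mul_one] at this
      linarith
    intro t ht
    rw [uIoc_of_le zero_le_one] at ht
    exact hy' t ⟨ht.1.le, ht.2⟩ ⟨ht.1.le, ht.2⟩ hys
  | succ m ih =>
    intro F _ _ _ g hg
    have h1 : ContDiffOn ℝ 1 g (s ×ˢ Icc (0 : ℝ) 1) :=
      hg.of_le (by exact_mod_cast Nat.succ_le_succ (Nat.zero_le m))
    have hder := fun y hy ↦ hasFDerivWithinAt_integral hs hu h1 (y := y) hy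
    push_cast
    rw [contDiffOn_succ_iff_fderivWithin hu]
    refine ⟨fun y hy ↦ (hder y hy).differentiableWithinAt, by simp, ?_⟩
    refine (ih (g := fun p ↦ (fderivWithin ℝ g (s ×ˢ Icc (0 : ℝ) 1) p).comp
      (ContinuousLinearMap.inl ℝ E ℝ)) ?_).congr (fun y hy ↦ (hder y hy).fderivWithin (hu y hy))
    exact (hg.fderivWithin hU (by push_cast; exact le_rfl)).clm_comp contDiffOn_const

theorem contDiffOn_integral [CompleteSpace F] {s : Set E} (hs : Convex ℝ s) (hu : UniqueDiffOn ℝ s)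
    {g : E × ℝ → F} (hg : ContDiffOn ℝ ∞ g (s ×ˢ Icc (0 : ℝ) 1)) :
    ContDiffOn ℝ ∞ (fun y ↦ ∫ t in (0 : ℝ)..1, g (y, t)) s := by
  rw [contDiffOn_infty] at *
  exact fun m ↦ contDiffOn_nat_integral hs hu m (hg m)

end ParametricIntegral

/-! ### Inverse function theorem -/

section Inverse

variable {E F : Type*} [NormedAddCommGroup E] [NormedSpace ℝ E] [CompleteSpace E]
  [NormedAddCommGroup F] [NormedSpace ℝ F]

/-- The local inverse is smooth wherever the derivative is invertible. Invertibility is an open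
condition, so the source is cut down to the points where it holds. -/
theorem exists_smooth_localInverse {g : E → F} {O : Set E} (hO : IsOpen O) {a : E} (ha : a ∈ O)
    (hg : ContDiffOn ℝ ∞ g O) (L : E ≃L[ℝ] F) (hL : HasFDerivAt g (L : E →L[ℝ] F) a) :
    ∃ Φ : OpenPartialHomeomorph E F, (∀ x, Φ x = g x) ∧ a ∈ Φ.source ∧ Φ.source ⊆ O ∧
      ContDiffOn ℝ ∞ Φ.symm Φ.target := by
  have hca : ContDiffAt ℝ ∞ g a := hg.contDiffAt (hO.mem_nhds ha)
  set Ψ := hca.toOpenPartialHomeomorph g hL (by simp)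
  have hopen : IsOpen (O ∩ {x ∈ O | fderiv ℝ g x ∈ Set.range ((↑) : (E ≃L[ℝ] F) → E →L[ℝ] F)}) := by
    have : ContinuousOn (fderiv ℝ g) O := (hg.fderiv_of_isOpen hO (m := 0) (by simp)).continuousOn
    have h2 := this.isOpen_inter_preimage hO (ContinuousLinearEquiv.isOpen (𝕜 := ℝ) (E := E) (F := F))
    convert h2 using 1
    ext x; simp +contextual
  set W := O ∩ {x ∈ O | fderiv ℝ g x ∈ Set.range ((↑) : (E ≃L[ℝ] F) → E →L[ℝ] F)}
  refine ⟨Ψ.restrOpen W hopen, fun x ↦ rfl, ?_, ?_, ?_⟩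
  · exact ⟨hca.mem_toOpenPartialHomeomorph_source hL (by simp), ha, ha, L, hL.fderiv.symm⟩
  · exact fun x hx ↦ hx.2.1
  · intro y hy
    set Φ := Ψ.restrOpen W hopen
    have hx : Φ.symm y ∈ Φ.source := Φ.map_target hy
    obtain ⟨L', hL'⟩ := hx.2.2.2
    refine (Φ.contDiffAt_symm (f₀' := L') hy ?_ ?_).contDiffWithinAt
    · have : DifferentiableAt ℝ g (Φ.symm y) :=
        (hg.contDiffAt (hO.mem_nhds hx.2.1)).differentiableAt (by simp)
      rw [hL']
      exact this.hasFDerivAt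
    · exact hg.contDiffAt (hO.mem_nhds hx.2.1)

end Inverse

/-! ### Division of rotation invariant functions by the square of the radius -/

section Division

open Set intervalIntegral

variable {K F : Type} [NormedAddCommGroup K] [NormedSpace ℝ K]
  [NormedAddCommGroup F] [NormedSpace ℝ F]

variable (K) in
/-- The product of the balls of radius `r` in `K` and in the plane. -/
def bidisc (r : ℝ) : Set (K × ℂ) := Metric.ball 0 r ×ˢ Metric.ball 0 r

theorem isOpen_bidisc (r : ℝ) : IsOpen (bidisc K r) := Metric.isOpen_ball.prod Metric.isOpen_ball

theorem mem_bidisc {r : ℝ} {p : K × ℂ} : p ∈ bidisc K r ↔ ‖p.1‖ < r ∧ ‖p.2‖ < r := by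
  simp [bidisc]

theorem convex_bidisc (r : ℝ) : Convex ℝ (bidisc K r) := (convex_ball _ _).prod (convex_ball _ _)

theorem bidisc_eqOn_of_dense {r : ℝ} {f g : K × ℂ → F} {D : Set (K × ℂ)} (hD : Dense D)
    (hf : ContinuousOn f (bidisc K r)) (hg : ContinuousOn g (bidisc K r))
    (h : ∀ p ∈ bidisc K r, p ∈ D → f p = g p) : EqOn f g (bidisc K r) :=
  EqOn.of_subset_closure (s := bidisc K r ∩ D) (fun p hp ↦ h p hp.1 hp.2) hf hg inter_subset_left
    (hD.open_subset_closure_inter (isOpen_bidisc r))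

theorem dense_im_ne_zero : Dense {p : K × ℂ | p.2.im ≠ 0} :=
  (dense_compl_singleton (0 : ℝ)).preimage (Complex.isOpenMap_im.comp isOpenMap_snd)

theorem re_add_mul_im_mem {r : ℝ} {p : K × ℂ} (hp : p ∈ bidisc K r) {t : ℝ} (ht : t ∈ Icc (0 : ℝ) 1) :
    (p.1, (p.2.re : ℂ) + (t * p.2.im : ℝ) * Complex.I) ∈ bidisc K r := by
  rw [mem_bidisc] at *
  refine ⟨hp.1, lt_of_le_of_lt ?_ hp.2⟩
  rw [← sq_le_sq₀ (norm_nonneg _) (norm_nonneg _), ← Complex.normSq_eq_norm_sq,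
    ← Complex.normSq_eq_norm_sq, Complex.normSq_apply, Complex.normSq_apply]
  simp only [Complex.add_re, Complex.ofReal_re, Complex.mul_re, Complex.I_re, mul_zero,
    Complex.ofReal_im, Complex.I_im, mul_one, sub_self, add_zero, Complex.add_im, Complex.mul_im,
    zero_add]
  nlinarith [ht.1, ht.2, mul_self_nonneg p.2.im, mul_le_mul ht.2 ht.2 ht.1 zero_le_one,
    mul_nonneg (sub_nonneg.2 (mul_le_mul ht.2 ht.2 ht.1 zero_le_one)) (mul_self_nonneg p.2.im)]

/-- Hadamard's lemma: the relation x C = y B forces C to vanish on y = 0, hence C = y G with G the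
average of ∂C/∂y over the segment from the real axis. Then B = x G where y ≠ 0, and everywhere by
density. -/
theorem exists_smooth_common_factor [CompleteSpace F] {r : ℝ} {B C : K × ℂ → F}
    (hB : ContDiffOn ℝ ∞ B (bidisc K r)) (hC : ContDiffOn ℝ ∞ C (bidisc K r))
    (h : ∀ p ∈ bidisc K r, p.2.re • C p = p.2.im • B p) :
    ∃ G : K × ℂ → F, ContDiffOn ℝ ∞ G (bidisc K r) ∧
      (∀ p ∈ bidisc K r, B p = p.2.re • G p) ∧ ∀ p ∈ bidisc K r, C p = p.2.im • G p := by
  set γ : (K × ℂ) × ℝ → K × ℂ := fun q ↦ (q.1.1, (q.1.2.re : ℂ) + (q.2 * q.1.2.im : ℝ) * Complex.I)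
    with hγ
  have hγc : ContDiff ℝ ∞ γ := by
    have h1 : ContDiff ℝ ∞ (fun q : (K × ℂ) × ℝ ↦ q.1.2.re) :=
      Complex.reCLM.contDiff.comp (by fun_prop)
    have h2 : ContDiff ℝ ∞ (fun q : (K × ℂ) × ℝ ↦ q.1.2.im) :=
      Complex.imCLM.contDiff.comp (by fun_prop)
    have h3 := Complex.ofRealCLM.contDiff (n := ∞) |>.comp h1
    have h4 := Complex.ofRealCLM.contDiff (n := ∞) |>.comp (contDiff_snd.mul h2)
    exact (contDiff_fst.comp contDiff_fst).prodMk (h3.add (h4.mul contDiff_const))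
  have hmaps : MapsTo γ (bidisc K r ×ˢ Icc (0 : ℝ) 1) (bidisc K r) :=
    fun q hq ↦ re_add_mul_im_mem hq.1 hq.2
  set c : K × ℂ → F := fun p ↦ fderiv ℝ C p (0, Complex.I) with hc
  have hcs : ContDiffOn ℝ ∞ c (bidisc K r) :=
    (hC.fderiv_of_isOpen (isOpen_bidisc r) (m := ∞) (by simp)).clm_apply contDiffOn_const
  set G : K × ℂ → F := fun p ↦ ∫ t in (0 : ℝ)..1, c (γ (p, t)) with hG
  have hGs : ContDiffOn ℝ ∞ G (bidisc K r) :=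
    contDiffOn_integral (convex_bidisc r) (isOpen_bidisc r).uniqueDiffOn
      (g := fun q ↦ c (γ q)) (hcs.comp hγc.contDiffOn hmaps)
  -- `C` vanishes on the real axis
  have hreal : ∀ p ∈ bidisc K r, p.2.im = 0 → C p = 0 := by
    intro p hp hpi
    have hp' := mem_bidisc.1 hp
    have hpe : p = (p.1, (p.2.re : ℂ)) := by
      ext1
      · rfl
      · exact Complex.ext (by simp) (by simp [hpi])
    have hm : MapsTo (fun s : ℝ ↦ (p.1, (s : ℂ))) (Metric.ball 0 r) (bidisc K r) := by
      intro s hs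
      rw [mem_bidisc]
      exact ⟨hp'.1, by simpa using hs⟩
    -- On the axis the relation reads x C = 0, which settles x ≠ 0; continuity gives the origin.
    have hEq : EqOn (fun s : ℝ ↦ C (p.1, (s : ℂ))) (fun _ ↦ 0) (Metric.ball 0 r) := by
      refine EqOn.of_subset_closure (s := Metric.ball 0 r ∩ {0}ᶜ) ?_
        (hC.continuousOn.comp (by fun_prop) hm) continuousOn_const inter_subset_left
        ((dense_compl_singleton (0 : ℝ)).open_subset_closure_inter Metric.isOpen_ball)
      intro s hs
      have := h _ (hm hs.1)
      simpa [show s ≠ 0 from hs.2] using this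
    rw [hpe]
    refine hEq ?_
    have h2 := hp'.2
    rw [hpe] at h2
    simpa using h2
  have hCG : ∀ p ∈ bidisc K r, C p = p.2.im • G p := by
    intro p hp
    have hder : ∀ t ∈ Icc (0 : ℝ) 1,
        HasDerivAt (fun t : ℝ ↦ C (γ (p, t))) (p.2.im • c (γ (p, t))) t := by
      intro t ht
      have h1 : HasFDerivAt C (fderiv ℝ C (γ (p, t))) (γ (p, t)) :=
        ((hC.contDiffAt ((isOpen_bidisc r).mem_nhds (hmaps ⟨hp, ht⟩))).differentiableAt
          (by simp)).hasFDerivAt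
      have h2 : HasDerivAt (fun t : ℝ ↦ γ (p, t)) (0, (p.2.im : ℂ) * Complex.I) t := by
        refine (hasDerivAt_const t p.1).prodMk ?_
        have := (((hasDerivAt_id t).mul_const p.2.im).ofReal_comp.mul_const Complex.I).const_add
          (p.2.re : ℂ)
        simpa using this
      have h3 := h1.comp_hasDerivAt t h2
      refine h3.congr_deriv ?_
      rw [hc, ← map_smul]
      congr 1
      ext <;> simp
    have hint : IntervalIntegrable (fun t ↦ p.2.im • c (γ (p, t))) MeasureTheory.volume 0 1 := by
      refine integrable_slice (g := fun q ↦ p.2.im • c (γ q)) (s := bidisc K r) ?_ hp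
      exact continuousOn_const.smul (hcs.continuousOn.comp hγc.continuous.continuousOn hmaps)
    have h4 := integral_eq_sub_of_hasDerivAt
      (fun t ht ↦ hder t (by rwa [uIcc_of_le zero_le_one] at ht)) hint
    have h5 : C (γ (p, 0)) = 0 := hreal _ (hmaps ⟨hp, by simp⟩) (by simp [hγ])
    have h6 : γ (p, 1) = p := by
      ext1
      · rfl
      · simp [hγ]
    rw [h5, h6, sub_zero, integral_smul] at h4
    exact h4.symm
  refine ⟨G, hGs, ?_, hCG⟩
  refine bidisc_eqOn_of_dense dense_im_ne_zero hB.continuousOn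
    ((Complex.continuous_re.comp continuous_snd).continuousOn.smul hGs.continuousOn) ?_
  intro p hp hpi
  have h1 := h p hp
  rw [hCG p hp, smul_comm] at h1
  exact (smul_right_injective F (show p.2.im ≠ 0 from hpi) h1).symm

theorem circle_mul_mem_bidisc {r : ℝ} {k : K} {ζ : ℂ} (a : Circle) :
    (k, (a : ℂ) * ζ) ∈ bidisc K r ↔ (k, ζ) ∈ bidisc K r := by
  simp [mem_bidisc, Circle.norm_coe]

/-- Invariance kills the derivative in the direction iζ, so x ∂X/∂y = y ∂X/∂x and the two partial
derivatives have a smooth common factor: along ℂ, dX is r dr times `G`. -/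
theorem exists_radial_derivative [CompleteSpace F] {r : ℝ} {X : K × ℂ → F}
    (hX : ContDiffOn ℝ ∞ X (bidisc K r))
    (hinv : ∀ (a : Circle) (k : K) (ζ : ℂ), (k, ζ) ∈ bidisc K r → X (k, a * ζ) = X (k, ζ)) :
    ∃ G : K × ℂ → F, ContDiffOn ℝ ∞ G (bidisc K r) ∧
      ∀ p ∈ bidisc K r, ∀ v : ℂ, fderiv ℝ X p (0, v) = (p.2.re * v.re + p.2.im * v.im) • G p := by
  have hd : ContDiffOn ℝ ∞ (fderiv ℝ X) (bidisc K r) :=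
    hX.fderiv_of_isOpen (isOpen_bidisc r) (m := ∞) (by simp)
  have hrel : ∀ p ∈ bidisc K r, p.2.re • fderiv ℝ X p (0, Complex.I) =
      p.2.im • fderiv ℝ X p (0, 1) := by
    intro p hp
    have h1 : HasFDerivAt X (fderiv ℝ X p) p :=
      ((hX.contDiffAt ((isOpen_bidisc r).mem_nhds hp)).differentiableAt (by simp)).hasFDerivAt
    have h2 : HasDerivAt (fun t : ℝ ↦ (p.1, (Circle.exp t : ℂ) * p.2)) (0, Complex.I * p.2) 0 := by
      refine (hasDerivAt_const 0 p.1).prodMk ?_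
      have : HasDerivAt (fun t : ℝ ↦ Complex.exp (t * Complex.I)) Complex.I 0 := by
        have h := ((hasDerivAt_id (0 : ℝ)).ofReal_comp.mul_const Complex.I).cexp
        simpa using h
      simpa [Circle.coe_exp] using this.mul_const p.2
    have h0 : (fun t : ℝ ↦ (p.1, (Circle.exp t : ℂ) * p.2)) 0 = p := by simp
    have h3 := HasFDerivAt.comp_hasDerivAt (0 : ℝ) (h0.symm ▸ h1) h2
    have h4 : HasDerivAt (X ∘ fun t : ℝ ↦ (p.1, (Circle.exp t : ℂ) * p.2)) 0 0 := by
      have : (X ∘ fun t : ℝ ↦ (p.1, (Circle.exp t : ℂ) * p.2)) = fun _ ↦ X p := by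
        ext t
        exact hinv _ _ _ hp
      rw [this]
      exact hasDerivAt_const _ _
    have h5 := h3.unique h4
    have hv : ((0, Complex.I * p.2) : K × ℂ) = p.2.re • (0, Complex.I) - p.2.im • (0, 1) := by
      ext1
      · simp
      · refine Complex.ext ?_ ?_ <;> simp
    rw [hv, map_sub, map_smul, map_smul, sub_eq_zero] at h5
    rwa [h0] at h5
  obtain ⟨G, hG, h1, h2⟩ := exists_smooth_common_factor (B := fun p ↦ fderiv ℝ X p (0, 1))
    (C := fun p ↦ fderiv ℝ X p (0, Complex.I)) (hd.clm_apply contDiffOn_const)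
    (hd.clm_apply contDiffOn_const) hrel
  refine ⟨G, hG, fun p hp v ↦ ?_⟩
  have hv : ((0, v) : K × ℂ) = v.re • (0, 1) + v.im • (0, Complex.I) := by
    ext1
    · simp
    · simp [Complex.re_add_im]
  rw [hv, map_add, map_smul, map_smul, h1 p hp, h2 p hp, smul_smul, smul_smul, ← add_smul]
  ring_nf

/-- On the ray t ↦ tζ the derivative of g is t‖ζ‖² R(tζ), with R the factor of the radial
derivative. Integrating from the centre, where g vanishes, pulls out ‖ζ‖². -/
theorem exists_smooth_quotient [CompleteSpace F] {r : ℝ} {g : K × ℂ → F}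
    (hg : ContDiffOn ℝ ∞ g (bidisc K r))
    (hinv : ∀ (a : Circle) (k : K) (ζ : ℂ), (k, ζ) ∈ bidisc K r → g (k, a * ζ) = g (k, ζ))
    (h0 : ∀ k, (k, 0) ∈ bidisc K r → g (k, 0) = 0) :
    ∃ G : K × ℂ → F, ContDiffOn ℝ ∞ G (bidisc K r) ∧
      ∀ p ∈ bidisc K r, g p = Complex.normSq p.2 • G p := by
  obtain ⟨R, hR, hRd⟩ := exists_radial_derivative hg hinv
  set γ : (K × ℂ) × ℝ → K × ℂ := fun q ↦ (q.1.1, (q.2 : ℂ) * q.1.2) with hγ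
  have hγc : ContDiff ℝ ∞ γ := by
    have h4 := Complex.ofRealCLM.contDiff (n := ∞) |>.comp (contDiff_snd (E := K × ℂ))
    exact (contDiff_fst.comp contDiff_fst).prodMk (h4.mul (contDiff_snd.comp contDiff_fst))
  have hmaps : MapsTo γ (bidisc K r ×ˢ Icc (0 : ℝ) 1) (bidisc K r) := by
    rintro q ⟨hq, ht⟩
    rw [mem_bidisc] at *
    refine ⟨hq.1, lt_of_le_of_lt ?_ hq.2⟩
    simp only [hγ, norm_mul, Complex.norm_real, Real.norm_eq_abs, abs_of_nonneg ht.1]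
    exact mul_le_of_le_one_left (norm_nonneg _) ht.2
  have hgs : ContDiffOn ℝ ∞ (fun q ↦ q.2 • R (γ q)) (bidisc K r ×ˢ Icc (0 : ℝ) 1) :=
    contDiffOn_snd.smul (hR.comp hγc.contDiffOn hmaps)
  refine ⟨fun p ↦ ∫ t in (0 : ℝ)..1, t • R (γ (p, t)),
    contDiffOn_integral (convex_bidisc r) (isOpen_bidisc r).uniqueDiffOn hgs, fun p hp ↦ ?_⟩
  have hder : ∀ t ∈ Icc (0 : ℝ) 1,
      HasDerivAt (fun t : ℝ ↦ g (γ (p, t))) (Complex.normSq p.2 • t • R (γ (p, t))) t := by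
    intro t ht
    have h1 : HasFDerivAt g (fderiv ℝ g (γ (p, t))) (γ (p, t)) :=
      ((hg.contDiffAt ((isOpen_bidisc r).mem_nhds (hmaps ⟨hp, ht⟩))).differentiableAt
        (by simp)).hasFDerivAt
    have h2 : HasDerivAt (fun t : ℝ ↦ γ (p, t)) (0, p.2) t := by
      refine (hasDerivAt_const t p.1).prodMk ?_
      simpa using (hasDerivAt_id t).ofReal_comp.mul_const p.2
    have h3 := h1.comp_hasDerivAt t h2
    refine h3.congr_deriv ?_
    rw [hRd _ (hmaps ⟨hp, ht⟩), smul_smul]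
    congr 1
    simp [hγ, Complex.normSq_apply]
    ring
  have hint : IntervalIntegrable (fun t ↦ Complex.normSq p.2 • t • R (γ (p, t)))
      MeasureTheory.volume 0 1 :=
    integrable_slice (g := fun q ↦ Complex.normSq p.2 • q.2 • R (γ q)) (s := bidisc K r)
      (hgs.continuousOn.const_smul _) hp
  have h4 := integral_eq_sub_of_hasDerivAt
    (fun t ht ↦ hder t (by rwa [uIcc_of_le zero_le_one] at ht)) hint
  have e0 : γ (p, 0) = (p.1, 0) := by simp [hγ]
  have e1 : γ (p, 1) = p := by simp [hγ]
  have h5 : g (γ (p, 0)) = 0 := by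
    rw [e0]
    exact h0 _ (e0 ▸ hmaps ⟨hp, by simp⟩)
  rw [h5, e1, sub_zero, integral_smul] at h4
  exact h4.symm

end Division

/-! ### Smooth families of alternating maps -/

section Alternating

variable {A E F : Type*} [NormedAddCommGroup A] [NormedSpace ℝ A]
  [NormedAddCommGroup E] [NormedSpace ℝ E] [NormedAddCommGroup F] [NormedSpace ℝ F]
  {k : ℕ} {s : Set A}

theorem contDiffOn_alternating_apply {η : A → E [⋀^Fin k]→L[ℝ] ℝ} {w : Fin k → A → E}
    (hη : ContDiffOn ℝ ∞ η s) (hw : ∀ i, ContDiffOn ℝ ∞ (w i) s) :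
    ContDiffOn ℝ ∞ (fun x ↦ η x (fun i ↦ w i x)) s := by
  have h := (ContinuousAlternatingMap.toContinuousMultilinearMapCLM ℝ :
    (E [⋀^Fin k]→L[ℝ] ℝ) →L[ℝ] _).analyticOnNhd_uncurry_of_multilinear (s := Set.univ)
  exact (h.contDiffOn uniqueDiffOn_univ).comp (hη.prodMk (contDiffOn_pi.2 hw)) (fun _ _ ↦ Set.mem_univ _)

/-- Evaluation of alternating maps on tuples of basis vectors. -/
def evalBasis {ι : Type*} (b : Module.Basis ι ℝ F) (k : ℕ) :
    (F [⋀^Fin k]→L[ℝ] ℝ) →ₗ[ℝ] ((Fin k → ι) → ℝ) where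
  toFun α v := α (fun i ↦ b (v i))
  map_add' _ _ := rfl
  map_smul' _ _ := rfl

theorem evalBasis_injective {ι : Type*} (b : Module.Basis ι ℝ F) :
    Function.Injective (evalBasis b k) := by
  intro α α' h
  apply ContinuousAlternatingMap.toAlternatingMap_injective
  refine AlternatingMap.coe_multilinearMap_injective ?_
  refine Module.Basis.ext_multilinear (fun _ ↦ b) (fun v ↦ ?_)
  exact congrFun h v

theorem exists_left_inverse_evalBasis {ι : Type*} [Finite ι] (b : Module.Basis ι ℝ F) :
    ∃ L : ((Fin k → ι) → ℝ) →L[ℝ] (F [⋀^Fin k]→L[ℝ] ℝ), ∀ α, L (evalBasis b k α) = α := by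
  have := Fintype.ofFinite ι
  obtain ⟨L, hL⟩ := (evalBasis b k).exists_leftInverse_of_injective
    (LinearMap.ker_eq_bot.2 (evalBasis_injective b))
  exact ⟨LinearMap.toContinuousLinearMap L, fun α ↦ LinearMap.congr_fun hL α⟩

/-- Smoothness of a family of alternating maps is checked on coefficients. The set t, where the
family is known, is separate from s, where the coefficients are smooth; in the application t is the
bidisc without its central fibre. -/
theorem exists_contDiffOn_extension {ι : Type*} [Finite ι] (b : Module.Basis ι ℝ F)
    {s t : Set A} {α : A → F [⋀^Fin k]→L[ℝ] ℝ}
    (h : ∀ v : Fin k → ι, ∃ N : A → ℝ, ContDiffOn ℝ ∞ N s ∧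
      ∀ x ∈ t, α x (fun i ↦ b (v i)) = N x) :
    ∃ γ : A → F [⋀^Fin k]→L[ℝ] ℝ, ContDiffOn ℝ ∞ γ s ∧ ∀ x ∈ t, α x = γ x := by
  have := Fintype.ofFinite ι
  obtain ⟨L, hL⟩ := exists_left_inverse_evalBasis (k := k) b
  choose N hN hNt using h
  refine ⟨fun x ↦ L (fun v ↦ N v x), L.contDiff.comp_contDiffOn (contDiffOn_pi.2 hN),
    fun x hx ↦ ?_⟩
  rw [← hL (α x)]
  congr 1
  ext v
  exact hNt v x hx

theorem contDiffOn_alternating_comp [FiniteDimensional ℝ F] {η : A → E [⋀^Fin k]→L[ℝ] ℝ}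
    {l : A → F →L[ℝ] E} (hη : ContDiffOn ℝ ∞ η s) (hl : ContDiffOn ℝ ∞ l s) :
    ContDiffOn ℝ ∞ (fun x ↦ (η x).compContinuousLinearMap (l x)) s := by
  obtain ⟨γ, hγ, h⟩ := exists_contDiffOn_extension (s := s) (t := s) (Module.finBasis ℝ F)
    (α := fun x ↦ (η x).compContinuousLinearMap (l x)) (fun v ↦ ⟨_,
      contDiffOn_alternating_apply (w := fun i x ↦ l x (Module.finBasis ℝ F (v i))) hη
        (fun i ↦ hl.clm_apply contDiffOn_const), fun x hx ↦ rfl⟩)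
  exact hγ.congr h

end Alternating

/-! ### Extension of invariant basic forms over the centre of the disc -/

section Extension

open Function

variable {K E : Type} [NormedAddCommGroup K] [NormedSpace ℝ K]
  [NormedAddCommGroup E] [NormedSpace ℝ E] {k : ℕ}

/-- Only directions in K are allowed: a direction in ℂ would have to be rotated by a. -/
theorem fderiv_circle_invariant {r : ℝ} {X : K × ℂ → E} (hX : ContDiffOn ℝ ∞ X (bidisc K r))
    (hinv : ∀ (a : Circle) (k : K) (ζ : ℂ), (k, ζ) ∈ bidisc K r → X (k, a * ζ) = X (k, ζ))
    (a : Circle) {κ : K} {ζ : ℂ} (h : (κ, ζ) ∈ bidisc K r) (u : K) :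
    fderiv ℝ X (κ, a * ζ) (u, 0) = fderiv ℝ X (κ, ζ) (u, 0) := by
  have key : ∀ z : ℂ, (κ, z) ∈ bidisc K r →
      HasFDerivAt (fun κ' ↦ X (κ', z))
        ((fderiv ℝ X (κ, z)).comp (ContinuousLinearMap.inl ℝ K ℂ)) κ := by
    intro z hz
    have h1 : HasFDerivAt X (fderiv ℝ X (κ, z)) (κ, z) :=
      ((hX.contDiffAt ((isOpen_bidisc r).mem_nhds hz)).differentiableAt (by simp)).hasFDerivAt
    exact h1.comp κ ((hasFDerivAt_id κ).prodMk (hasFDerivAt_const z κ))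
  have h1 := key _ ((circle_mul_mem_bidisc a).2 h)
  have h2 := key _ h
  have h3 : (fun κ' ↦ X (κ', a * ζ)) =ᶠ[𝓝 κ] fun κ' ↦ X (κ', ζ) := by
    have : {κ' | (κ', ζ) ∈ bidisc K r} ∈ 𝓝 κ :=
      ((isOpen_bidisc r).preimage (by fun_prop : Continuous fun κ' : K ↦ (κ', ζ))).mem_nhds h
    filter_upwards [this] with κ' hκ'
    exact hinv a κ' ζ hκ'
  have h4 := (h1.congr_of_eventuallyEq h3.symm).unique h2
  exact congrArg (fun l : K →L[ℝ] E ↦ l u) h4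

/-- This is (x e − (y/N) ξ) ∧ (y e + (x/N) ξ) = ((x² + y²)/N) e ∧ ξ, that is, r dr ∧ dθ = dx ∧ dy.
-/
theorem map_update_update_rotation (f : E [⋀^Fin k]→L[ℝ] ℝ) (w : Fin k → E) {i j : Fin k}
    (hij : i ≠ j) (e ξ : E) {x y N : ℝ} (hN : N ≠ 0) (hxy : x * x + y * y = N) :
    f (update (update w i (x • e + (-y / N) • ξ)) j (y • e + (x / N) • ξ)) =
      f (update (update w i e) j ξ) := by
  have hself : ∀ v, f (update (update w i v) j v) = 0 := fun v ↦
    f.map_eq_zero_of_eq _ (i := i) (j := j) (by simp [hij]) hij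
  have hswap : f (update (update w i ξ) j e) = - f (update (update w i e) j ξ) := by
    have h := hself (e + ξ)
    rw [f.map_update_add, update_comm hij, update_comm hij, f.map_update_add, f.map_update_add,
      update_comm hij.symm, update_comm hij.symm, update_comm hij.symm, update_comm hij.symm,
      hself, hself] at h
    linarith
  rw [f.map_update_add, update_comm hij, update_comm hij, f.map_update_add, f.map_update_add,
    update_comm hij.symm, update_comm hij.symm, update_comm hij.symm, update_comm hij.symm]
  simp only [f.map_update_smul]
  rw [update_comm hij, update_comm hij, update_comm hij, update_comm hij]
  simp only [f.map_update_smul]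
  rw [update_comm hij.symm, update_comm hij.symm, update_comm hij.symm, update_comm hij.symm,
      hself, hself, hswap]
  simp only [smul_eq_mul]
  field_simp
  rw [← hxy]
  ring

/-- The one-form `dθ` on the punctured plane. -/
def angular (z v : ℂ) : ℝ := (z.re * v.im - z.im * v.re) / Complex.normSq z

/-- The singularity of dθ at ζ = 0 cancels coefficient by coefficient, according to how many of the
basis vectors 1, i of ℂ occur among the arguments. With none, dθ does not enter. With one, `hor`
makes the coefficient of dθ divisible by ‖ζ‖². With both, the coefficient is that of e ∧ ξ, with e
the radial factor of dX. -/
theorem exists_form_extension [FiniteDimensional ℝ K] [CompleteSpace E] {r : ℝ}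
    {η : K × ℂ → E [⋀^Fin k]→L[ℝ] ℝ} {X ξ : K × ℂ → E}
    (hη : ContDiffOn ℝ ∞ η (bidisc K r)) (hX : ContDiffOn ℝ ∞ X (bidisc K r))
    (hξ : ContDiffOn ℝ ∞ ξ (bidisc K r))
    (hηi : ∀ (a : Circle) (k : K) (ζ : ℂ), (k, ζ) ∈ bidisc K r → η (k, a * ζ) = η (k, ζ))
    (hXi : ∀ (a : Circle) (k : K) (ζ : ℂ), (k, ζ) ∈ bidisc K r → X (k, a * ζ) = X (k, ζ))
    (hξi : ∀ (a : Circle) (k : K) (ζ : ℂ), (k, ζ) ∈ bidisc K r → ξ (k, a * ζ) = ξ (k, ζ))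
    (hor : ∀ κ, (κ, 0) ∈ bidisc K r → ∀ w : Fin k → E,
      (∀ i, w i = ξ (κ, 0) ∨ ∃ u, w i = fderiv ℝ X (κ, 0) (u, 0)) → (∃ i, w i = ξ (κ, 0)) →
      η (κ, 0) w = 0) :
    ∃ γ : K × ℂ → (K × ℂ) [⋀^Fin k]→L[ℝ] ℝ, ContDiffOn ℝ ∞ γ (bidisc K r) ∧
      ∀ p ∈ bidisc K r, p.2 ≠ 0 → ∀ v, γ p v =
        η p (fun i ↦ fderiv ℝ X p (v i) + angular p.2 (v i).2 • ξ p) := by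
  obtain ⟨e, he, hXe⟩ := exists_radial_derivative hX hXi
  have hdX : ContDiffOn ℝ ∞ (fderiv ℝ X) (bidisc K r) :=
    hX.fderiv_of_isOpen (isOpen_bidisc r) (m := ∞) (by simp)
  set b := (Module.finBasis ℝ K).prod Complex.basisOneI with hb
  set τ : ℂ → (K × ℂ) →L[ℝ] ℝ := fun z ↦
    ((z.re / Complex.normSq z) • Complex.imCLM - (z.im / Complex.normSq z) • Complex.reCLM).comp
      (ContinuousLinearMap.snd ℝ K ℂ) with hτ
  have hτa : ∀ z v, τ z v = angular z v.2 := by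
    intro z v
    simp [hτ, angular]
    ring
  set J : K × ℂ → (K × ℂ) →L[ℝ] E := fun p ↦ fderiv ℝ X p + (τ p.2).smulRight (ξ p) with hJ
  suffices hext : ∀ c : Fin k → Fin (Module.finrank ℝ K) ⊕ Fin 2,
      ∃ N : K × ℂ → ℝ, ContDiffOn ℝ ∞ N (bidisc K r) ∧
        ∀ p ∈ {p | p ∈ bidisc K r ∧ p.2 ≠ 0},
          ((η p).compContinuousLinearMap (J p)) (fun i ↦ b (c i)) = N p by
    obtain ⟨γ, hγ, hγe⟩ := exists_contDiffOn_extension b hext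
    refine ⟨γ, hγ, fun p hp hp0 v ↦ ?_⟩
    rw [← hγe p ⟨hp, hp0⟩]
    simp [hJ, hτa, comp_def]
  intro c
  have hA : ∀ i, ContDiffOn ℝ ∞ (fun p ↦ fderiv ℝ X p (b (c i))) (bidisc K r) :=
    fun i ↦ hdX.clm_apply contDiffOn_const
  have hJc : ∀ p i, J p (b (c i)) = fderiv ℝ X p (b (c i)) + angular p.2 (b (c i)).2 • ξ p := by
    intro p i
    simp [hJ, hτa]
  have hinl : ∀ j : Fin (Module.finrank ℝ K), b (Sum.inl j) = (Module.finBasis ℝ K j, 0) := by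
    intro j; simp [hb]
  have hinr : ∀ j : Fin 2, b (Sum.inr j) = (0, Complex.basisOneI j) := by
    intro j; simp [hb]
  -- A repeated basis vector gives zero, so each of 1 and i may be assumed to occupy at most one
  -- slot.
  by_cases hc : Injective c
  swap
  · refine ⟨fun _ ↦ 0, contDiffOn_const, fun p hp ↦ ?_⟩
    refine ContinuousAlternatingMap.map_eq_zero_of_not_injective _ _ (fun h ↦ hc ?_)
    exact fun i j hij ↦ h (by simp [hij])
  -- The case of exactly one argument from ℂ.
  have single : ∀ i j, c i = Sum.inr j → (∀ i' ≠ i, ∃ l, c i' = Sum.inl l) →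
      ∃ N : K × ℂ → ℝ, ContDiffOn ℝ ∞ N (bidisc K r) ∧
      ∀ p ∈ {p | p ∈ bidisc K r ∧ p.2 ≠ 0},
        ((η p).compContinuousLinearMap (J p)) (fun i ↦ b (c i)) = N p := by
    intro i j hij hi'
    set w : K × ℂ → Fin k → E := fun p i ↦ fderiv ℝ X p (b (c i)) with hw
    have hcomp : ∀ i', ContDiffOn ℝ ∞ (fun p ↦ update (w p) i (ξ p) i') (bidisc K r) := by
      intro i'
      by_cases h : i' = i
      · subst h; simpa using hξ
      · simpa [h] using hA i'
    have hwinv : ∀ (a : Circle) (κ : K) (ζ : ℂ), (κ, ζ) ∈ bidisc K r →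
        update (w (κ, a * ζ)) i (ξ (κ, a * ζ)) = update (w (κ, ζ)) i (ξ (κ, ζ)) := by
      intro a κ ζ h
      ext1 i'
      by_cases h' : i' = i
      · subst h'; simpa using hξi a κ ζ h
      · obtain ⟨l, hl⟩ := hi' i' h'
        simp only [ne_eq, h', not_false_eq_true, update_of_ne, hw, hl, hinl]
        exact fderiv_circle_invariant hX hXi a h _
    -- With ξ in slot i and derivatives along K in the others, the coefficient is rotation invariant
    -- and vanishes at the centre by `hor`.
    obtain ⟨G, hG, hGe⟩ := exists_smooth_quotient
      (g := fun p ↦ η p (update (w p) i (ξ p))) (contDiffOn_alternating_apply hη hcomp)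
      (fun a κ ζ h ↦ by simp only [hηi a κ ζ h, hwinv a κ ζ h]) (fun κ h ↦ by
        refine hor κ h _ (fun i' ↦ ?_) ⟨i, by simp⟩
        by_cases h' : i' = i
        · subst h'; exact Or.inl (by simp)
        · obtain ⟨l, hl⟩ := hi' i' h'
          exact Or.inr ⟨Module.finBasis ℝ K l, by simp [h', hw, hl, hinl]⟩)
    -- The factor ‖ζ‖² in front of `G` has cancelled the denominator of dθ, leaving x dy − y dx.
    refine ⟨fun p ↦ η p (w p) +
      (p.2.re * (Complex.basisOneI j).im - p.2.im * (Complex.basisOneI j).re) * G p,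
      (contDiffOn_alternating_apply hη hA).add (ContDiffOn.mul ?_ hG), ?_⟩
    · refine ContDiff.contDiffOn (ContDiff.sub ?_ ?_)
      · exact (Complex.reCLM.contDiff.comp contDiff_snd).mul contDiff_const
      · exact (Complex.imCLM.contDiff.comp contDiff_snd).mul contDiff_const
    · rintro p ⟨hp, hp0⟩
      have hN : Complex.normSq p.2 ≠ 0 := by simpa using hp0
      have e1 : (fun i' ↦ J p (b (c i'))) =
          update (w p) i (w p i + angular p.2 (Complex.basisOneI j) • ξ p) := by
        ext1 i'
        by_cases h' : i' = i
        · subst h'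
          rw [update_self, hJc, hij, hinr]
          simp [hw, hij, hinr]
        · obtain ⟨l, hl⟩ := hi' i' h'
          rw [update_of_ne h', hJc, hl, hinl]
          simp [hw, hl, hinl, angular]
      have e2 := hGe p hp
      simp only [smul_eq_mul] at e2
      change η p (fun i' ↦ J p (b (c i'))) = _
      rw [e1, ContinuousAlternatingMap.map_update_add, ContinuousAlternatingMap.map_update_smul,
        update_eq_self, e2, smul_eq_mul, angular]
      field_simp
  by_cases h0 : ∃ i, c i = Sum.inr 0 <;> by_cases h1 : ∃ i, c i = Sum.inr 1
  · obtain ⟨i, hi⟩ := h0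
    obtain ⟨j, hj⟩ := h1
    have hij : i ≠ j := by
      rintro rfl
      rw [hi] at hj
      simp at hj
    set w : K × ℂ → Fin k → E := fun p i ↦ fderiv ℝ X p (b (c i)) with hw
    have hcomp : ∀ i', ContDiffOn ℝ ∞
        (fun p ↦ update (update (w p) i (e p)) j (ξ p) i') (bidisc K r) := by
      intro i'
      by_cases h : i' = j
      · subst h; simpa using hξ
      · by_cases h' : i' = i
        · subst h'; simpa [h] using he
        · simpa [h, h'] using hA i'
    -- The witness is η evaluated with e in the slot of 1 and ξ in the slot of i; it involves no
    -- division.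
    refine ⟨_, contDiffOn_alternating_apply hη hcomp, ?_⟩
    rintro p ⟨hp, hp0⟩
    have hN : Complex.normSq p.2 ≠ 0 := by simpa using hp0
    change η p (fun i' ↦ J p (b (c i'))) = η p (update (update (w p) i (e p)) j (ξ p))
    rw [← map_update_update_rotation (η p) (w p) hij (e p) (ξ p) hN
      (Complex.normSq_apply p.2).symm]
    congr 1
    ext1 i'
    by_cases h : i' = j
    · subst h
      rw [update_self, hJc, hj, hinr, hXe p hp]
      simp [angular]
    · rw [update_of_ne h]
      by_cases h' : i' = i
      · subst h'
        rw [update_self, hJc, hi, hinr, hXe p hp]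
        simp [angular]
      · rw [update_of_ne h', hJc]
        obtain ⟨l, hl⟩ : ∃ l, c i' = Sum.inl l := by
          rcases hci : c i' with l | l
          · exact ⟨l, rfl⟩
          · fin_cases l
            · exact absurd (hc (hci.trans hi.symm)) h'
            · exact absurd (hc (hci.trans hj.symm)) h
        simp [hw, hl, hinl, angular]
  · obtain ⟨i, hi⟩ := h0
    refine single i 0 hi (fun i' hi' ↦ ?_)
    rcases hci : c i' with l | l
    · exact ⟨l, rfl⟩
    · fin_cases l
      · exact absurd (hc (hci.trans hi.symm)) hi'
      · exact absurd ⟨i', hci⟩ h1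
  · obtain ⟨i, hi⟩ := h1
    refine single i 1 hi (fun i' hi' ↦ ?_)
    rcases hci : c i' with l | l
    · exact ⟨l, rfl⟩
    · fin_cases l
      · exact absurd ⟨i', hci⟩ h0
      · exact absurd (hc (hci.trans hi.symm)) hi'
  · refine ⟨_, contDiffOn_alternating_apply hη hA, ?_⟩
    rintro p ⟨hp, hp0⟩
    change η p (fun i' ↦ J p (b (c i'))) = _
    congr 1
    ext1 i'
    rw [hJc]
    rcases hci : c i' with l | l
    · simp [hinl, angular]
    · fin_cases l
      · exact absurd ⟨i', hci⟩ h0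
      · exact absurd ⟨i', hci⟩ h1

end Extension

/-! ### The circle action near the boundary -/

section Action

open Set Filter

variable {n : ℕ} [NeZero n] {M : Type*} [TopologicalSpace M] [ChartedSpace (EuclideanHalfSpace n) M]
  {U : TopologicalSpace.Opens M} [MulAction Circle U]

theorem act_of_mem (a : Circle) {x : M} (hx : x ∈ U) :
    act U a x = ((a • (⟨x, hx⟩ : U) : U) : M) := by
  simp [act, hx]

theorem act_of_notMem (a : Circle) {x : M} (hx : x ∉ U) : act U a x = x := by
  simp [act, hx]

theorem act_mem (a : Circle) {x : M} (hx : x ∈ U) : act U a x ∈ U := by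
  rw [act_of_mem a hx]
  exact Subtype.coe_prop _

theorem act_one (x : M) : act U 1 x = x := by
  by_cases hx : x ∈ U
  · rw [act_of_mem 1 hx, one_smul]
  · exact act_of_notMem 1 hx

theorem act_mul (a b : Circle) (x : M) : act U (a * b) x = act U a (act U b x) := by
  by_cases hx : x ∈ U
  · rw [act_of_mem _ hx, act_of_mem a (act_mem b hx), mul_smul]
    congr 2
    exact Subtype.ext (act_of_mem b hx).symm
  · rw [act_of_notMem _ hx, act_of_notMem b hx, act_of_notMem a hx]

theorem act_inv_act (a : Circle) (x : M) : act U a⁻¹ (act U a x) = x := by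
  rw [← act_mul, inv_mul_cancel, act_one]

theorem act_act_inv (a : Circle) (x : M) : act U a (act U a⁻¹ x) = x := by
  rw [← act_mul, mul_inv_cancel, act_one]

theorem IsInvariantNhd.act_mem {V : Set M} (hV : IsInvariantNhd n U V) (a : Circle) {x : M}
    (hx : x ∈ V) : act U a x ∈ V := by
  rw [act_of_mem a (hV.subset hx)]
  exact hV.invariant a ⟨x, hV.subset hx⟩ hx

theorem IsInvariantNhd.inter {V W : Set M} (hV : IsInvariantNhd n U V)
    (hW : IsInvariantNhd n U W) : IsInvariantNhd n U (V ∩ W) where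
  isOpen := hV.isOpen.inter hW.isOpen
  boundary_subset := subset_inter hV.boundary_subset hW.boundary_subset
  subset := inter_subset_left.trans hV.subset
  invariant a x hx := ⟨hV.invariant a x hx.1, hW.invariant a x hx.2⟩

variable [IsManifold (𝓡∂ n) ∞ M] (hU : IsFreeActionNearBoundary n U)
include hU

theorem eq_one_of_act_eq {a : Circle} {x : M} (hx : x ∈ U) (h : act U a x = x) : a = 1 := by
  rw [act_of_mem a hx] at h
  exact hU.free a ⟨x, hx⟩ (Subtype.ext h)

theorem contMDiffAt_act {p : Circle × M} (hp : p.2 ∈ U) :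
    ContMDiffAt ((𝓡 1).prod (𝓡∂ n)) (𝓡∂ n) ∞ (fun p : Circle × M ↦ act U p.1 p.2) p := by
  classical
  -- A left inverse of the inclusion of U. Its values off U do not matter since U is open.
  set ι : M → U := fun x ↦ if hx : x ∈ U then ⟨x, hx⟩ else ⟨p.2, hp⟩ with hι
  have hιs : ContMDiffAt (𝓡∂ n) (𝓡∂ n) ∞ ι p.2 := by
    rw [show p.2 = ((⟨p.2, hp⟩ : U) : M) from rfl, ← contMDiffAt_subtype_iff]
    have : (fun x : U ↦ ι x) = id := by
      ext x
      simp [hι]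
    rw [this]
    exact contMDiffAt_id
  have h1 : ContMDiffAt ((𝓡 1).prod (𝓡∂ n)) ((𝓡 1).prod (𝓡∂ n)) ∞
      (fun q : Circle × M ↦ (q.1, ι q.2)) p :=
    contMDiffAt_fst.prodMk (hιs.comp p contMDiffAt_snd)
  have h2 := contMDiff_subtype_val.contMDiffAt.comp p (hU.smooth.contMDiffAt.comp p h1)
  refine h2.congr_of_eventuallyEq ?_
  have : ∀ᶠ q : Circle × M in 𝓝 p, q.2 ∈ U :=
    continuous_snd.continuousAt.eventually (U.isOpen.mem_nhds hp)
  filter_upwards [this] with q hq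
  simp [act, hq, hι]

section Comp

variable {E' : Type*} [NormedAddCommGroup E'] [NormedSpace ℝ E'] {H' : Type*} [TopologicalSpace H']
  {J : ModelWithCorners ℝ E' H'} {N : Type*} [TopologicalSpace N] [ChartedSpace H' N]

theorem contMDiffAt_act_comp {a : N → Circle} {g : N → M} {y : N}
    (ha : ContMDiffAt J (𝓡 1) ∞ a y) (hg : ContMDiffAt J (𝓡∂ n) ∞ g y) (hy : g y ∈ U) :
    ContMDiffAt J (𝓡∂ n) ∞ (fun z ↦ act U (a z) (g z)) y :=
  (contMDiffAt_act hU (p := (a y, g y)) hy).comp y (ha.prodMk hg)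

theorem contMDiffWithinAt_act_comp {a : N → Circle} {g : N → M} {s : Set N} {y : N}
    (ha : ContMDiffWithinAt J (𝓡 1) ∞ a s y) (hg : ContMDiffWithinAt J (𝓡∂ n) ∞ g s y)
    (hy : g y ∈ U) : ContMDiffWithinAt J (𝓡∂ n) ∞ (fun z ↦ act U (a z) (g z)) s y :=
  (contMDiffAt_act hU (p := (a y, g y)) hy).comp_contMDiffWithinAt y (ha.prodMk hg)

end Comp

theorem continuousAt_act_comp {Y : Type*} [TopologicalSpace Y] {a : Y → Circle} {g : Y → M} {y : Y}
    (ha : ContinuousAt a y) (hg : ContinuousAt g y) (hy : g y ∈ U) :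
    ContinuousAt (fun z ↦ act U (a z) (g z)) y :=
  ContinuousAt.comp (g := fun p : Circle × M ↦ act U p.1 p.2) (f := fun z ↦ (a z, g z))
    (contMDiffAt_act hU (p := (a y, g y)) hy).continuousAt (ha.prodMk hg)

theorem contMDiffAt_act_const (a : Circle) {x : M} (hx : x ∈ U) :
    ContMDiffAt (𝓡∂ n) (𝓡∂ n) ∞ (act U a) x :=
  contMDiffAt_act_comp hU contMDiffAt_const contMDiffAt_id hx

theorem mfderiv_act_comp_inv (a : Circle) {x : M} (hx : x ∈ U) :
    (mfderiv (𝓡∂ n) (𝓡∂ n) (act U a) (act U a⁻¹ x)).comp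
      (mfderiv (𝓡∂ n) (𝓡∂ n) (act U a⁻¹) x) = ContinuousLinearMap.id ℝ _ := by
  have h1 := (contMDiffAt_act_const hU a⁻¹ hx).mdifferentiableAt (by simp)
  have h2 := (contMDiffAt_act_const hU a (act_mem a⁻¹ hx)).mdifferentiableAt (by simp)
  rw [← mfderiv_comp x h2 h1]
  have : act U a ∘ act U a⁻¹ = id := funext fun y ↦ act_act_inv a y
  rw [this, mfderiv_id]

/-- A translation has an invertible differential, and a map with surjective differential sends
interior points to interior points. This is what makes the boundary invariant. -/
theorem isInteriorPoint_act (a : Circle) {x : M} (hx : x ∈ U)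
    (h : (𝓡∂ n).IsInteriorPoint x) : (𝓡∂ n).IsInteriorPoint (act U a x) := by
  refine ((contMDiffAt_act_const hU a hx).mdifferentiableAt
    (by simp)).isInteriorPoint_of_surjective_mfderiv ?_ h
  have h1 := mfderiv_act_comp_inv hU a (act_mem a hx)
  rw [act_inv_act] at h1
  intro v
  exact ⟨_, congrArg (fun l : TangentSpace (𝓡∂ n) (act U a x) →L[ℝ] _ ↦ l v) h1⟩

theorem act_mem_boundary (a : Circle) {x : M} :
    act U a x ∈ (𝓡∂ n).boundary M ↔ x ∈ (𝓡∂ n).boundary M := by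
  have key : ∀ (a : Circle) (x : M), x ∈ (𝓡∂ n).boundary M → act U a x ∈ (𝓡∂ n).boundary M := by
    intro a x hx
    have hxU : x ∈ U := hU.boundary_subset hx
    rw [← ModelWithCorners.compl_interior] at hx ⊢
    intro h
    apply hx
    have h2 := isInteriorPoint_act hU a⁻¹ (act_mem a hxU) h
    rwa [act_inv_act] at h2
  exact ⟨fun h ↦ by simpa [act_inv_act] using key a⁻¹ _ h, key a x⟩

omit hU [IsManifold (𝓡∂ n) ∞ M] in
theorem cutMap_eq_iff {x y : M} : cutMap n U x = cutMap n U y ↔ x = y ∨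
    (x ∈ (𝓡∂ n).boundary M ∧ y ∈ (𝓡∂ n).boundary M ∧
      ∃ (u v : U) (a : Circle), (u : M) = x ∧ (v : M) = y ∧ a • u = v) :=
  Quotient.eq (r := cutSetoid n U)

theorem cutMap_eq_iff_act {x y : M} : cutMap n U x = cutMap n U y ↔ x = y ∨
    (x ∈ (𝓡∂ n).boundary M ∧ ∃ a : Circle, y = act U a x) := by
  rw [cutMap_eq_iff]
  refine or_congr_right ⟨?_, ?_⟩
  · rintro ⟨hx, hy, u, v, a, rfl, rfl, rfl⟩
    exact ⟨hx, a, by rw [act_of_mem a u.2]⟩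
  · rintro ⟨hx, a, rfl⟩
    have hxU : x ∈ U := hU.boundary_subset hx
    exact ⟨hx, (act_mem_boundary hU a).2 hx, ⟨x, hxU⟩, ⟨_, act_mem a hxU⟩, a, rfl, rfl,
      Subtype.ext (act_of_mem a hxU).symm⟩

theorem cutMap_act_of_boundary {x : M} (hx : x ∈ (𝓡∂ n).boundary M) (a : Circle) :
    cutMap n U (act U a x) = cutMap n U x :=
  ((cutMap_eq_iff_act hU).2 (Or.inr ⟨hx, a, rfl⟩)).symm

theorem eq_of_cutMap_eq {x y : M} (hx : x ∈ (𝓡∂ n).interior M)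
    (h : cutMap n U x = cutMap n U y) : x = y := by
  rcases (cutMap_eq_iff_act hU).1 h with h | ⟨h, -⟩
  · exact h
  · rw [← ModelWithCorners.compl_boundary] at hx
    exact absurd h hx

/-- The set of points whose orbit is contained in an open set `O` is open. -/
theorem isOpen_setOf_orbit_subset {O : Set M} (hO : IsOpen O) :
    IsOpen {x | x ∈ U ∧ ∀ a : Circle, act U a x ∈ O} := by
  rw [isOpen_iff_mem_nhds]
  rintro x ⟨hx, h⟩
  have h1 : ∀ᶠ y in 𝓝 x, ∀ a ∈ (univ : Set Circle), act U a y ∈ O := by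
    refine isCompact_univ.eventually_forall_of_forall_eventually (P := fun y a ↦ act U a y ∈ O) ?_
    intro a _
    exact (continuousAt_act_comp hU (a := fun z : M × Circle ↦ z.2) (g := fun z : M × Circle ↦ z.1)
      (y := (x, a)) continuousAt_snd continuousAt_fst hx).eventually (hO.mem_nhds (h a))
  filter_upwards [h1, U.isOpen.mem_nhds hx] with y hy hyU
  exact ⟨hyU, fun a ↦ hy a (mem_univ a)⟩

/-- The points whose whole orbit lies in O form an invariant set, open because the circle is
compact. -/
theorem exists_isInvariantNhd_subset {O : Set M} (hO : IsOpen O)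
    (h : (𝓡∂ n).boundary M ⊆ O) : ∃ V ⊆ O, IsInvariantNhd n U V := by
  refine ⟨{x | x ∈ U ∧ ∀ a : Circle, act U a x ∈ O}, fun x hx ↦ ?_,
    isOpen_setOf_orbit_subset hU hO, fun x hx ↦ ⟨hU.boundary_subset hx, fun a ↦ ?_⟩,
    fun x hx ↦ hx.1, fun a x hx ↦ ⟨Subtype.coe_prop _, fun b ↦ ?_⟩⟩
  · simpa [act_one] using hx.2 1
  · exact h ((act_mem_boundary hU a).2 hx)
  · have := hx.2 (b * a)
    rwa [act_mul, act_of_mem a x.2] at this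

omit hU [IsManifold (𝓡∂ n) ∞ M] in
theorem IsInvariantBoundaryDefining.exists_nhd {f : M → ℝ}
    (hf : IsInvariantBoundaryDefining n U f) :
    ∃ V : Set M, IsInvariantNhd n U V ∧ ∀ a, ∀ x ∈ V, f (act U a x) = f x := by
  obtain ⟨V, hV, h⟩ := hf.invariant
  exact ⟨V, hV, fun a x hx ↦ by rw [act_of_mem a (hV.subset hx), h a ⟨x, _⟩ hx]⟩

end Action

/-! ### Averages of smooth functions on manifolds -/

section Average

open Set Filter

variable {E F : Type} [NormedAddCommGroup E] [NormedSpace ℝ E] [NormedAddCommGroup F]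
  [NormedSpace ℝ F] [CompleteSpace F] {H : Type*} [TopologicalSpace H] {I : ModelWithCorners ℝ E H}
  {N : Type*} [TopologicalSpace N] [ChartedSpace H N] [IsManifold I ∞ N]

/-- A ball intersected with the range of the model: not open at boundary points, but convex and with
unique derivatives, as the integral lemmas require. -/
theorem exists_convex_chart_nhd {V : Set N} (hV : IsOpen V) {x : N} (hx : x ∈ V) :
    ∃ s : Set E, Convex ℝ s ∧ UniqueDiffOn ℝ s ∧ s ⊆ (extChartAt I x).target ∧
      s ∈ 𝓝[range I] (extChartAt I x x) ∧ extChartAt I x x ∈ s ∧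
      MapsTo (extChartAt I x).symm s V := by
  have h1 : (extChartAt I x).target ∩ (extChartAt I x).symm ⁻¹' V ∈ 𝓝[range I] (extChartAt I x x) :=
    inter_mem (extChartAt_target_mem_nhdsWithin x) (mem_nhdsWithin_of_mem_nhds
      ((continuousAt_extChartAt_symm x).preimage_mem_nhds
        (by rw [extChartAt_to_inv]; exact hV.mem_nhds hx)))
  obtain ⟨ε, hε, hb⟩ := Metric.mem_nhdsWithin_iff.1 h1
  refine ⟨Metric.ball (extChartAt I x x) ε ∩ range I, (convex_ball _ _).inter I.convex_range,
    ?_, fun y hy ↦ (hb hy).1, inter_mem (mem_nhdsWithin_of_mem_nhds (Metric.ball_mem_nhds _ hε)) self_mem_nhdsWithin,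
    ⟨Metric.mem_ball_self hε, mem_range_self _⟩, fun y hy ↦ (hb hy).2⟩
  rw [inter_comm]
  exact I.uniqueDiffOn.inter Metric.isOpen_ball

theorem contDiffOn_chart_slice {G : N × ℝ → F} {V : Set N}
    (hG : ContMDiffOn (I.prod 𝓘(ℝ, ℝ)) 𝓘(ℝ, F) ∞ G (V ×ˢ Icc (0 : ℝ) 1)) {x : N} {s : Set E}
    (hs : s ⊆ (extChartAt I x).target) (hsV : MapsTo (extChartAt I x).symm s V) :
    ContDiffOn ℝ ∞ (fun q : E × ℝ ↦ G ((extChartAt I x).symm q.1, q.2)) (s ×ˢ Icc (0 : ℝ) 1) := by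
  rw [← contMDiffOn_iff_contDiffOn]
  refine hG.comp (ContMDiffOn.prodMk ?_ ?_) (fun q hq ↦ ⟨hsV hq.1, hq.2⟩)
  · exact (contMDiffOn_extChartAt_symm x).comp
      (contDiff_fst.contMDiff.contMDiffOn) (fun q hq ↦ hs hq.1)
  · exact contDiff_snd.contMDiff.contMDiffOn

theorem contMDiffOn_integral {G : N × ℝ → F} {V : Set N} (hV : IsOpen V)
    (hG : ContMDiffOn (I.prod 𝓘(ℝ, ℝ)) 𝓘(ℝ, F) ∞ G (V ×ˢ Icc (0 : ℝ) 1)) :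
    ContMDiffOn I 𝓘(ℝ, F) ∞ (fun x ↦ ∫ t in (0 : ℝ)..1, G (x, t)) V := by
  intro x hx
  apply ContMDiffAt.contMDiffWithinAt
  obtain ⟨s, hc, hu, hst, hsn, hxs, hsV⟩ := exists_convex_chart_nhd (I := I) hV hx
  have h1 := contDiffOn_integral hc hu (contDiffOn_chart_slice hG hst hsV)
  have h2 : ContMDiffWithinAt 𝓘(ℝ, E) 𝓘(ℝ, F) ∞
      (fun y ↦ ∫ t in (0 : ℝ)..1, G ((extChartAt I x).symm y, t)) s (extChartAt I x x) :=
    (h1 _ hxs).contMDiffWithinAt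
  have h3 : ∀ᶠ z in 𝓝 x, extChartAt I x z ∈ s := by
    rw [← map_extChartAt_nhds] at hsn
    exact hsn
  have h4 : ContMDiffWithinAt I 𝓘(ℝ, F) ∞ ((fun y ↦ ∫ t in (0 : ℝ)..1,
      G ((extChartAt I x).symm y, t)) ∘ extChartAt I x) (extChartAt I x ⁻¹' s) x :=
    h2.comp x contMDiffAt_extChartAt.contMDiffWithinAt (fun z hz ↦ hz)
  refine (h4.contMDiffAt h3).congr_of_eventuallyEq ?_
  filter_upwards [extChartAt_source_mem_nhds (I := I) x] with z hz
  simp only [Function.comp_apply, (extChartAt I x).left_inv hz]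

variable (I) in
/-- The derivative at `x` of a vector valued function in the preferred chart at `x`. -/
def chartDeriv (g : N → F) (x : N) : E →L[ℝ] F :=
  fderivWithin ℝ (fun y ↦ g ((extChartAt I x).symm y)) (range I) (extChartAt I x x)

theorem mfderiv_apply_eq_chartDeriv {g : N → F} {x : N} (hg : MDifferentiableAt I 𝓘(ℝ, F) g x)
    (v : TangentSpace I x) : mfderiv I 𝓘(ℝ, F) g x v = chartDeriv I g x v := by
  simp only [mfderiv, hg]
  rfl

theorem hasFDerivWithinAt_chartDeriv {g : N → F} {x : N} (hg : MDifferentiableAt I 𝓘(ℝ, F) g x) :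
    HasFDerivWithinAt (fun y ↦ g ((extChartAt I x).symm y))
      (chartDeriv I g x) (range I) (extChartAt I x x) :=
  hg.differentiableWithinAt_writtenInExtChartAt.hasFDerivWithinAt

/-- The derivative of an average is the average of the derivatives. The integrand is exposed as a
function continuous on [0, 1] so that pointwise positivity can be integrated. -/
theorem chartDeriv_integral_apply {G : N × ℝ → F} {V : Set N} (hV : IsOpen V)
    (hG : ContMDiffOn (I.prod 𝓘(ℝ, ℝ)) 𝓘(ℝ, F) ∞ G (V ×ˢ Icc (0 : ℝ) 1)) {x : N} (hx : x ∈ V)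
    (hd : ∀ t ∈ Icc (0 : ℝ) 1, MDifferentiableAt I 𝓘(ℝ, F) (fun z ↦ G (z, t)) x)
    (v : E) :
    ∃ d : ℝ → F, ContinuousOn d (Icc 0 1) ∧
      (∀ t ∈ Icc (0 : ℝ) 1, d t = chartDeriv I (fun z ↦ G (z, t)) x v) ∧
      chartDeriv I (fun z ↦ ∫ t in (0 : ℝ)..1, G (z, t)) x v =
        ∫ t in (0 : ℝ)..1, d t := by
  obtain ⟨s, hc, hu, hst, hsn, hxs, hsV⟩ := exists_convex_chart_nhd (I := I) hV hx
  have hg := contDiffOn_chart_slice hG hst hsV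
  set g : E × ℝ → F := fun q ↦ G ((extChartAt I x).symm q.1, q.2) with hgdef
  have hg1 : ContDiffOn ℝ 1 g (s ×ˢ Icc (0 : ℝ) 1) := hg.of_le (by simp)
  have hsr : s ⊆ range I := hst.trans (extChartAt_target_subset_range x)
  have h1 := hasFDerivWithinAt_integral hc hu hg1 hxs
  have h2 := (hasFDerivWithinAt_chartDeriv ((contMDiffOn_integral hV hG).contMDiffAt
    (hV.mem_nhds hx) |>.mdifferentiableAt (by simp))).mono hsr
  have h3 := (hu _ hxs).eq h2 h1
  have hDc : ContinuousOn (fun p ↦ (fderivWithin ℝ g (s ×ˢ Icc (0 : ℝ) 1) p).comp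
      (ContinuousLinearMap.inl ℝ E ℝ)) (s ×ˢ Icc (0 : ℝ) 1) :=
    (hg1.continuousOn_fderivWithin (hu.prod (uniqueDiffOn_Icc zero_lt_one)) le_rfl).clm_comp
      continuousOn_const
  refine ⟨fun t ↦ (fderivWithin ℝ g (s ×ˢ Icc (0 : ℝ) 1) (extChartAt I x x, t)).comp
    (ContinuousLinearMap.inl ℝ E ℝ) v, ?_, fun t ht ↦ ?_, ?_⟩
  · exact (hDc.comp (by fun_prop : Continuous fun t : ℝ ↦ (extChartAt I x x, t)).continuousOn
      (fun t ht ↦ ⟨hxs, ht⟩)).clm_apply continuousOn_const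
  · have h4 := hasFDerivWithinAt_slice (hg1.differentiableOn one_ne_zero) hxs ht
    have h5 := (hasFDerivWithinAt_chartDeriv (hd t ht)).mono hsr
    rw [(hu _ hxs).eq h5 h4]
  · rw [h3]
    exact ContinuousLinearMap.intervalIntegral_apply (integrable_slice hDc hxs) v

end Average

/-! ### Charts with values in the half space -/

section HalfSpace

open Set Filter

variable {n : ℕ} [NeZero n] {M : Type*} [TopologicalSpace M] [ChartedSpace (EuclideanHalfSpace n) M]

theorem mem_range_halfSpace {y : EuclideanSpace ℝ (Fin n)} : y ∈ range (𝓡∂ n) ↔ 0 ≤ y 0 := by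
  rw [range_modelWithCornersEuclideanHalfSpace]
  rfl

variable (n) in
/-- The inward pointing unit vector. -/
def inward : EuclideanSpace ℝ (Fin n) := EuclideanSpace.single 0 1

@[simp] theorem inward_zero : inward n 0 = 1 := by simp [inward]

theorem chart_zero_nonneg {x₀ x : M} (hx : x ∈ (extChartAt (𝓡∂ n) x₀).source) :
    0 ≤ extChartAt (𝓡∂ n) x₀ x 0 :=
  mem_range_halfSpace.1 (extChartAt_target_subset_range x₀ ((extChartAt (𝓡∂ n) x₀).map_source hx))

variable [IsManifold (𝓡∂ n) ∞ M]

theorem mem_interior_iff_chart {x₀ x : M} (hx : x ∈ (extChartAt (𝓡∂ n) x₀).source) :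
    x ∈ (𝓡∂ n).interior M ↔ 0 < extChartAt (𝓡∂ n) x₀ x 0 := by
  have h1 := (𝓡∂ n).isInteriorPoint_iff_of_mem_atlas (n := ∞) (by simp)
    (chart_mem_atlas (EuclideanHalfSpace n) x₀) (x := x) (by simpa using hx)
  have h2 : extChartAt (𝓡∂ n) x₀ x ∈ interior (range (𝓡∂ n)) ↔ 0 < extChartAt (𝓡∂ n) x₀ x 0 := by
    rw [interior_range_modelWithCornersEuclideanHalfSpace]
    rfl
  rw [← h2]
  refine h1.trans ⟨fun h ↦ interior_mono (extChartAt_target_subset_range x₀) h, fun h ↦ ?_⟩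
  exact (chartAt (EuclideanHalfSpace n) x₀).mem_interior_extend_target
    ((chartAt (EuclideanHalfSpace n) x₀).map_source (by simpa using hx)) h

theorem mem_boundary_iff_chart {x₀ x : M} (hx : x ∈ (extChartAt (𝓡∂ n) x₀).source) :
    x ∈ (𝓡∂ n).boundary M ↔ extChartAt (𝓡∂ n) x₀ x 0 = 0 := by
  rw [← ModelWithCorners.compl_interior, mem_compl_iff, mem_interior_iff_chart hx, not_lt]
  exact ⟨fun h ↦ le_antisymm h (chart_zero_nonneg hx), fun h ↦ h.le⟩

theorem hasDerivWithinAt_ray {g : M → ℝ} {x : M}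
    (hg : MDifferentiableAt (𝓡∂ n) 𝓘(ℝ, ℝ) g x) {v : EuclideanSpace ℝ (Fin n)} (hv : 0 ≤ v 0) :
    HasDerivWithinAt (fun t : ℝ ↦ g ((extChartAt (𝓡∂ n) x).symm (extChartAt (𝓡∂ n) x x + t • v)))
      (chartDeriv (𝓡∂ n) g x v) (Ici 0) 0 := by
  have h1 := hasFDerivWithinAt_chartDeriv hg
  have h2 : HasDerivWithinAt (fun t : ℝ ↦ extChartAt (𝓡∂ n) x x + t • v) v (Ici 0) 0 := by
    simpa using (((hasDerivAt_id (0 : ℝ)).smul_const v).const_add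
      (extChartAt (𝓡∂ n) x x)).hasDerivWithinAt
  have h0 : (fun t : ℝ ↦ extChartAt (𝓡∂ n) x x + t • v) 0 = extChartAt (𝓡∂ n) x x := by simp
  refine HasFDerivWithinAt.comp_hasDerivWithinAt (t := range (𝓡∂ n)) (0 : ℝ) (h0.symm ▸ h1) h2 ?_
  intro t ht
  rw [mem_range_halfSpace]
  have := chart_zero_nonneg (mem_extChartAt_source (I := 𝓡∂ n) x)
  have ht' : 0 ≤ t := ht
  simp only [PiLp.add_apply, PiLp.smul_apply, smul_eq_mul]
  positivity

theorem tendsto_ray (x : M) (v : EuclideanSpace ℝ (Fin n)) :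
    Tendsto (fun t : ℝ ↦ (extChartAt (𝓡∂ n) x).symm (extChartAt (𝓡∂ n) x x + t • v)) (𝓝 0)
      (𝓝 x) := by
  have h1 : Tendsto (fun t : ℝ ↦ extChartAt (𝓡∂ n) x x + t • v) (𝓝 0) (𝓝 (extChartAt (𝓡∂ n) x x)) :=
    (by fun_prop : Continuous fun t : ℝ ↦ extChartAt (𝓡∂ n) x x + t • v).tendsto' _ _ (by simp)
  have h2 := (continuousAt_extChartAt_symm (I := 𝓡∂ n) x).tendsto
  rw [extChartAt_to_inv] at h2
  exact h2.comp h1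

/-- Difference quotients are compared along the inward ray, which stays in the half space. -/
theorem chartDeriv_inward_mono {g₁ g₂ : M → ℝ} {x : M} {c : ℝ}
    (h₁ : MDifferentiableAt (𝓡∂ n) 𝓘(ℝ, ℝ) g₁ x) (h₂ : MDifferentiableAt (𝓡∂ n) 𝓘(ℝ, ℝ) g₂ x)
    (h : ∀ᶠ z in 𝓝 x, c * g₁ z ≤ g₂ z) (hx : c * g₁ x = g₂ x) :
    c * chartDeriv (𝓡∂ n) g₁ x (inward n) ≤ chartDeriv (𝓡∂ n) g₂ x (inward n) := by
  have d₁ := hasDerivWithinAt_ray h₁ (v := inward n) (by simp)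
  have d₂ := hasDerivWithinAt_ray h₂ (v := inward n) (by simp)
  have d := d₂.sub (d₁.const_mul c)
  rw [hasDerivWithinAt_iff_tendsto_slope] at d
  have : 0 ≤ chartDeriv (𝓡∂ n) g₂ x (inward n) - c * chartDeriv (𝓡∂ n) g₁ x (inward n) := by
    have hne : (𝓝[Ici (0 : ℝ) \ {0}] 0).NeBot := by
      rw [show Ici (0 : ℝ) \ {0} = Ioi 0 from Ici_sdiff_left]
      infer_instance
    refine ge_of_tendsto d ?_
    filter_upwards [mem_nhdsWithin_of_mem_nhds ((tendsto_ray x (inward n)).eventually h),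
      self_mem_nhdsWithin] with t ht ht0
    have h0 : (0 : ℝ) ≤ t := ht0.1
    simp only [slope, vsub_eq_sub, sub_zero, smul_eq_mul, Pi.sub_apply, zero_smul, add_zero,
      extChartAt_to_inv, hx, sub_self]
    exact mul_nonneg (inv_nonneg.2 h0) (sub_nonneg.2 ht)
  linarith

/-- Since g vanishes on the boundary, its derivative kills tangential vectors; being nonzero, it
cannot kill the inward vector, and g ≥ 0 fixes the sign. -/
theorem chartDeriv_inward_pos {g : M → ℝ} {x : M} (hx : x ∈ (𝓡∂ n).boundary M)
    (hg : MDifferentiableAt (𝓡∂ n) 𝓘(ℝ, ℝ) g x) (h0 : ∀ᶠ z in 𝓝 x, 0 ≤ g z)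
    (hz : ∀ᶠ z in 𝓝 x, z ∈ (𝓡∂ n).boundary M → g z = 0)
    (hne : chartDeriv (𝓡∂ n) g x ≠ 0) : 0 < chartDeriv (𝓡∂ n) g x (inward n) := by
  have hgx : g x = 0 := hz.self_of_nhds hx
  have hxc := (mem_boundary_iff_chart (mem_extChartAt_source (I := 𝓡∂ n) x)).1 hx
  have hnn : 0 ≤ chartDeriv (𝓡∂ n) g x (inward n) := by
    have := chartDeriv_inward_mono (c := 0) hg hg (by simpa using h0) (by simp [hgx])
    simpa using this
  refine lt_of_le_of_ne hnn (fun h ↦ hne ?_)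
  have htan : ∀ v : EuclideanSpace ℝ (Fin n), v 0 = 0 → chartDeriv (𝓡∂ n) g x v = 0 := by
    intro v hv
    have d := hasDerivWithinAt_ray hg hv.ge
    have hcurve : Tendsto (fun t : ℝ ↦ extChartAt (𝓡∂ n) x x + t • v) (𝓝[≥] 0)
        (𝓝[range (𝓡∂ n)] (extChartAt (𝓡∂ n) x x)) := by
      refine tendsto_nhdsWithin_iff.2 ⟨?_, Eventually.of_forall fun t ↦ ?_⟩
      · exact ((by fun_prop : Continuous fun t : ℝ ↦ extChartAt (𝓡∂ n) x x + t • v).tendsto' _ _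
          (by simp)).mono_left nhdsWithin_le_nhds
      · rw [mem_range_halfSpace]
        simp only [PiLp.add_apply, PiLp.smul_apply, hxc, hv, smul_zero, add_zero, le_refl]
    have d0 : HasDerivWithinAt (fun t : ℝ ↦ g ((extChartAt (𝓡∂ n) x).symm
        (extChartAt (𝓡∂ n) x x + t • v))) 0 (Ici 0) 0 := by
      refine (hasDerivWithinAt_const (0 : ℝ) (Ici 0) (0 : ℝ)).congr_of_eventuallyEq ?_ ?_
      · filter_upwards [mem_nhdsWithin_of_mem_nhds ((tendsto_ray x v).eventually hz),
          hcurve.eventually (extChartAt_target_mem_nhdsWithin x)] with t ht ht'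
        refine ht ((mem_boundary_iff_chart ((extChartAt (𝓡∂ n) x).map_target ht')).2 ?_)
        rw [(extChartAt (𝓡∂ n) x).right_inv ht']
        simp only [PiLp.add_apply, PiLp.smul_apply, hxc, hv, smul_zero, add_zero]
      · simp only [zero_smul, add_zero, extChartAt_to_inv, hgx]
    exact (uniqueDiffOn_Ici (0 : ℝ) 0 (by simp)).eq_deriv _ d d0
  ext v
  have hv : v = (v - v 0 • inward n) + v 0 • inward n := by simp
  rw [hv, map_add, map_smul, ← h, htan _ (by simp)]
  simp

theorem mdifferentiableAt_chart_zero {x₀ x : M} (hx : x ∈ (extChartAt (𝓡∂ n) x₀).source) :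
    ContMDiffAt (𝓡∂ n) 𝓘(ℝ, ℝ) ∞ (fun z ↦ extChartAt (𝓡∂ n) x₀ z 0) x :=
  (EuclideanSpace.proj (0 : Fin n) : EuclideanSpace ℝ (Fin n) →L[ℝ] ℝ).contMDiff.contMDiffAt.comp x
    (contMDiffAt_extChartAt' (by simpa using hx))

theorem chartDeriv_chart_zero_ne {x₀ x : M} (hx : x ∈ (extChartAt (𝓡∂ n) x₀).source) :
    chartDeriv (𝓡∂ n) (fun z ↦ extChartAt (𝓡∂ n) x₀ z 0) x ≠ 0 := by
  intro h
  set π : EuclideanSpace ℝ (Fin n) →L[ℝ] ℝ := EuclideanSpace.proj (0 : Fin n)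
  have h1 : MDifferentiableAt (𝓡∂ n) 𝓘(ℝ, EuclideanSpace ℝ (Fin n)) (extChartAt (𝓡∂ n) x₀) x :=
    (contMDiffAt_extChartAt' (n := ∞) (by simpa using hx)).mdifferentiableAt (by simp)
  have h2 := (π.mdifferentiableAt (x := extChartAt (𝓡∂ n) x₀ x)).hasMFDerivAt.comp x h1.hasMFDerivAt
  obtain ⟨v, hv⟩ := (isInvertible_mfderiv_extChartAt hx).surjective (inward n)
  have h3 := mfderiv_apply_eq_chartDeriv ((mdifferentiableAt_chart_zero hx).mdifferentiableAt
    (by simp)) v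
  rw [h] at h3
  have h4 : mfderiv (𝓡∂ n) 𝓘(ℝ, ℝ) (fun z ↦ extChartAt (𝓡∂ n) x₀ z 0) x = _ := h2.mfderiv
  rw [h4, ContinuousLinearMap.mfderiv_eq] at h3
  change π (mfderiv (𝓡∂ n) 𝓘(ℝ, EuclideanSpace ℝ (Fin n)) (extChartAt (𝓡∂ n) x₀) x v) = 0 at h3
  rw [hv] at h3
  simp [π] at h3

end HalfSpace

/-! ### Existence of invariant boundary defining functions -/

/-- The circle, parametrized by the unit interval. -/
def circlePath (t : ℝ) : Circle := Circle.exp (2 * Real.pi * t)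

theorem contMDiff_circlePath : ContMDiff 𝓘(ℝ, ℝ) (𝓡 1) ∞ circlePath :=
  contMDiff_circleExp.comp (contDiff_const.mul contDiff_id).contMDiff

/-- Multiplication by a translates the parameter, and the integrand has period 1. -/
theorem integral_circle_mul {F : Type*} [NormedAddCommGroup F] [NormedSpace ℝ F]
    (φ : Circle → F) (a : Circle) :
    ∫ t in (0 : ℝ)..1, φ (circlePath t * a) = ∫ t in (0 : ℝ)..1, φ (circlePath t) := by
  set c : ℝ := Complex.arg a / (2 * Real.pi) with hc
  have hpi : (2 * Real.pi) ≠ 0 := by positivity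
  have h1 : ∀ t, circlePath t * a = circlePath (t + c) := by
    intro t
    have : a = Circle.exp (2 * Real.pi * c) := by
      rw [hc, mul_div_cancel₀ _ hpi, Circle.exp_arg]
    rw [circlePath, circlePath, mul_add, Circle.exp_add, ← this]
  have hper : Function.Periodic (fun t ↦ φ (circlePath t)) 1 := by
    intro t
    simp only [circlePath, mul_add, mul_one, Circle.exp_add, Circle.exp_two_pi]
  simp only [h1]
  rw [intervalIntegral.integral_comp_add_right (fun t ↦ φ (circlePath t))]
  have := hper.intervalIntegral_add_eq c 0
  simpa [add_comm] using this

theorem locallyCompact_of_halfSpace (n : ℕ) [NeZero n] (M : Type*) [TopologicalSpace M]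
    [ChartedSpace (EuclideanHalfSpace n) M] : LocallyCompactSpace M :=
  Manifold.locallyCompact_of_finiteDimensional (𝓡∂ n)

theorem sigmaCompact_of_halfSpace (n : ℕ) [NeZero n] (M : Type*) [TopologicalSpace M]
    [SecondCountableTopology M] [ChartedSpace (EuclideanHalfSpace n) M] : SigmaCompactSpace M := by
  have := locallyCompact_of_halfSpace n M
  infer_instance

section Existence

open Set Filter

variable {n : ℕ} [NeZero n] {M : Type*} [TopologicalSpace M] [T2Space M]
    [SecondCountableTopology M] [ChartedSpace (EuclideanHalfSpace n) M] [IsManifold (𝓡∂ n) ∞ M]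

variable (n M) in
-- The first coordinates of the charts are glued by a partition of unity. All terms are nonnegative,
-- so comparison with a single term gives both the zero set and the positivity of the inward
-- derivative, without differentiating the sum.
theorem exists_boundary_defining : ∃ f : M → ℝ, ContMDiff (𝓡∂ n) 𝓘(ℝ, ℝ) ∞ f ∧ (∀ x, 0 ≤ f x) ∧
    (∀ x, f x = 0 ↔ x ∈ (𝓡∂ n).boundary M) ∧
    ∀ x ∈ (𝓡∂ n).boundary M, 0 < chartDeriv (𝓡∂ n) f x (inward n) := by
  have := sigmaCompact_of_halfSpace n M
  obtain ⟨ρ, hρ⟩ := SmoothPartitionOfUnity.exists_isSubordinate_chartAt_source (𝓡∂ n) M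
  set g : M → M → ℝ := fun i z ↦ extChartAt (𝓡∂ n) i z 0 with hg
  set f : M → ℝ := fun x ↦ ∑ᶠ i, ρ i x • g i x with hf
  have hsrc : ∀ i x, ρ i x ≠ 0 → x ∈ (extChartAt (𝓡∂ n) i).source := by
    intro i x hx
    rw [extChartAt_source]
    exact hρ i (subset_tsupport _ hx)
  have hterm : ∀ i x, 0 ≤ ρ i x • g i x := by
    intro i x
    by_cases h : ρ i x = 0
    · simp [h]
    · exact mul_nonneg (ρ.nonneg i x) (chart_zero_nonneg (hsrc i x h))
  have hfin : ∀ x, (Function.support fun i ↦ ρ i x • g i x).Finite := fun x ↦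
    (ρ.locallyFinite.point_finite x).subset fun i hi ↦ left_ne_zero_of_smul hi
  have hle : ∀ i x, ρ i x • g i x ≤ f x := fun i x ↦ single_le_finsum i (hfin x) (hterm · x)
  have hfs : ContMDiff (𝓡∂ n) 𝓘(ℝ, ℝ) ∞ f := by
    refine hρ.contMDiff_finsum_smul (fun i ↦ (chartAt _ i).open_source) (fun i x hx ↦ ?_)
    exact (mdifferentiableAt_chart_zero (by simpa using hx)).contMDiffWithinAt
  have hnn : ∀ x, 0 ≤ f x := fun x ↦ finsum_nonneg fun i ↦ hterm i x
  have hex : ∀ x, ∃ i, 0 < ρ i x := fun x ↦ ρ.exists_pos_of_mem (mem_univ x)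
  have hz : ∀ x ∈ (𝓡∂ n).boundary M, f x = 0 := by
    intro x hx
    refine finsum_eq_zero_of_forall_eq_zero fun i ↦ ?_
    by_cases h : ρ i x = 0
    · simp [h]
    · have := (mem_boundary_iff_chart (hsrc i x h)).1 hx
      rw [show g i x = 0 from this, smul_zero]
  refine ⟨f, hfs, hnn, fun x ↦ ⟨fun h ↦ ?_, hz x⟩, fun x hx ↦ ?_⟩
  · obtain ⟨i, hi⟩ := hex x
    have h1 := hle i x
    have hs := hsrc i x hi.ne'
    rw [mem_boundary_iff_chart hs]
    refine le_antisymm ?_ (chart_zero_nonneg hs)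
    by_contra hneg
    have := mul_pos hi (not_le.1 hneg)
    rw [h] at h1
    exact absurd h1 (not_le.2 this)
  · obtain ⟨i, hi⟩ := hex x
    have hs := hsrc i x hi.ne'
    have hgd := (mdifferentiableAt_chart_zero hs).mdifferentiableAt (by simp)
    have hgx := (mem_boundary_iff_chart hs).1 hx
    have hpos : 0 < chartDeriv (𝓡∂ n) (g i) x (inward n) := by
      have hnhds : ∀ᶠ z in 𝓝 x, z ∈ (extChartAt (𝓡∂ n) i).source :=
        (isOpen_extChartAt_source i).mem_nhds hs
      refine chartDeriv_inward_pos hx hgd ?_ ?_ (chartDeriv_chart_zero_ne hs)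
      · filter_upwards [hnhds] with z hz using chart_zero_nonneg hz
      · filter_upwards [hnhds] with z hz hzb using (mem_boundary_iff_chart hz).1 hzb
    -- Near x the weight `ρ i` stays above half of its positive value at x, so a constant multiple
    -- of one coordinate lies below f and agrees with it at x.
    have hcmp := chartDeriv_inward_mono (c := ρ i x / 2) hgd (hfs.mdifferentiable (by simp) x) ?_ ?_
    · exact lt_of_lt_of_le (mul_pos (half_pos hi) hpos) hcmp
    · have h1 : ∀ᶠ z in 𝓝 x, ρ i x / 2 < ρ i z :=
        ((ρ i).contMDiff.continuous.continuousAt (x := x)).eventually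
          (lt_mem_nhds (half_lt_self hi))
      filter_upwards [h1, (isOpen_extChartAt_source i).mem_nhds hs] with z hz hzs
      exact (mul_le_mul_of_nonneg_right hz.le (chart_zero_nonneg hzs)).trans (hle i z)
    · rw [hz x hx, hgx, mul_zero]

variable {U : TopologicalSpace.Opens M} [MulAction Circle U] (hU : IsFreeActionNearBoundary n U)
include hU

theorem contMDiffOn_circlePath_act {f : M → ℝ} (hf : ContMDiff (𝓡∂ n) 𝓘(ℝ, ℝ) ∞ f) :
    ContMDiffOn ((𝓡∂ n).prod 𝓘(ℝ, ℝ)) 𝓘(ℝ, ℝ) ∞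
      (fun p : M × ℝ ↦ f (act U (circlePath p.2) p.1)) ((U : Set M) ×ˢ Icc (0 : ℝ) 1) := by
  intro p hp
  refine (hf.contMDiffAt.comp p (contMDiffAt_act_comp hU ?_ contMDiffAt_fst
    hp.1)).contMDiffWithinAt
  exact contMDiff_circlePath.contMDiffAt.comp p contMDiffAt_snd

/-- Averaging `f₀` over the circle keeps the zero set and, the inward derivatives of all translates
being positive, the nonvanishing derivative. The average makes sense only on U, so away from the
boundary it is replaced by a positive function. -/
theorem exists_isInvariantBoundaryDefining : ∃ f : M → ℝ, IsInvariantBoundaryDefining n U f := by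
  have := sigmaCompact_of_halfSpace n M
  have := locallyCompact_of_halfSpace n M
  obtain ⟨f₀, hs, hnn, hz, hd⟩ := exists_boundary_defining n M
  set fb : M → ℝ := fun x ↦ ∫ t in (0 : ℝ)..1, f₀ (act U (circlePath t) x) with hfb
  have hfbs : ContMDiffOn (𝓡∂ n) 𝓘(ℝ, ℝ) ∞ fb U :=
    contMDiffOn_integral U.isOpen (contMDiffOn_circlePath_act hU hs)
  have hcont : ∀ x ∈ U, IntervalIntegrable (fun t ↦ f₀ (act U (circlePath t) x))
      MeasureTheory.volume 0 1 := by
    intro x hx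
    apply ContinuousOn.intervalIntegrable
    rw [uIcc_of_le zero_le_one]
    exact (contMDiffOn_circlePath_act hU hs).continuousOn.comp
      (by fun_prop : Continuous fun t : ℝ ↦ (x, t)).continuousOn (fun t ht ↦ ⟨hx, ht⟩)
  have hfbnn : ∀ x, 0 ≤ fb x :=
    fun x ↦ intervalIntegral.integral_nonneg zero_le_one fun t _ ↦ hnn _
  have hfbz : ∀ x ∈ (𝓡∂ n).boundary M, fb x = 0 := by
    intro x hx
    have : ∀ t, f₀ (act U (circlePath t) x) = 0 :=
      fun t ↦ (hz _).2 ((act_mem_boundary hU _).2 hx)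
    simp [hfb, this]
  have hfbpos : ∀ x ∈ U, x ∉ (𝓡∂ n).boundary M → 0 < fb x := by
    intro x hx hxb
    refine intervalIntegral.intervalIntegral_pos_of_pos (hcont x hx) (fun t ↦ ?_) zero_lt_one
    refine lt_of_le_of_ne (hnn _) (fun h ↦ hxb ?_)
    exact (act_mem_boundary hU _).1 ((hz _).1 h.symm)
  have hfbd : ∀ x ∈ (𝓡∂ n).boundary M, 0 < chartDeriv (𝓡∂ n) fb x (inward n) := by
    intro x hx
    have hxU := hU.boundary_subset hx
    have hactd : ∀ t, MDifferentiableAt (𝓡∂ n) (𝓡∂ n) (act U (circlePath t)) x :=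
      fun t ↦ (contMDiffAt_act_const hU _ hxU).mdifferentiableAt (by simp)
    have hcd : ∀ t, MDifferentiableAt (𝓡∂ n) 𝓘(ℝ, ℝ) (fun z ↦ f₀ (act U (circlePath t) z)) x :=
      fun t ↦ (hs.mdifferentiable (by simp) _).comp x (hactd t)
    obtain ⟨d, hdc, hdt, hde⟩ := chartDeriv_integral_apply U.isOpen
      (contMDiffOn_circlePath_act hU hs) hxU (fun t _ ↦ hcd t) (inward n)
    rw [hfb, hde]
    refine intervalIntegral.intervalIntegral_pos_of_pos_on ?_ (fun t ht ↦ ?_) zero_lt_one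
    · apply ContinuousOn.intervalIntegrable
      rwa [uIcc_of_le zero_le_one]
    rw [hdt t ⟨ht.1.le, ht.2.le⟩]
    refine chartDeriv_inward_pos hx (hcd t) (Eventually.of_forall fun z ↦ hnn _)
      (Eventually.of_forall fun z hzb ↦ (hz _).2 ((act_mem_boundary hU _).2 hzb)) (fun h0 ↦ ?_)
    -- If the derivative of a translate of `f₀` vanished, so would that of `f₀` at the translated
    -- point, the translation being invertible.
    have hy := (act_mem_boundary hU (circlePath t)).2 hx
    have h1 := (hd _ hy).ne'
    refine h1 ((mfderiv_apply_eq_chartDeriv (hs.mdifferentiable (by simp) _)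
      (inward n)).symm.trans ?_)
    have h2 := mfderiv_act_comp_inv hU (circlePath t) (act_mem (circlePath t) hxU)
    rw [act_inv_act] at h2
    have h3 := congrArg (fun l : TangentSpace (𝓡∂ n) (act U (circlePath t) x) →L[ℝ]
      TangentSpace (𝓡∂ n) (act U (circlePath t) x) ↦ l (inward n)) h2
    have h4 := mfderiv_comp x (hs.mdifferentiable (by simp) (act U (circlePath t) x)) (hactd t)
    set v := mfderiv (𝓡∂ n) (𝓡∂ n) (act U (circlePath t)⁻¹) (act U (circlePath t) x) (inward n)
    have h5 := mfderiv_apply_eq_chartDeriv (hcd t) v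
    rw [h0] at h5
    have h6 : mfderiv (𝓡∂ n) 𝓘(ℝ, ℝ) f₀ (act U (circlePath t) x)
      (mfderiv (𝓡∂ n) (𝓡∂ n) (act U (circlePath t)) x v) = 0 :=
      (congrArg (fun l : TangentSpace (𝓡∂ n) x →L[ℝ] ℝ ↦ l v) h4).symm.trans h5
    exact (congrArg (mfderiv (𝓡∂ n) 𝓘(ℝ, ℝ) f₀ (act U (circlePath t) x)) h3).symm.trans h6
  obtain ⟨O, hO, hbO, hOU⟩ := normal_exists_closure_subset
    ((𝓡∂ n).isClosed_boundary (M := M) (n := ∞) (by simp)) U.isOpen hU.boundary_subset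
  -- Both requirements, equality with the average on the closure of O and positivity off it, are
  -- convex in the value, so a partition of unity preserves them.
  set T : M → Set ℝ := fun x ↦ {y | (x ∈ closure O → y = fb x) ∧ (x ∉ closure O → 0 < y)} with hT
  have hconv : ∀ x, Convex ℝ (T x) := by
    intro x
    by_cases hx : x ∈ closure O
    · simp only [hT, hx, true_imp_iff, not_true, false_imp_iff, and_true]
      exact convex_singleton _
    · simp only [hT, hx, true_imp_iff, not_false_iff, false_imp_iff, true_and]
      exact convex_Ioi _
  have hloc : ∀ x, ∃ W ∈ 𝓝 x, ∃ g : M → ℝ, ContMDiffOn (𝓡∂ n) 𝓘(ℝ, ℝ) ∞ g W ∧ ∀ y ∈ W, g y ∈ T y := by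
    intro x
    by_cases hx : x ∈ closure O
    · refine ⟨U, U.isOpen.mem_nhds (hOU hx), fb, hfbs, fun y hy ↦ ⟨fun _ ↦ rfl, fun h ↦ ?_⟩⟩
      exact hfbpos y hy (fun hyb ↦ h (subset_closure (hbO hyb)))
    · refine ⟨(closure O)ᶜ, isClosed_closure.isOpen_compl.mem_nhds hx, fun _ ↦ 1,
        contMDiffOn_const, fun y hy ↦ ⟨fun h ↦ absurd h hy, fun _ ↦ zero_lt_one⟩⟩
  obtain ⟨f, hf⟩ := exists_contMDiffMap_forall_mem_convex_of_local (n := ⊤) (𝓡∂ n) hconv hloc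
  have hfO : ∀ x ∈ O, f x = fb x := fun x hx ↦ (hf x).1 (subset_closure hx)
  refine ⟨f, f.contMDiff, fun x ↦ ?_, fun x ↦ ⟨fun h ↦ ?_, fun h ↦ ?_⟩, fun x hx h0 ↦ ?_, ?_⟩
  · by_cases hx : x ∈ closure O
    · rw [(hf x).1 hx]; exact hfbnn x
    · exact ((hf x).2 hx).le
  · by_contra hxb
    by_cases hx : x ∈ closure O
    · have := (hf x).1 hx
      exact absurd (this ▸ h) (hfbpos x (hOU hx) hxb).ne'
    · exact absurd h ((hf x).2 hx).ne'
  · rw [hfO x (hbO h), hfbz x h]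
  · have h1 := hfbd x hx
    have h2 : mfderiv (𝓡∂ n) 𝓘(ℝ, ℝ) f x = mfderiv (𝓡∂ n) 𝓘(ℝ, ℝ) fb x := by
      apply Filter.EventuallyEq.mfderiv_eq
      filter_upwards [hO.mem_nhds (hbO hx)] with z hz using hfO z hz
    rw [h2] at h0
    have h3 := mfderiv_apply_eq_chartDeriv ((hfbs.contMDiffAt (U.isOpen.mem_nhds
      (hU.boundary_subset hx))).mdifferentiableAt (by simp)) (inward n)
    rw [h0] at h3
    exact h1.ne h3
  · obtain ⟨V, hVO, hV⟩ := exists_isInvariantNhd_subset hU hO hbO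
    refine ⟨V, hV, fun a x hx ↦ ?_⟩
    rw [hfO _ (hVO hx), hfO _ (hVO (hV.invariant a x hx)), ← act_of_mem a x.2]
    simp only [hfb, ← act_mul]
    exact integral_circle_mul (fun b ↦ f₀ (act U b x)) a

end Existence

/-! ### The topology of the cut space -/

section CutTopology

open Set Filter

variable {n : ℕ} [NeZero n] {M : Type*} [TopologicalSpace M] [ChartedSpace (EuclideanHalfSpace n) M]
  {U : TopologicalSpace.Opens M} [MulAction Circle U]

theorem isQuotientMap_cutMap : Topology.IsQuotientMap (cutMap n U) := isQuotientMap_quotient_mk'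

theorem surjective_cutMap : Function.Surjective (cutMap n U) := Quotient.mk_surjective

theorem continuous_cutMap : Continuous (cutMap n U) := isQuotientMap_cutMap.continuous

variable [IsManifold (𝓡∂ n) ∞ M] (hU : IsFreeActionNearBoundary n U)
include hU

/-- The saturation of a closed A is A together with the boundary points whose orbit meets A, and the
latter set is closed by compactness of the circle. -/
theorem isClosedMap_cutMap : IsClosedMap (cutMap n U) := by
  intro A hA
  rw [← isQuotientMap_cutMap.isClosed_preimage]
  have : cutMap n U ⁻¹' (cutMap n U '' A) =
      A ∪ ((𝓡∂ n).boundary M ∩ {x | x ∈ U ∧ ∀ a : Circle, act U a x ∈ Aᶜ}ᶜ) := by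
    ext x
    simp only [mem_preimage, mem_image, mem_union, mem_inter_iff, mem_compl_iff, mem_ofPred_eq,
      not_and, not_forall, not_not]
    constructor
    · rintro ⟨y, hy, h⟩
      rcases (cutMap_eq_iff_act hU).1 h.symm with rfl | ⟨hx, a, rfl⟩
      · exact Or.inl hy
      · exact Or.inr ⟨hx, fun _ ↦ ⟨a, hy⟩⟩
    · rintro (h | ⟨hx, h⟩)
      · exact ⟨x, h, rfl⟩
      · obtain ⟨a, ha⟩ := h (hU.boundary_subset hx)
        exact ⟨_, ha, cutMap_act_of_boundary hU hx a⟩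
  rw [this]
  exact hA.union (((𝓡∂ n).isClosed_boundary (M := M) (n := ∞) (by simp)).inter
    (isOpen_setOf_orbit_subset hU hA.isOpen_compl).isClosed_compl)

/-- M is normal and c is closed: disjoint open neighbourhoods of two closed fibres give separating
open sets as complements of images of complements. -/
theorem t2Space_cutSpace [T2Space M] [SecondCountableTopology M] : T2Space (CutSpace n U) := by
  have := sigmaCompact_of_halfSpace n M
  have := locallyCompact_of_halfSpace n M
  refine ⟨fun p q hpq ↦ ?_⟩
  have hcl : ∀ p : CutSpace n U, IsClosed {p} := by
    intro p
    obtain ⟨x, rfl⟩ := surjective_cutMap p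
    simpa using isClosedMap_cutMap hU {x} isClosed_singleton
  have hdisj : Disjoint (cutMap n U ⁻¹' {p}) (cutMap n U ⁻¹' {q}) :=
    Disjoint.preimage _ (by simpa using hpq)
  obtain ⟨A, B, hA, hB, hpA, hqB, hAB⟩ := normal_separation
    ((hcl p).preimage continuous_cutMap) ((hcl q).preimage continuous_cutMap) hdisj
  refine ⟨(cutMap n U '' Aᶜ)ᶜ, (cutMap n U '' Bᶜ)ᶜ,
    (isClosedMap_cutMap hU _ hA.isClosed_compl).isOpen_compl,
    (isClosedMap_cutMap hU _ hB.isClosed_compl).isOpen_compl, ?_, ?_, ?_⟩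
  · rintro ⟨x, hx, h⟩
    exact hx (hpA h)
  · rintro ⟨x, hx, h⟩
    exact hx (hqB h)
  · rw [Set.disjoint_left]
    intro r h1 h2
    obtain ⟨x, rfl⟩ := surjective_cutMap r
    have hxA : x ∈ A := by_contra fun h ↦ h1 ⟨x, h, rfl⟩
    have hxB : x ∈ B := by_contra fun h ↦ h2 ⟨x, h, rfl⟩
    exact hAB.le_bot ⟨hxA, hxB⟩

theorem sigmaCompactSpace_cutSpace [SecondCountableTopology M] :
    SigmaCompactSpace (CutSpace n U) := by
  have := sigmaCompact_of_halfSpace n M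
  refine ⟨⟨fun k ↦ cutMap n U '' compactCovering M k,
    fun k ↦ (isCompact_compactCovering M k).image continuous_cutMap, ?_⟩⟩
  rw [← image_iUnion, iUnion_compactCovering, image_univ, surjective_cutMap.range_eq]

theorem secondCountable_cutSpace [SecondCountableTopology M]
    [ChartedSpace (EuclideanSpace ℝ (Fin n)) (CutSpace n U)] :
    SecondCountableTopology (CutSpace n U) := by
  have := sigmaCompactSpace_cutSpace hU
  exact ChartedSpace.secondCountable_of_sigmaCompact (EuclideanSpace ℝ (Fin n)) (CutSpace n U)

theorem isOpen_image_cutMap {O : Set M} (hO : IsOpen O) (hOi : O ⊆ (𝓡∂ n).interior M) :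
    IsOpen (cutMap n U '' O) := by
  rw [← isQuotientMap_cutMap.isOpen_preimage]
  suffices cutMap n U ⁻¹' (cutMap n U '' O) = O by rwa [this]
  refine Subset.antisymm ?_ (subset_preimage_image _ _)
  rintro x ⟨y, hy, h⟩
  rwa [← eq_of_cutMap_eq hU (hOi hy) h]

end CutTopology

/-! ### Square root parametrization near a boundary point -/

section Tube

open Set Filter

variable {n : ℕ} [NeZero n] {M : Type*} [TopologicalSpace M] [ChartedSpace (EuclideanHalfSpace n) M]

variable (n) in
/-- The hyperplane that bounds the half space. -/
abbrev Tangential : Submodule ℝ (EuclideanSpace ℝ (Fin n)) :=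
  LinearMap.ker ((EuclideanSpace.proj (0 : Fin n) : EuclideanSpace ℝ (Fin n) →L[ℝ] ℝ) :
    EuclideanSpace ℝ (Fin n) →ₗ[ℝ] ℝ)

variable (n) in
/-- The projection to the bounding hyperplane along the inward vector. -/
def tangentialProj : EuclideanSpace ℝ (Fin n) →L[ℝ] Tangential n :=
  (ContinuousLinearMap.id ℝ _ -
    (EuclideanSpace.proj (0 : Fin n) : EuclideanSpace ℝ (Fin n) →L[ℝ] ℝ).smulRight
      (inward n)).codRestrict _ fun v ↦ by simp

theorem coe_tangentialProj (v : EuclideanSpace ℝ (Fin n)) :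
    (tangentialProj n v : EuclideanSpace ℝ (Fin n)) = v - v 0 • inward n := rfl

theorem tangential_zero (y : Tangential n) : (y : EuclideanSpace ℝ (Fin n)) 0 = 0 := y.2

theorem add_smul_inward_zero (y : Tangential n) (s : ℝ) :
    ((y : EuclideanSpace ℝ (Fin n)) + s • inward n) 0 = s := by
  simp [tangential_zero]

theorem tangentialProj_add_smul (y : Tangential n) (s : ℝ) :
    tangentialProj n ((y : EuclideanSpace ℝ (Fin n)) + s • inward n) = y := by
  apply Subtype.ext
  rw [coe_tangentialProj, add_smul_inward_zero]
  simp

theorem tangentialProj_add (v : EuclideanSpace ℝ (Fin n)) :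
    (tangentialProj n v : EuclideanSpace ℝ (Fin n)) + v 0 • inward n = v := by
  rw [coe_tangentialProj]; simp

variable [IsManifold (𝓡∂ n) ∞ M]

/-- Near a boundary point, a boundary defining function is the transverse coordinate times a
positive function, which becomes smooth after substituting `‖w‖ ^ 2` for the coordinate. -/
theorem exists_transverse_factor {f : M → ℝ} {x₀ : M} (hx₀ : x₀ ∈ (𝓡∂ n).boundary M)
    (hf : ContMDiff (𝓡∂ n) 𝓘(ℝ, ℝ) ∞ f) (hz : ∀ x ∈ (𝓡∂ n).boundary M, f x = 0)
    (hd : 0 < chartDeriv (𝓡∂ n) f x₀ (inward n)) :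
    ∃ (u : Tangential n × ℂ → ℝ) (B : Set (Tangential n × ℂ)), IsOpen B ∧
      (tangentialProj n (extChartAt (𝓡∂ n) x₀ x₀), 0) ∈ B ∧ ContDiffOn ℝ ∞ u B ∧
      (∀ p ∈ B, 0 < u p ∧ (p.1 : EuclideanSpace ℝ (Fin n)) + (‖p.2‖ ^ 2) • inward n ∈
          (extChartAt (𝓡∂ n) x₀).target ∧
        f ((extChartAt (𝓡∂ n) x₀).symm (p.1 + (‖p.2‖ ^ 2) • inward n)) = ‖p.2‖ ^ 2 * u p) ∧
      ∀ y w w', ‖w‖ = ‖w'‖ → u (y, w) = u (y, w') := by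
  set φ := extChartAt (𝓡∂ n) x₀ with hφ
  set y₀ := tangentialProj n (φ x₀) with hy₀
  have h00 : φ x₀ 0 = 0 := (mem_boundary_iff_chart (mem_extChartAt_source x₀)).1 hx₀
  have hy₀' : (y₀ : EuclideanSpace ℝ (Fin n)) = φ x₀ := by
    have := tangentialProj_add (φ x₀)
    rwa [h00, zero_smul, add_zero] at this
  set F : EuclideanSpace ℝ (Fin n) → ℝ := fun y ↦ f (φ.symm y) with hF
  obtain ⟨s, hsc, hsu, hst, hsn, hxs, -⟩ :=
    exists_convex_chart_nhd (I := 𝓡∂ n) isOpen_univ (mem_univ x₀)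
  have hFs : ContDiffOn ℝ ∞ F s := by
    rw [← contMDiffOn_iff_contDiffOn]
    exact hf.comp_contMDiffOn ((contMDiffOn_extChartAt_symm x₀).mono hst)
  set d : EuclideanSpace ℝ (Fin n) → ℝ := fun y ↦ fderivWithin ℝ F s y (inward n) with hdd
  have hds : ContDiffOn ℝ ∞ d s :=
    (hFs.fderivWithin hsu (m := ∞) (by simp)).clm_apply contDiffOn_const
  set j : Tangential n × ℂ → EuclideanSpace ℝ (Fin n) :=
    fun p ↦ (p.1 : EuclideanSpace ℝ (Fin n)) + (‖p.2‖ ^ 2) • inward n with hj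
  have hn2 : ContDiff ℝ ∞ fun p : Tangential n × ℂ ↦ ‖p.2‖ ^ 2 := contDiff_snd.norm_sq ℝ
  have hjs : ContDiff ℝ ∞ j :=
    ((Tangential n).subtypeL.contDiff.comp contDiff_fst).add (hn2.smul contDiff_const)
  have hj0 : j (y₀, 0) = φ x₀ := by simp [hj, hy₀']
  have hjr : ∀ p, j p ∈ range (𝓡∂ n) := fun p ↦ by
    rw [mem_range_halfSpace, hj, add_smul_inward_zero]; positivity
  have hjn : j ⁻¹' s ∈ 𝓝 (y₀, (0 : ℂ)) := by
    have : Tendsto j (𝓝 (y₀, 0)) (𝓝[range (𝓡∂ n)] (φ x₀)) :=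
      tendsto_nhdsWithin_iff.2 ⟨hj0 ▸ hjs.continuous.continuousAt, Eventually.of_forall hjr⟩
    exact this hsn
  obtain ⟨r, hr, hball⟩ := Metric.mem_nhds_iff.1 hjn
  set B₀ := Metric.ball (y₀, (0 : ℂ)) r with hB₀
  have hB₀0 : ∀ p ∈ B₀, (p.1, (0 : ℂ)) ∈ B₀ := by
    intro p hp
    simp only [hB₀, Metric.mem_ball, Prod.dist_eq, max_lt_iff, dist_self] at hp ⊢
    exact ⟨hp.1, hr⟩
  have hseg : ∀ p ∈ B₀, ∀ t ∈ Icc (0 : ℝ) 1,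
      (p.1 : EuclideanSpace ℝ (Fin n)) + (t * ‖p.2‖ ^ 2) • inward n ∈ s := by
    intro p hp t ht
    have h1 := hball (hB₀0 p hp)
    have h2 := hball hp
    have := hsc h1 h2 (sub_nonneg.2 ht.2) ht.1 (by ring)
    convert this using 1
    simp only [hj, norm_zero]
    module
  -- Hadamard's formula f(y, s) = s ∫₀¹ ∂f/∂s (y, ts) dt, with s = ‖w‖²; at the base point u is the
  -- inward derivative of f.
  set u : Tangential n × ℂ → ℝ := fun p ↦ ∫ t in (0 : ℝ)..1,
    d ((p.1 : EuclideanSpace ℝ (Fin n)) + (t * ‖p.2‖ ^ 2) • inward n) with hu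
  have hus : ContDiffOn ℝ ∞ u B₀ := by
    refine contDiffOn_integral (g := fun q : (Tangential n × ℂ) × ℝ ↦
      d ((q.1.1 : EuclideanSpace ℝ (Fin n)) + (q.2 * ‖q.1.2‖ ^ 2) • inward n))
      (convex_ball _ _) Metric.isOpen_ball.uniqueDiffOn ?_
    refine hds.comp (t := s) (ContDiff.contDiffOn ?_) ?_
    · exact ((Tangential n).subtypeL.contDiff.comp (contDiff_fst.comp contDiff_fst)).add
        ((contDiff_snd.mul (hn2.comp contDiff_fst)).smul contDiff_const)
    · rintro ⟨p, t⟩ ⟨hp, ht⟩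
      exact hseg p hp t ht
  have hu0 : 0 < u (y₀, 0) := by
    have h1 : u (y₀, 0) = d (φ x₀) := by simp [hu, hy₀']
    have h2 : HasFDerivWithinAt F (chartDeriv (𝓡∂ n) f x₀) s (φ x₀) :=
      (hasFDerivWithinAt_chartDeriv (hf.mdifferentiable (by simp) x₀)).mono
        (hst.trans (extChartAt_target_subset_range x₀))
    rw [h1, hdd]
    simp only
    rwa [h2.fderivWithin (hsu _ hxs)]
  refine ⟨u, {p ∈ B₀ | 0 < u p}, ?_, ⟨Metric.mem_ball_self hr, hu0⟩, hus.mono (sep_subset _ _), ?_, ?_⟩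
  · exact hus.continuousOn.isOpen_inter_preimage Metric.isOpen_ball isOpen_Ioi
  · rintro p ⟨hp, hup⟩
    refine ⟨hup, hst (hball hp), ?_⟩
    have hder : ∀ t ∈ Icc (0 : ℝ) 1, HasDerivWithinAt
        (fun t : ℝ ↦ F ((p.1 : EuclideanSpace ℝ (Fin n)) + (t * ‖p.2‖ ^ 2) • inward n))
        (‖p.2‖ ^ 2 * d ((p.1 : EuclideanSpace ℝ (Fin n)) + (t * ‖p.2‖ ^ 2) • inward n))
        (Icc 0 1) t := by
      intro t ht
      have h1 := (hFs.differentiableOn (by simp) _ (hseg p hp t ht)).hasFDerivWithinAt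
      have h2 : HasDerivWithinAt
          (fun t : ℝ ↦ (p.1 : EuclideanSpace ℝ (Fin n)) + (t * ‖p.2‖ ^ 2) • inward n)
          ((‖p.2‖ ^ 2) • inward n) (Icc 0 1) t := by
        have := (((hasDerivAt_id t).mul_const (‖p.2‖ ^ 2)).smul_const (inward n)).const_add
          (p.1 : EuclideanSpace ℝ (Fin n))
        simpa using this.hasDerivWithinAt
      have h3 := h1.comp_hasDerivWithinAt t h2 (fun t ht ↦ hseg p hp t ht)
      refine h3.congr_deriv ?_
      simp [hdd]
    have hint : IntervalIntegrable (fun t : ℝ ↦ ‖p.2‖ ^ 2 *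
        d ((p.1 : EuclideanSpace ℝ (Fin n)) + (t * ‖p.2‖ ^ 2) • inward n)) MeasureTheory.volume 0 1 := by
      apply ContinuousOn.intervalIntegrable
      rw [uIcc_of_le zero_le_one]
      refine continuousOn_const.mul (hds.continuousOn.comp (by fun_prop) fun t ht ↦ hseg p hp t ht)
    have hftc := intervalIntegral.integral_eq_sub_of_hasDerivAt_of_le zero_le_one
      (fun t ht ↦ (hder t ht).continuousWithinAt)
      (fun t ht ↦ (hder t (Ioo_subset_Icc_self ht)).hasDerivAt (Icc_mem_nhds ht.1 ht.2)) hint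
    rw [intervalIntegral.integral_const_mul] at hftc
    have hF0 : F ((p.1 : EuclideanSpace ℝ (Fin n)) + ((0 : ℝ) * ‖p.2‖ ^ 2) • inward n) = 0 := by
      have h1 := hst (hseg p hp 0 (by simp))
      apply hz
      rw [mem_boundary_iff_chart (φ.map_target h1), φ.right_inv h1, add_smul_inward_zero, zero_mul]
    rw [hF0, one_mul, sub_zero] at hftc
    exact hftc.symm
  · intro y w w' h
    simp only [hu, h]

/-- In chart coordinates (y, s) the hypersurface is s·u = ‖z‖². Put s = ‖w‖² and z = √u · w: the map
(y, w) ↦ (y, √u · w) is a local diffeomorphism, so w, and with it s, is a smooth function of (y, z).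
The last clause allows every z of the right modulus, since u depends only on ‖w‖. -/
theorem exists_tube_parametrization {f : M → ℝ} {x₀ : M} (hx₀ : x₀ ∈ (𝓡∂ n).boundary M)
    (hf : ContMDiff (𝓡∂ n) 𝓘(ℝ, ℝ) ∞ f) (hz : ∀ x ∈ (𝓡∂ n).boundary M, f x = 0)
    (hd : 0 < chartDeriv (𝓡∂ n) f x₀ (inward n)) :
    ∃ (X : Tangential n × ℂ → M) (O : Set (Tangential n × ℂ)), IsOpen O ∧
      (tangentialProj n (extChartAt (𝓡∂ n) x₀ x₀), 0) ∈ O ∧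
      ContMDiffOn 𝓘(ℝ, Tangential n × ℂ) (𝓡∂ n) ∞ X O ∧
      X (tangentialProj n (extChartAt (𝓡∂ n) x₀ x₀), 0) = x₀ ∧
      (∀ p ∈ O, X p ∈ (extChartAt (𝓡∂ n) x₀).source ∧ f (X p) = ‖p.2‖ ^ 2 ∧
        tangentialProj n (extChartAt (𝓡∂ n) x₀ (X p)) = p.1) ∧
      ∃ N ∈ 𝓝 x₀, ∀ x ∈ N, ∀ z : ℂ, f x = ‖z‖ ^ 2 →
        (tangentialProj n (extChartAt (𝓡∂ n) x₀ x), z) ∈ O ∧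
        X (tangentialProj n (extChartAt (𝓡∂ n) x₀ x), z) = x := by
  obtain ⟨u, B, hB, h0B, hus, hu, huw⟩ := exists_transverse_factor hx₀ hf hz hd
  set φ := extChartAt (𝓡∂ n) x₀ with hφ
  set y₀ := tangentialProj n (φ x₀) with hy₀
  have h00 : φ x₀ 0 = 0 := (mem_boundary_iff_chart (mem_extChartAt_source x₀)).1 hx₀
  have hy₀' : (y₀ : EuclideanSpace ℝ (Fin n)) = φ x₀ := by
    have := tangentialProj_add (φ x₀)
    rwa [h00, zero_smul, add_zero] at this
  set j : Tangential n × ℂ → EuclideanSpace ℝ (Fin n) :=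
    fun p ↦ (p.1 : EuclideanSpace ℝ (Fin n)) + (‖p.2‖ ^ 2) • inward n with hj
  have hjs : ContDiff ℝ ∞ j :=
    ((Tangential n).subtypeL.contDiff.comp contDiff_fst).add
      ((contDiff_snd.norm_sq ℝ).smul contDiff_const)
  have hj0 : j (y₀, 0) = φ x₀ := by simp [hj, hy₀']
  have hsq : ContDiffOn ℝ ∞ (fun p ↦ √(u p)) B := hus.sqrt fun p hp ↦ (hu p hp).1.ne'
  set Λ : Tangential n × ℂ → Tangential n × ℂ := fun p ↦ (p.1, √(u p) • p.2) with hΛ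
  have hΛs : ContDiffOn ℝ ∞ Λ B := contDiffOn_fst.prodMk (hsq.smul contDiffOn_snd)
  set c := √(u (y₀, 0)) with hc
  have hc0 : c ≠ 0 := (Real.sqrt_pos.2 (hu _ h0B).1).ne'
  -- At w = 0 the derivative of √u is multiplied by zero, so the differential is diagonal, with the
  -- nonzero entry c on ℂ.
  have hL : HasFDerivAt Λ (((ContinuousLinearEquiv.refl ℝ (Tangential n)).prodCongr
      (ContinuousLinearEquiv.smulLeft (Units.mk0 c hc0)) :
        (Tangential n × ℂ) ≃L[ℝ] Tangential n × ℂ) :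
      Tangential n × ℂ →L[ℝ] Tangential n × ℂ) (y₀, 0) := by
    have h1 := ((hsq.contDiffAt (hB.mem_nhds h0B)).differentiableAt (by simp)).hasFDerivAt.smul
      (hasFDerivAt_snd (𝕜 := ℝ) (p := (y₀, (0 : ℂ))))
    refine (hasFDerivAt_fst.prodMk h1).congr_fderiv ?_
    ext v <;> simp [hc, Units.smul_def]
  obtain ⟨Φ, hΦ, h0Φ, hΦB, hΦs⟩ := exists_smooth_localInverse hB h0B hΛs _ hL
  have hΦ0 : Φ (y₀, 0) = (y₀, 0) := by rw [hΦ]; simp [hΛ]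
  have hsrc : ∀ q ∈ Φ.target, Φ.symm q ∈ B ∧ (Φ.symm q).1 = q.1 ∧
      √(u (Φ.symm q)) • (Φ.symm q).2 = q.2 := by
    intro q hq
    have h1 := Φ.right_inv hq
    rw [hΦ] at h1
    exact ⟨hΦB (Φ.map_target hq), (congrArg Prod.fst h1 :), (congrArg Prod.snd h1 :)⟩
  refine ⟨fun q ↦ φ.symm (j (Φ.symm q)), Φ.target, Φ.open_target, ?_, ?_, ?_, ?_, ?_⟩
  · simpa [hΦ0] using Φ.map_source h0Φ
  · refine (contMDiffOn_extChartAt_symm x₀).comp ?_ fun q hq ↦ (hu _ (hsrc q hq).1).2.1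
    exact (hjs.comp_contDiffOn hΦs).contMDiffOn
  · have : Φ.symm (y₀, 0) = (y₀, 0) := by
      conv_lhs => rw [← hΦ0]
      exact Φ.left_inv h0Φ
    simp only [this, hj0]
    exact extChartAt_to_inv x₀
  · intro q hq
    obtain ⟨h1, h2, h3⟩ := hsrc q hq
    obtain ⟨h4, h5, h6⟩ := hu _ h1
    refine ⟨φ.map_target h5, ?_, ?_⟩
    · refine h6.trans ?_
      rw [← h3, norm_smul, mul_pow, Real.norm_of_nonneg (Real.sqrt_nonneg _), Real.sq_sqrt h4.le,
        mul_comm]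
    · rw [φ.right_inv h5, tangentialProj_add_smul, h2]
  · obtain ⟨δ, hδ, hδΦ⟩ := Metric.mem_nhds_iff.1 (Φ.open_source.mem_nhds h0Φ)
    have hcφ : ContinuousAt φ x₀ := continuousAt_extChartAt x₀
    have hc1 : ContinuousAt (fun x ↦ tangentialProj n (φ x)) x₀ :=
      (tangentialProj n).continuous.continuousAt.comp hcφ
    have hc2 : ContinuousAt (fun x ↦ √(φ x 0)) x₀ :=
      (Real.continuous_sqrt.comp (EuclideanSpace.proj (0 : Fin n) :
        EuclideanSpace ℝ (Fin n) →L[ℝ] ℝ).continuous).continuousAt.comp hcφ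
    have hc3 : ∀ᶠ x in 𝓝 x₀, √(φ x 0) < δ := hc2.eventually (Iio_mem_nhds (by simpa [h00] using hδ))
    have hc4 : ∀ᶠ x in 𝓝 x₀, dist (tangentialProj n (φ x)) y₀ < δ :=
      hc1.eventually (Metric.ball_mem_nhds _ hδ)
    refine ⟨_, hc3.and (hc4.and (extChartAt_source_mem_nhds (I := 𝓡∂ n) x₀)), ?_⟩
    rintro x ⟨h1, h2, h3⟩ z hxz
    set y := tangentialProj n (φ x)
    set s := φ x 0 with hs
    have hs0 : 0 ≤ s := chart_zero_nonneg h3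
    have hmem : ∀ w : ℂ, ‖w‖ = √s → (y, w) ∈ Φ.source := by
      intro w hw
      apply hδΦ
      rw [Metric.mem_ball, Prod.dist_eq, max_lt_iff]
      exact ⟨h2, by simpa [hw] using h1⟩
    have hyB := hu _ (hΦB (hmem (√s : ℂ) (by simp [abs_of_nonneg])))
    -- Since u depends on w only through ‖w‖ = √s, its value is available before w = z/√a is
    -- defined.
    set a := u (y, (√s : ℂ)) with ha
    have hjx : ∀ w : ℂ, ‖w‖ = √s → j (y, w) = φ x := by
      intro w hw
      simp only [hj, hw, Real.sq_sqrt hs0]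
      exact tangentialProj_add _
    have hxa : ‖z‖ ^ 2 = s * a := by
      have h5 := hyB.2.2
      have h6 := hjx (√s : ℂ) (by simp [abs_of_nonneg])
      simp only [hj] at h6
      rw [h6, φ.left_inv h3, hxz] at h5
      rw [h5]
      simp [Real.sq_sqrt hs0]
    have hsa : 0 < √a := Real.sqrt_pos.2 hyB.1
    set w := (√a)⁻¹ • z with hw
    have hwn : ‖w‖ = √s := by
      rw [hw, norm_smul, norm_inv, Real.norm_of_nonneg hsa.le, ← Real.sqrt_sq (norm_nonneg z), hxa,
        Real.sqrt_mul hs0]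
      field_simp
    have hΛw : Φ (y, w) = (y, z) := by
      rw [hΦ, hΛ]
      simp only [Prod.mk.injEq, true_and]
      rw [huw y w (√s : ℂ) (by simp [hwn, abs_of_nonneg]), ← ha, hw, smul_smul,
        mul_inv_cancel₀ hsa.ne', one_smul]
    have hinv : Φ.symm (y, z) = (y, w) := by rw [← hΛw, Φ.left_inv (hmem w hwn)]
    refine ⟨hΛw ▸ Φ.map_source (hmem w hwn), ?_⟩
    simp only [hinv, hjx w hwn]
    exact φ.left_inv h3

end Tube

/-! ### Orbits -/

section Orbit

open Set Filter

variable {n : ℕ} [NeZero n] {M : Type*} [TopologicalSpace M] [ChartedSpace (EuclideanHalfSpace n) M]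
  {U : TopologicalSpace.Opens M} [MulAction Circle U] [IsManifold (𝓡∂ n) ∞ M]
  (hU : IsFreeActionNearBoundary n U)
include hU

theorem contMDiff_orbit {x : M} (hx : x ∈ U) :
    ContMDiff 𝓘(ℝ, ℝ) (𝓡∂ n) ∞ (fun t : ℝ ↦ act U (Circle.exp t) x) := fun _ ↦
  contMDiffAt_act_comp hU contMDiff_circleExp.contMDiffAt contMDiffAt_const hx

/-- Translation by exp(it₀) carries the velocity at time 0 to the velocity at time t₀. -/
theorem hasDerivAt_chart_orbit_of_zero {x : M} (hx : x ∈ U)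
    (h : HasDerivAt (fun t : ℝ ↦ extChartAt (𝓡∂ n) x (act U (Circle.exp t) x)) 0 0) {t₀ : ℝ}
    (ht : act U (Circle.exp t₀) x ∈ (extChartAt (𝓡∂ n) x).source) :
    HasDerivAt (fun t : ℝ ↦ extChartAt (𝓡∂ n) x (act U (Circle.exp t) x)) 0 t₀ := by
  set φ := extChartAt (𝓡∂ n) x with hφ
  have hg : ContMDiffAt (𝓡∂ n) 𝓘(ℝ, EuclideanSpace ℝ (Fin n)) ∞
      (fun y ↦ φ (act U (Circle.exp t₀) y)) x :=
    (contMDiffAt_extChartAt' (by simpa [hφ] using ht)).comp x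
      (contMDiffAt_act_const hU (Circle.exp t₀) hx)
  have h1 := hasFDerivWithinAt_chartDeriv (hg.mdifferentiableAt (by simp))
  have h0 : φ x = (fun t : ℝ ↦ φ (act U (Circle.exp t) x)) 0 := by simp [act_one]
  have hsrc : ∀ᶠ t in 𝓝 (0 : ℝ), act U (Circle.exp t) x ∈ φ.source := by
    refine (contMDiff_orbit hU hx).continuous.continuousAt.eventually ?_
    simp only [Circle.exp_zero, act_one]
    exact extChartAt_source_mem_nhds x
  rw [h0] at h1
  have h2 := h1.comp_hasDerivAt (0 : ℝ) h (by
    filter_upwards [hsrc] with t ht'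
    exact extChartAt_target_subset_range x (φ.map_source ht'))
  have h3 : HasDerivAt (fun s : ℝ ↦ φ (act U (Circle.exp (t₀ + s)) x)) 0 0 := by
    refine (h2.congr_deriv (map_zero _)).congr_of_eventuallyEq ?_
    filter_upwards [hsrc] with s hs
    simp only [Function.comp, Circle.exp_add, act_mul]
    rw [φ.left_inv hs]
  have h4 := HasDerivAt.comp_sub_const t₀ t₀ (by rwa [sub_self] : HasDerivAt _ _ (t₀ - t₀))
    (f := fun s : ℝ ↦ φ (act U (Circle.exp (t₀ + s)) x))
  simpa using h4

theorem differentiableAt_chart_orbit {x : M} (hx : x ∈ U) :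
    DifferentiableAt ℝ (fun t : ℝ ↦ extChartAt (𝓡∂ n) x (act U (Circle.exp t) x)) 0 := by
  rw [← mdifferentiableAt_iff_differentiableAt]
  refine MDifferentiableAt.comp (I' := 𝓡∂ n) (0 : ℝ) ?_ ((contMDiff_orbit hU hx).mdifferentiable (by simp) 0)
  refine (contMDiffAt_extChartAt' (n := ∞) ?_).mdifferentiableAt (by simp)
  simp [act_one]

/-- A vanishing velocity would make the orbit constant for a short time, against freeness. -/
theorem deriv_chart_orbit_ne_zero {x : M} (hx : x ∈ U) :
    deriv (fun t : ℝ ↦ extChartAt (𝓡∂ n) x (act U (Circle.exp t) x)) 0 ≠ 0 := by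
  intro h
  have hd := (differentiableAt_chart_orbit hU hx).hasDerivAt
  rw [h] at hd
  set φ := extChartAt (𝓡∂ n) x with hφ
  have hsrc : ∀ᶠ t in 𝓝 (0 : ℝ), act U (Circle.exp t) x ∈ φ.source := by
    refine (contMDiff_orbit hU hx).continuous.continuousAt.eventually ?_
    simp only [Circle.exp_zero, act_one]
    exact extChartAt_source_mem_nhds x
  obtain ⟨δ, hδ, hb⟩ := Metric.eventually_nhds_iff_ball.1 hsrc
  have hall : ∀ t ∈ Metric.ball (0 : ℝ) δ,
      HasDerivAt (fun t : ℝ ↦ φ (act U (Circle.exp t) x)) 0 t :=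
    fun t ht ↦ hasDerivAt_chart_orbit_of_zero hU hx hd (hb t ht)
  -- The bound 1 < π ensures that exp(it) has argument t, hence differs from 1.
  set t := min (δ / 2) 1 with ht
  have ht0 : 0 < t := lt_min (by positivity) one_pos
  have htb : t ∈ Metric.ball (0 : ℝ) δ := by
    rw [Metric.mem_ball, Real.dist_eq, sub_zero, abs_of_pos ht0]
    exact (min_le_left _ _).trans_lt (by linarith)
  have h1 := Metric.isOpen_ball.is_const_of_deriv_eq_zero (convex_ball (0 : ℝ) δ).isPreconnected
    (fun t ht ↦ (hall t ht).differentiableAt.differentiableWithinAt) (fun t ht ↦ (hall t ht).deriv)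
    htb (Metric.mem_ball_self hδ)
  have h2 := φ.injOn (hb t htb) (hb 0 (Metric.mem_ball_self hδ)) h1
  simp only [Circle.exp_zero, act_one] at h2
  have h3 := eq_one_of_act_eq hU hx h2
  have h4 := Circle.arg_exp (x := t) (by linarith [Real.pi_pos])
    ((min_le_right _ _).trans (by linarith [Real.pi_gt_three]))
  rw [h3] at h4
  simp at h4
  exact ht0.ne h4

/-- The velocity of the orbit of a boundary point, in the bounding hyperplane. -/
theorem exists_orbit_velocity {x : M} (hx : x ∈ (𝓡∂ n).boundary M) :
    ∃ ξ : Tangential n, ξ ≠ 0 ∧ HasDerivAt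
      (fun t : ℝ ↦ tangentialProj n (extChartAt (𝓡∂ n) x (act U (Circle.exp t) x))) ξ 0 := by
  have hxU := hU.boundary_subset hx
  set φ := extChartAt (𝓡∂ n) x with hφ
  have hd := (differentiableAt_chart_orbit hU hxU).hasDerivAt
  set v := deriv (fun t : ℝ ↦ φ (act U (Circle.exp t) x)) 0 with hv
  have h1 := (tangentialProj n).hasFDerivAt.comp_hasDerivAt (0 : ℝ) hd
  have h2 := (EuclideanSpace.proj (0 : Fin n) :
    EuclideanSpace ℝ (Fin n) →L[ℝ] ℝ).hasFDerivAt.comp_hasDerivAt (0 : ℝ) hd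
  have hsrc : ∀ᶠ t in 𝓝 (0 : ℝ), act U (Circle.exp t) x ∈ φ.source := by
    refine (contMDiff_orbit hU hxU).continuous.continuousAt.eventually ?_
    simp only [Circle.exp_zero, act_one]
    exact extChartAt_source_mem_nhds x
  have h3 : v 0 = 0 := by
    refine h2.unique ((hasDerivAt_const (0 : ℝ) (0 : ℝ)).congr_of_eventuallyEq ?_)
    filter_upwards [hsrc] with t ht
    exact (mem_boundary_iff_chart ht).1 ((act_mem_boundary hU _).2 hx)
  refine ⟨tangentialProj n v, fun h ↦ deriv_chart_orbit_ne_zero hU hxU ?_, h1⟩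
  have := tangentialProj_add v
  rwa [h, h3, zero_smul, add_zero, Submodule.coe_zero, eq_comm] at this

end Orbit

/-! ### The local model near a boundary orbit -/

section Slice

open Set Filter

variable {n : ℕ} [NeZero n] {M : Type*} [TopologicalSpace M] [ChartedSpace (EuclideanHalfSpace n) M]
  {U : TopologicalSpace.Opens M} [MulAction Circle U]

variable (n U) in
/-- A parametrization, by a bidisc in `K × ℂ`, of the quotient of the hypersurface
`f x = ‖z‖ ^ 2` in `M × ℂ` by the antidiagonal circle action, near the point `(x₀, 0)`. The point
`(k, ζ)` represents the orbit of `(X (k, ζ), ζ)`. -/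
structure SliceModel (f : M → ℝ) (V : Set M) (x₀ : M) (K : Type) [NormedAddCommGroup K]
    [NormedSpace ℝ K] where
  /-- The radius of the bidisc. -/
  radius : ℝ
  radius_pos : 0 < radius
  /-- The slice. -/
  X : K × ℂ → M
  smooth : ContMDiffOn 𝓘(ℝ, K × ℂ) (𝓡∂ n) ∞ X (bidisc K radius)
  base : X 0 = x₀
  mem : ∀ p ∈ bidisc K radius, X p ∈ V
  mem_source : ∀ p ∈ bidisc K radius, X p ∈ (extChartAt (𝓡∂ n) x₀).source
  level : ∀ p ∈ bidisc K radius, f (X p) = ‖p.2‖ ^ 2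
  rotate : ∀ p ∈ bidisc K radius, ∀ a : Circle, X (p.1, a * p.2) = X p
  free : ∀ k k' ζ (a : Circle), (k, ζ) ∈ bidisc K radius → (k', ζ) ∈ bidisc K radius →
    X (k', ζ) = act U a (X (k, ζ)) → a = 1 ∧ k' = k
  /-- The domain of the reconstruction. -/
  N : Set (M × ℂ)
  /-- The time that the flow needs to reach a point from the slice. -/
  time : M × ℂ → ℝ
  /-- The projection to the slice. -/
  proj : M × ℂ → K
  isOpen_N : IsOpen N
  smooth_time : ContMDiffOn ((𝓡∂ n).prod 𝓘(ℝ, ℂ)) 𝓘(ℝ, ℝ) ∞ time N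
  smooth_proj : ContMDiffOn ((𝓡∂ n).prod 𝓘(ℝ, ℂ)) 𝓘(ℝ, K) ∞ proj N
  mem_N : ∀ p ∈ bidisc K radius, (X p, p.2) ∈ N
  time_slice : ∀ p ∈ bidisc K radius, time (X p, p.2) = 0
  proj_slice : ∀ p ∈ bidisc K radius, proj (X p, p.2) = p.1
  proj_mem : ∀ q ∈ N, (proj q, q.2) ∈ bidisc K radius
  reconstruct : ∀ q ∈ N, f q.1 = ‖q.2‖ ^ 2 →
    q.1 = act U (Circle.exp (time q)) (X (proj q, q.2))

theorem exists_bidisc_subset {K : Type} [NormedAddCommGroup K] [NormedSpace ℝ K] {s : Set (K × ℂ)}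
    (hs : s ∈ 𝓝 (0 : K × ℂ)) : ∃ r > 0, bidisc K r ⊆ s := by
  obtain ⟨r, hr, h⟩ := Metric.mem_nhds_iff.1 hs
  refine ⟨r, hr, fun p hp ↦ h ?_⟩
  rw [mem_bidisc] at hp
  rw [mem_ball_zero_iff, Prod.norm_def, max_lt_iff]
  exact hp

theorem finrank_tangential : Module.finrank ℝ (Tangential n) + 1 = n := by
  have h := LinearMap.finrank_range_add_finrank_ker
    ((EuclideanSpace.proj (0 : Fin n) : EuclideanSpace ℝ (Fin n) →L[ℝ] ℝ) :
    EuclideanSpace ℝ (Fin n) →ₗ[ℝ] ℝ)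
  have hs : LinearMap.range ((EuclideanSpace.proj (0 : Fin n) : EuclideanSpace ℝ (Fin n) →L[ℝ] ℝ) :
    EuclideanSpace ℝ (Fin n) →ₗ[ℝ] ℝ) = ⊤ := by
    rw [LinearMap.range_eq_top]
    exact fun c ↦ ⟨c • inward n, by simp⟩
  rw [hs, finrank_top, Module.finrank_self, finrank_euclideanSpace_fin, add_comm] at h
  exact h

/-- The complement is parametrized by a Euclidean space, so that its dimension is explicit. The map
`D` is described by its values because it will be the derivative of the flow-out of the slice. -/
theorem exists_complement_parametrization {T : Type} [NormedAddCommGroup T] [NormedSpace ℝ T]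
    [FiniteDimensional ℝ T] {ξ : T} (hξ : ξ ≠ 0) :
    ∃ (m : ℕ) (ι : EuclideanSpace ℝ (Fin m) →L[ℝ] T), m + 1 = Module.finrank ℝ T ∧
      ∀ D : ℝ × (EuclideanSpace ℝ (Fin m) × ℂ) →L[ℝ] T × ℂ,
        (∀ s p, D (s, p) = (s • ξ + ι p.1, p.2)) →
        ∃ e : (ℝ × (EuclideanSpace ℝ (Fin m) × ℂ)) ≃L[ℝ] T × ℂ,
          (e : ℝ × (EuclideanSpace ℝ (Fin m) × ℂ) →L[ℝ] T × ℂ) = D := by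
  obtain ⟨K, hK⟩ := Submodule.exists_isCompl (ℝ ∙ ξ)
  have h1 := Submodule.finrank_add_eq_of_isCompl hK
  rw [finrank_span_singleton hξ] at h1
  set m := Module.finrank ℝ K
  have hm : Module.finrank ℝ (EuclideanSpace ℝ (Fin m)) = Module.finrank ℝ K := by simp [m]
  set ε := ContinuousLinearEquiv.ofFinrankEq hm
  refine ⟨m, K.subtypeL.comp (ε : EuclideanSpace ℝ (Fin m) →L[ℝ] K), by omega, fun D hD ↦ ?_⟩
  have hinj : LinearMap.ker (D : ℝ × (EuclideanSpace ℝ (Fin m) × ℂ) →ₗ[ℝ] T × ℂ) = ⊥ := by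
    rw [LinearMap.ker_eq_bot']
    rintro ⟨s, k, ζ⟩ h
    replace h : D (s, (k, ζ)) = 0 := h
    rw [hD, Prod.mk_eq_zero] at h
    obtain ⟨h1, rfl⟩ := h
    replace h1 : s • ξ + (ε k : T) = 0 := h1
    have h2 : s • ξ = -(ε k : T) := eq_neg_of_add_eq_zero_left h1
    have h3 : s • ξ = 0 := by
      refine Submodule.disjoint_def.1 hK.disjoint _ (Submodule.smul_mem _ _
        (Submodule.mem_span_singleton_self ξ)) ?_
      rw [h2]
      exact K.neg_mem (ε k).2
    have h4 : s = 0 := (smul_eq_zero.1 h3).resolve_right hξ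
    subst h4
    have h5 : ε k = 0 := by simpa using h1
    have h6 : k = 0 := by simpa using h5
    simp [h6]
  have hsurj : LinearMap.range (D : ℝ × (EuclideanSpace ℝ (Fin m) × ℂ) →ₗ[ℝ] T × ℂ) = ⊤ := by
    rw [LinearMap.range_eq_top]
    rintro ⟨y, z⟩
    have : y ∈ (ℝ ∙ ξ) ⊔ K := by rw [hK.sup_eq_top]; trivial
    obtain ⟨v, hv, k, hk, rfl⟩ := Submodule.mem_sup.1 this
    obtain ⟨s, rfl⟩ := Submodule.mem_span_singleton.1 hv
    refine ⟨(s, (ε.symm ⟨k, hk⟩, z)), (hD _ _).trans ?_⟩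
    simp
  exact ⟨ContinuousLinearEquiv.ofBijective D hinj hsurj, by ext <;> rfl⟩

variable [IsManifold (𝓡∂ n) ∞ M] [T2Space M] (hU : IsFreeActionNearBoundary n U)
include hU

/-- Freeness at the base point and compactness of the circle: a group element that matches two
nearby points is close to 1. The inverse function theorem does not see the elements far from 1. -/
theorem eventually_mem_of_act_eq {Y : Type*} [TopologicalSpace Y] {g h : Y → M} {y : Y}
    (hg : ContinuousAt g y) (hh : ContinuousAt h y) (hgh : g y = h y) (hy : g y ∈ U)
    {A : Set Circle} (hA : A ∈ 𝓝 1) :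
    ∀ᶠ y' in 𝓝 y, ∀ a : Circle, h y' = act U a (g y') → a ∈ A := by
  have h1 : ∀ᶠ y' in 𝓝 y, ∀ a ∈ (interior A)ᶜ, h y' ≠ act U a (g y') := by
    refine isOpen_interior.isClosed_compl.isCompact.eventually_forall_of_forall_eventually
      (P := fun y' a ↦ h y' ≠ act U a (g y')) ?_
    intro a ha
    have hc := continuousAt_act_comp hU (a := fun z : Y × Circle ↦ z.2)
      (g := fun z : Y × Circle ↦ g z.1) (y := (y, a)) continuousAt_snd
      (ContinuousAt.comp (g := g) hg continuousAt_fst) hy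
    have hc' : ContinuousAt (fun z : Y × Circle ↦ h z.1) (y, a) :=
      ContinuousAt.comp (g := h) hh continuousAt_fst
    refine (hc'.ne_iff_eventually_ne hc).1 ?_
    simp only [← hgh]
    intro h2
    rw [eq_one_of_act_eq hU hy h2.symm] at ha
    exact ha (mem_interior_iff_mem_nhds.2 hA)
  filter_upwards [h1] with y' h2 a h3
  by_contra h4
  exact h2 a (fun h ↦ h4 (interior_subset h)) h3

set_option maxHeartbeats 1000000 in
-- The tube parametrization is restricted to an affine complement of the orbit direction and flowed
-- out by the action. The flow-out has invertible differential in the coordinates (y, z), and its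
-- inverse provides the time and the projection. The hyperplane has dimension n − 1 and the orbit
-- takes away one more, hence m + 2 = n.
theorem exists_sliceModel {f : M → ℝ} (hf : IsInvariantBoundaryDefining n U f) {V : Set M}
    (hV : IsInvariantNhd n U V) (hfV : ∀ a, ∀ x ∈ V, f (act U a x) = f x) {x₀ : M}
    (hx₀ : x₀ ∈ (𝓡∂ n).boundary M) :
    ∃ m : ℕ, m + 2 = n ∧ Nonempty (SliceModel n U f V x₀ (EuclideanSpace ℝ (Fin m))) := by
  have hd : 0 < chartDeriv (𝓡∂ n) f x₀ (inward n) := by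
    refine chartDeriv_inward_pos hx₀ (hf.smooth.mdifferentiable (by simp) x₀)
      (Eventually.of_forall hf.nonneg) (Eventually.of_forall fun z ↦ (hf.zero_iff z).2) fun h ↦ ?_
    refine hf.deriv_ne_zero x₀ hx₀ (ContinuousLinearMap.ext fun v ↦ ?_)
    refine (mfderiv_apply_eq_chartDeriv (hf.smooth.mdifferentiable (by simp) x₀) v).trans ?_
    rw [h]
    rfl
  obtain ⟨Xb, Ob, hOb, h0b, hXs, hX0, hXp, N', hN', hXN⟩ := exists_tube_parametrization hx₀ hf.smooth
    (fun x hx ↦ (hf.zero_iff x).2 hx) hd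
  obtain ⟨ξ, hξ, hξd⟩ := exists_orbit_velocity hU hx₀
  obtain ⟨m, ι, hm, hι⟩ := exists_complement_parametrization hξ
  refine ⟨m, by have := finrank_tangential (n := n); omega, ?_⟩
  let K := EuclideanSpace ℝ (Fin m)
  set φ := extChartAt (𝓡∂ n) x₀ with hφ
  set y₀ := tangentialProj n (φ x₀) with hy₀
  have hxU : x₀ ∈ U := hU.boundary_subset hx₀
  obtain ⟨N₁, hN₁, hN₁o, hx₀N⟩ : ∃ N₁ ⊆ N' ∩ φ.source ∩ V, IsOpen N₁ ∧ x₀ ∈ N₁ :=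
    mem_nhds_iff.1 (inter_mem (inter_mem hN' (extChartAt_source_mem_nhds x₀))
      (hV.isOpen.mem_nhds (hV.boundary_subset hx₀)))
  set A : K × ℂ → Tangential n × ℂ := fun p ↦ (y₀ + ι p.1, p.2) with hA
  have hAs : ContDiff ℝ ∞ A :=
    (contDiff_const.add (ι.contDiff.comp contDiff_fst)).prodMk contDiff_snd
  have hA0 : A 0 = (y₀, 0) := by simp [hA]
  set X : K × ℂ → M := fun p ↦ Xb (A p) with hX
  have hXO₁ : ContMDiffOn 𝓘(ℝ, K × ℂ) (𝓡∂ n) ∞ X (A ⁻¹' Ob) :=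
    hXs.comp hAs.contMDiff.contMDiffOn fun p hp ↦ hp
  have hX00 : X 0 = x₀ := by simp only [hX, hA0, hX0]
  set O₂ := A ⁻¹' Ob ∩ X ⁻¹' N₁ with hO₂
  have hO₂o : IsOpen O₂ := hXO₁.continuousOn.isOpen_inter_preimage (hOb.preimage hAs.continuous) hN₁o
  have h0O₂ : (0 : K × ℂ) ∈ O₂ := ⟨by rwa [mem_preimage, hA0], by rwa [mem_preimage, hX00]⟩
  have hXO₂ := hXO₁.mono (inter_subset_left (s := A ⁻¹' Ob) (t := X ⁻¹' N₁))
  set Γ : ℝ × (K × ℂ) → M := fun q ↦ act U (Circle.exp q.1) (X q.2) with hΓ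
  have hXU : ∀ p ∈ O₂, X p ∈ U := fun p hp ↦ hV.subset (hN₁ hp.2).2
  have hΓs : ContMDiffOn 𝓘(ℝ, ℝ × (K × ℂ)) (𝓡∂ n) ∞ Γ (univ ×ˢ O₂) := by
    intro q hq
    refine contMDiffWithinAt_act_comp hU ?_ ?_ (hXU _ hq.2)
    · exact (contMDiff_circleExp.comp (contDiff_fst.contMDiff)).contMDiffAt.contMDiffWithinAt
    · exact (hXO₂ q.2 hq.2).comp q contDiff_snd.contMDiff.contMDiffAt.contMDiffWithinAt
        (fun q' hq' ↦ hq'.2)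
  set O₃ := univ ×ˢ O₂ ∩ Γ ⁻¹' N₁ with hO₃
  have hO₃o : IsOpen O₃ := hΓs.continuousOn.isOpen_inter_preimage (isOpen_univ.prod hO₂o) hN₁o
  have hΓ0 : ∀ p, Γ (0, p) = X p := fun p ↦ by simp [hΓ, act_one]
  have h0O₃ : ((0 : ℝ), (0 : K × ℂ)) ∈ O₃ := ⟨⟨trivial, h0O₂⟩, by
    rw [mem_preimage, hΓ0, hX00]; exact hx₀N⟩
  -- The transverse coordinate is not recorded: it is determined by the tangential ones and ζ,
  -- because the flow preserves f.
  set Υ : ℝ × (K × ℂ) → Tangential n × ℂ := fun q ↦ (tangentialProj n (φ (Γ q)), q.2.2) with hΥ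
  have hΥs : ContDiffOn ℝ ∞ Υ O₃ := by
    refine ContDiffOn.prodMk ((tangentialProj n).contDiff.comp_contDiffOn ?_)
      (contDiff_snd.comp contDiff_snd).contDiffOn
    rw [← contMDiffOn_iff_contDiffOn]
    exact (contMDiffOn_extChartAt (x := x₀)).comp (hΓs.mono inter_subset_left)
      fun q hq ↦ by simpa [hφ] using (hN₁ hq.2).1.2
  have hΥ0 : ∀ p ∈ O₂, Υ (0, p) = A p := by
    intro p hp
    simp only [hΥ, hΓ0]
    rw [(hXp _ hp.1).2.2]
  have hD := ((hΥs.contDiffAt (hO₃o.mem_nhds h0O₃)).differentiableAt (by simp)).hasFDerivAt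
  set D := fderiv ℝ Υ (0, 0) with hDdef
  have hD1 : D (1, 0) = (ξ, 0) := by
    have h1 : HasDerivAt (fun s : ℝ ↦ (s, (0 : K × ℂ))) (1, 0) 0 :=
      (hasDerivAt_id (0 : ℝ)).prodMk (hasDerivAt_const _ _)
    have h2 := HasFDerivAt.comp_hasDerivAt (0 : ℝ) (f := fun s : ℝ ↦ (s, (0 : K × ℂ))) hD h1
    refine h2.unique ((hξd.prodMk (hasDerivAt_const (0 : ℝ) (0 : ℂ))).congr_of_eventuallyEq
      (Eventually.of_forall fun s ↦ ?_))
    simp [hΥ, hΓ, hX00]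
  have hD2 : ∀ p, D (0, p) = (ι p.1, p.2) := by
    have h1 : HasFDerivAt (fun p : K × ℂ ↦ ((0 : ℝ), p)) (ContinuousLinearMap.inr ℝ ℝ (K × ℂ)) 0 :=
      (ContinuousLinearMap.inr ℝ ℝ (K × ℂ)).hasFDerivAt
    have h2 := HasFDerivAt.comp (0 : K × ℂ) (f := fun p : K × ℂ ↦ ((0 : ℝ), p)) hD h1
    have h3 : HasFDerivAt A ((ι.comp (ContinuousLinearMap.fst ℝ K ℂ)).prod
        (ContinuousLinearMap.snd ℝ K ℂ)) 0 :=
      ((ι.comp (ContinuousLinearMap.fst ℝ K ℂ)).hasFDerivAt.const_add y₀).prodMk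
        (ContinuousLinearMap.snd ℝ K ℂ).hasFDerivAt
    have h4 := h2.unique (h3.congr_of_eventuallyEq (by
      filter_upwards [hO₂o.mem_nhds h0O₂] with p hp using hΥ0 p hp))
    intro p
    exact congrArg (fun l : K × ℂ →L[ℝ] Tangential n × ℂ ↦ l p) h4
  have hDv : ∀ s p, D (s, p) = (s • ξ + ι p.1, p.2) := by
    intro s p
    have : (s, p) = s • ((1 : ℝ), (0 : K × ℂ)) + (0, p) := by simp
    rw [this, map_add, map_smul, hD1, hD2]
    simp
  obtain ⟨e, he⟩ := hι D hDv
  obtain ⟨Φ, hΦ, h0Φ, hΦO, hΦs⟩ := exists_smooth_localInverse hO₃o h0O₃ hΥs e (he ▸ hD)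
  obtain ⟨δ, hδ, hδΦ⟩ := Metric.mem_nhds_iff.1 (Φ.open_source.mem_nhds h0Φ)
  have hδ' : ∀ (s : ℝ) (p : K × ℂ), |s| < δ → ‖p‖ < δ → (s, p) ∈ Φ.source := by
    intro s p hs hp
    apply hδΦ
    rw [Metric.mem_ball, Prod.dist_eq, max_lt_iff]
    simpa using ⟨hs, hp⟩
  have hXc : ContinuousAt X 0 := hXO₂.continuousOn.continuousAt (hO₂o.mem_nhds h0O₂)
  -- Elements matching two slice points near the base point have small argument, so they are reached
  -- within the domain where `Φ` is injective.
  have hfree : ∀ᶠ q : (K × ℂ) × (K × ℂ) in 𝓝 0, ∀ a : Circle, X q.2 = act U a (X q.1) →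
      a ∈ {a : Circle | |Complex.arg a| < δ} := by
    refine eventually_mem_of_act_eq hU (g := fun q : (K × ℂ) × (K × ℂ) ↦ X q.1)
      (h := fun q ↦ X q.2) (ContinuousAt.comp (g := X) hXc continuousAt_fst)
      (ContinuousAt.comp (g := X) hXc continuousAt_snd) rfl (hXU 0 h0O₂) ?_
    have : ContinuousAt (fun a : Circle ↦ |Complex.arg a|) 1 :=
      (ContinuousAt.comp (g := Complex.arg) (Complex.continuousAt_arg (by simp))
        (continuous_induced_dom : Continuous ((↑) : Circle → ℂ)).continuousAt).abs
    exact this.eventually (Iio_mem_nhds (by simpa using hδ))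
  obtain ⟨ρ, hρ, hρf⟩ := Metric.eventually_nhds_iff_ball.1 hfree
  obtain ⟨r₂, hr₂, hr₂O⟩ := exists_bidisc_subset (hO₂o.mem_nhds h0O₂)
  -- r₂ keeps the bidisc in the domain of the slice, ρ makes `hfree` applicable, and δ keeps the
  -- points in the source of `Φ`.
  set r := min r₂ (min ρ δ) with hr
  have hbO : ∀ p ∈ bidisc K r, p ∈ O₂ := fun p hp ↦ hr₂O (by
    rw [mem_bidisc] at hp ⊢
    exact ⟨hp.1.trans_le (min_le_left _ _), hp.2.trans_le (min_le_left _ _)⟩)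
  have hbn : ∀ p ∈ bidisc K r, ‖p‖ < min ρ δ := fun p hp ↦ by
    rw [mem_bidisc] at hp
    rw [Prod.norm_def, max_lt_iff]
    exact ⟨hp.1.trans_le (min_le_right _ _), hp.2.trans_le (min_le_right _ _)⟩
  have hbΦ : ∀ p ∈ bidisc K r, ∀ s : ℝ, |s| < δ → (s, p) ∈ Φ.source := fun p hp s hs ↦
    hδ' s p hs ((hbn p hp).trans_le (min_le_right _ _))
  have hlev : ∀ p ∈ O₂, f (X p) = ‖p.2‖ ^ 2 := fun p hp ↦ (hXp _ hp.1).2.1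
  have hpr : ∀ p ∈ O₂, tangentialProj n (φ (X p)) = y₀ + ι p.1 :=
    fun p hp ↦ (hXp _ hp.1).2.2
  set μ : M × ℂ → Tangential n × ℂ := fun q ↦ (tangentialProj n (φ q.1), q.2) with hμ
  have hms : ContMDiffOn ((𝓡∂ n).prod 𝓘(ℝ, ℂ)) 𝓘(ℝ, Tangential n × ℂ) ∞ μ (N₁ ×ˢ univ) := by
    refine ContMDiffOn.prodMk_space ?_ contMDiff_snd.contMDiffOn
    refine (tangentialProj n).contMDiff.comp_contMDiffOn ?_
    exact (contMDiffOn_extChartAt (x := x₀)).comp contMDiff_fst.contMDiffOn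
      fun q hq ↦ by simpa [hφ] using (hN₁ hq.1).1.2
  set W := Φ.target ∩ Φ.symm ⁻¹' (Prod.snd ⁻¹' bidisc K r) with hW
  have hWo : IsOpen W := Φ.symm.continuousOn.isOpen_inter_preimage Φ.open_target
    ((isOpen_bidisc r).preimage continuous_snd)
  set N := N₁ ×ˢ univ ∩ μ ⁻¹' W with hN
  have hNs : ContMDiffOn ((𝓡∂ n).prod 𝓘(ℝ, ℂ)) 𝓘(ℝ, ℝ × (K × ℂ)) ∞ (fun q ↦ Φ.symm (μ q)) N :=
    hΦs.contMDiffOn.comp (hms.mono inter_subset_left) fun q hq ↦ hq.2.1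
  have hΦm : ∀ p ∈ bidisc K r, Φ.symm (μ (X p, p.2)) = (0, p) := by
    intro p hp
    have : μ (X p, p.2) = Φ (0, p) := by
      rw [hΦ, hΥ0 p (hbO p hp)]
      simp only [hμ, hA, hpr p (hbO p hp)]
    rw [this, Φ.left_inv (hbΦ p hp 0 (by simpa using hδ))]
  have hinv : ∀ q ∈ N, Υ (Φ.symm (μ q)) = μ q := fun q hq ↦ by rw [← hΦ, Φ.right_inv hq.2.1]
  have hsnd : ∀ q ∈ N, (Φ.symm (μ q)).2.2 = q.2 := fun q hq ↦ congrArg Prod.snd (hinv q hq)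
  have hpair : ∀ q ∈ N, ((Φ.symm (μ q)).2.1, q.2) = (Φ.symm (μ q)).2 := fun q hq ↦
    Prod.ext rfl (hsnd q hq).symm
  refine ⟨{
    radius := r
    radius_pos := lt_min hr₂ (lt_min hρ hδ)
    X := X
    smooth := hXO₂.mono hbO
    base := hX00
    mem := fun p hp ↦ (hN₁ (hbO p hp).2).2
    mem_source := fun p hp ↦ (hN₁ (hbO p hp).2).1.2
    level := fun p hp ↦ hlev p (hbO p hp)
    rotate := fun p hp a ↦ ?_
    free := fun k k' ζ a hk hk' h ↦ ?_
    N := N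
    time := fun q ↦ (Φ.symm (μ q)).1
    proj := fun q ↦ (Φ.symm (μ q)).2.1
    isOpen_N := hms.continuousOn.isOpen_inter_preimage (hN₁o.prod isOpen_univ) hWo
    smooth_time := contDiff_fst.contMDiff.comp_contMDiffOn hNs
    smooth_proj := (contDiff_fst.comp contDiff_snd).contMDiff.comp_contMDiffOn hNs
    mem_N := fun p hp ↦ ?_
    time_slice := fun p hp ↦ by rw [hΦm p hp]
    proj_slice := fun p hp ↦ by rw [hΦm p hp]
    proj_mem := fun q hq ↦ by rw [hpair q hq]; exact hq.2.2
    reconstruct := fun q hq h ↦ ?_ }⟩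
  -- The point X(k, aζ) has tangential coordinates given by k and lies on the level ‖ζ‖², so the
  -- tube parametrization at (k, ζ) also returns it.
  · have h1 : (p.1, (a : ℂ) * p.2) ∈ bidisc K r := (circle_mul_mem_bidisc a).2 hp
    have h2 := hXN _ (hN₁ (hbO _ h1).2).1.1 p.2 (by
      rw [hlev _ (hbO _ h1), norm_mul, Circle.norm_coe, one_mul])
    rw [hpr _ (hbO _ h1)] at h2
    exact h2.2.symm
  -- Once arg a is small, (arg a, k, ζ) and (0, k', ζ) have the same image under the injective `Φ`.
  · have h1 := hρf ((k, ζ), (k', ζ)) (by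
      rw [mem_ball_zero_iff, Prod.norm_def, max_lt_iff]
      exact ⟨(hbn _ hk).trans_le (min_le_left _ _), (hbn _ hk').trans_le (min_le_left _ _)⟩) a h
    have h2 : Υ (Complex.arg a, (k, ζ)) = Υ (0, (k', ζ)) := by
      simp only [hΥ, hΓ, Circle.exp_arg, Circle.exp_zero, act_one, ← h]
    rw [← hΦ, ← hΦ] at h2
    have h3 := Φ.injOn (hbΦ _ hk _ h1) (hbΦ _ hk' 0 (by simpa using hδ)) h2
    simp only [Prod.mk.injEq, and_true] at h3
    refine ⟨?_, h3.2.symm⟩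
    rw [← Circle.exp_arg a, h3.1, Circle.exp_zero]
  · refine ⟨⟨(hbO p hp).2, trivial⟩, ?_, ?_⟩
    · have : μ (X p, p.2) = Φ (0, p) := by
        rw [hΦ, hΥ0 p (hbO p hp)]
        simp only [hμ, hA, hpr p (hbO p hp)]
      rw [this]
      exact Φ.map_source (hbΦ p hp 0 (by simpa using hδ))
    · rw [mem_preimage, hΦm p hp]
      exact hp
  -- The flowed slice point and q have equal tangential coordinates and lie on the same level of f,
  -- so the tube parametrization identifies them.
  · rw [hpair q hq]
    set w := Φ.symm (μ q) with hw
    have h1 : w ∈ O₃ := hΦO (Φ.map_target hq.2.1)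
    have h2 : Γ w ∈ N₁ := h1.2
    have h3 : f (Γ w) = ‖q.2‖ ^ 2 := by
      rw [hΓ]
      simp only
      rw [hfV _ _ (hN₁ h1.1.2.2).2, hlev _ h1.1.2, hsnd q hq]
    have h4 : tangentialProj n (φ (Γ w)) = tangentialProj n (φ q.1) := congrArg Prod.fst (hinv q hq)
    have h5 := (hXN _ (hN₁ h2).1.1 _ h3).2
    have h6 := (hXN _ (hN₁ hq.1.1).1.1 _ h).2
    rw [h4, h6] at h5
    exact h5

end Slice

/-! ### The phase of a complex number -/

section Phase

/-- The phase of a complex number; it is `1` at `0`. -/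
def phase (z : ℂ) : Circle := Circle.exp (Complex.arg z)

@[simp] theorem phase_zero : phase 0 = 1 := by simp [phase]

theorem phase_mul_norm (z : ℂ) : (phase z : ℂ) * ‖z‖ = z := by
  rw [phase, Circle.coe_exp, mul_comm]
  exact Complex.norm_mul_exp_arg_mul_I z

@[simp] theorem phase_ofReal {s : ℝ} (hs : 0 ≤ s) : phase s = 1 := by
  simp [phase, Complex.arg_ofReal_of_nonneg hs]

theorem eq_phase {z : ℂ} (hz : z ≠ 0) {a : Circle} (h : (a : ℂ) * ‖z‖ = z) : phase z = a := by
  have hn : (‖z‖ : ℂ) ≠ 0 := by simpa using hz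
  exact Circle.ext (mul_right_cancel₀ hn ((phase_mul_norm z).trans h.symm))

theorem phase_mul {z w : ℂ} (hz : z ≠ 0) (hw : w ≠ 0) : phase (z * w) = phase z * phase w := by
  refine eq_phase (mul_ne_zero hz hw) ?_
  rw [Circle.coe_mul, norm_mul, Complex.ofReal_mul, mul_mul_mul_comm, phase_mul_norm,
    phase_mul_norm]

@[simp] theorem phase_coe (a : Circle) : phase a = a :=
  eq_phase (Circle.coe_ne_zero a) (by rw [Circle.norm_coe]; simp)

/-- The argument jumps along the negative axis, but the angle relative to a fixed z is Im log(w/z),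
smooth for w near z. -/
theorem phase_eq_exp_mul {z w : ℂ} (hz : z ≠ 0) (hw : w ≠ 0) :
    phase w = Circle.exp ((Complex.log (w * z⁻¹)).im) * phase z := by
  have : phase (w * z⁻¹ * z) = phase (w * z⁻¹) * phase z :=
    phase_mul (mul_ne_zero hw (inv_ne_zero hz)) hz
  rw [inv_mul_cancel_right₀ hz] at this
  rw [this, phase, Complex.log_im]

theorem contMDiffAt_phase {z : ℂ} (hz : z ≠ 0) : ContMDiffAt 𝓘(ℝ, ℂ) (𝓡 1) ∞ phase z := by
  have h1 : ContDiffAt ℝ ∞ (fun w : ℂ ↦ (Complex.log (w * z⁻¹)).im) z := by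
    have h2 : ContDiffAt ℝ ∞ (fun w : ℂ ↦ w * z⁻¹) z := contDiffAt_id.mul contDiffAt_const
    have h3 : ContDiffAt ℝ ∞ Complex.log (z * z⁻¹) := by
      rw [mul_inv_cancel₀ hz]
      exact (Complex.contDiffAt_log Complex.one_mem_slitPlane).restrict_scalars ℝ
    exact Complex.imCLM.contDiff.contDiffAt.comp z (h3.comp z h2)
  have h4 : ContMDiffAt 𝓘(ℝ, ℂ) (𝓡 1) ∞
      (fun w ↦ Circle.exp ((Complex.log (w * z⁻¹)).im) * phase z) z :=
    (contMDiff_circleExp.contMDiffAt.comp z h1.contMDiffAt).mul contMDiffAt_const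
  refine h4.congr_of_eventuallyEq ?_
  filter_upwards [isOpen_ne.mem_nhds hz] with w hw
  exact phase_eq_exp_mul hz hw

end Phase

/-! ### The cut space as a quotient of a hypersurface in `M × ℂ` -/

section Twist

open Set Filter

variable {n : ℕ} [NeZero n] {M : Type*} [TopologicalSpace M] [ChartedSpace (EuclideanHalfSpace n) M]
  {U : TopologicalSpace.Opens M} [MulAction Circle U]

variable (n U) in
/-- The map to the cut space from the hypersurface `f x = ‖z‖ ^ 2` in `M × ℂ`. -/
def twistMap (q : M × ℂ) : CutSpace n U := cutMap n U (act U (phase q.2) q.1)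

@[simp] theorem twistMap_zero (x : M) : twistMap n U (x, 0) = cutMap n U x := by
  simp [twistMap, act_one]

theorem twistMap_ofReal (x : M) {s : ℝ} (hs : 0 ≤ s) :
    twistMap n U (x, (s : ℂ)) = cutMap n U x := by
  simp [twistMap, act_one, hs]

variable [IsManifold (𝓡∂ n) ∞ M] (hU : IsFreeActionNearBoundary n U)
include hU

theorem continuousAt_twistMap_of_ne {q : M × ℂ} (hq : q.1 ∈ U) (h : q.2 ≠ 0) :
    ContinuousAt (twistMap n U) q :=
  continuous_cutMap.continuousAt.comp (continuousAt_act_comp hU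
    (ContinuousAt.comp (g := phase) (contMDiffAt_phase h).continuousAt continuousAt_snd)
    continuousAt_fst hq)

/-- The phase is discontinuous at 0, but a boundary orbit is collapsed: by compactness, whole orbits
near it have image near that point, whatever the phase. -/
theorem continuousAt_twistMap_of_boundary {q : M × ℂ} (hq : q.1 ∈ (𝓡∂ n).boundary M) :
    ContinuousAt (twistMap n U) q := by
  intro W hW
  rw [twistMap, cutMap_act_of_boundary hU hq] at hW
  obtain ⟨W', hW', hW'o, hqW⟩ := mem_nhds_iff.1 hW
  have h1 := isOpen_setOf_orbit_subset hU (hW'o.preimage continuous_cutMap)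
  have h2 : q.1 ∈ {x | x ∈ U ∧ ∀ a : Circle, act U a x ∈ cutMap n U ⁻¹' W'} :=
    ⟨hU.boundary_subset hq, fun a ↦ by
      rw [mem_preimage, cutMap_act_of_boundary hU hq]; exact hqW⟩
  rw [mem_map]
  filter_upwards [continuousAt_fst.preimage_mem_nhds (h1.mem_nhds h2)] with q' hq'
  exact hW' (hq'.2 _)

variable {f : M → ℝ} (hf : IsInvariantBoundaryDefining n U f) {V : Set M}
    (hV : IsInvariantNhd n U V) (hfV : ∀ a, ∀ x ∈ V, f (act U a x) = f x)
include hf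

theorem mem_interior_iff_pos {x : M} : x ∈ (𝓡∂ n).interior M ↔ 0 < f x := by
  rw [← ModelWithCorners.compl_boundary, mem_compl_iff, ← hf.zero_iff]
  exact ⟨fun h ↦ lt_of_le_of_ne (hf.nonneg x) (Ne.symm h), fun h ↦ h.ne'⟩

theorem continuousAt_twistMap {q : M × ℂ} (hq : q.1 ∈ U) (h : f q.1 = ‖q.2‖ ^ 2) :
    ContinuousAt (twistMap n U) q := by
  by_cases h0 : q.2 = 0
  · exact continuousAt_twistMap_of_boundary hU ((hf.zero_iff _).1 (by simp [h, h0]))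
  · exact continuousAt_twistMap_of_ne hU hq h0

theorem twistMap_act (a : Circle) {x : M} {w : ℂ} (h : f x = ‖w‖ ^ 2) :
    twistMap n U (act U a⁻¹ x, a * w) = twistMap n U (x, w) := by
  by_cases h0 : w = 0
  · have := cutMap_act_of_boundary hU ((hf.zero_iff x).1 (by simp [h, h0])) a⁻¹
    simpa [h0] using this
  · rw [twistMap, twistMap, phase_mul (Circle.coe_ne_zero a) h0, phase_coe, ← act_mul,
      mul_right_comm, mul_inv_cancel, one_mul]

include hV hfV

/-- The fibres are no larger than the antidiagonal orbits. For w ≠ 0 the image lies over the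
interior, where c is injective, and comparing phases gives a; for w = 0 the equivalence relation on
the boundary supplies it. -/
theorem exists_of_twistMap_eq {x x' : M} {w w' : ℂ} (hx : x ∈ V) (hx' : x' ∈ V)
    (h : f x = ‖w‖ ^ 2) (h' : f x' = ‖w'‖ ^ 2)
    (heq : twistMap n U (x, w) = twistMap n U (x', w')) :
    ∃ a : Circle, x' = act U a⁻¹ x ∧ w' = a * w := by
  by_cases h0 : w = 0
  · have hb : x ∈ (𝓡∂ n).boundary M := (hf.zero_iff x).1 (by simp [h, h0])
    have h2 : cutMap n U x = cutMap n U (act U (phase w') x') := by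
      rw [h0, twistMap_zero] at heq
      exact heq
    obtain ⟨b, hb'⟩ : ∃ b : Circle, act U (phase w') x' = act U b x := by
      rcases (cutMap_eq_iff_act hU).1 h2 with h3 | ⟨-, b, h3⟩
      · exact ⟨1, by rw [act_one, h3]⟩
      · exact ⟨b, h3⟩
    have h4 : x' = act U ((phase w')⁻¹ * b) x := by
      rw [act_mul, ← hb', act_inv_act]
    refine ⟨((phase w')⁻¹ * b)⁻¹, by rw [inv_inv]; exact h4, ?_⟩
    have h5 : f x' = 0 := by rw [h4, hfV _ x hx, (hf.zero_iff x).2 hb]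
    rw [h5] at h'
    have : w' = 0 := by simpa using h'.symm
    simp [this, h0]
  · have hpos : 0 < f (act U (phase w) x) := by
      rw [hfV _ x hx, h]; positivity
    have h2 := eq_of_cutMap_eq hU ((mem_interior_iff_pos hU hf).2 hpos) heq
    simp only at h2
    have h3 : ‖w'‖ = ‖w‖ := by
      have : ‖w'‖ ^ 2 = ‖w‖ ^ 2 := by
        rw [← h, ← h', ← hfV (phase w') x' hx', ← h2, hfV _ x hx]
      exact (sq_eq_sq₀ (norm_nonneg _) (norm_nonneg _)).1 this
    refine ⟨phase w' * (phase w)⁻¹, ?_, ?_⟩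
    · rw [mul_inv_rev, inv_inv, mul_comm, act_mul, h2, act_inv_act]
    · have h4 : phase w' = phase w' * (phase w)⁻¹ * phase w := by group
      have h5 := congrArg (fun a : Circle ↦ (a : ℂ) * ‖w‖) h4
      simp only [Circle.coe_mul, mul_assoc, phase_mul_norm] at h5
      rw [← h3, phase_mul_norm] at h5
      refine h5.trans ?_
      rw [Circle.coe_mul, mul_assoc]

end Twist

/-! ### Charts of the cut space -/

section Chart

open Set Filter

/-- The inverse of an injective, continuous and open map, as an open partial homeomorphism. -/
def chartOfParametrization {X F : Type*} [TopologicalSpace X] [TopologicalSpace F] [Nonempty F]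
    (Y : F → X) (O : Set F) (hO : IsOpen O) (hinj : InjOn Y O) (hc : ContinuousOn Y O)
    (ho : ∀ O' ⊆ O, IsOpen O' → IsOpen (Y '' O')) : OpenPartialHomeomorph X F :=
  (OpenPartialHomeomorph.ofContinuousOpenRestrict (hinj.toPartialEquiv Y O) hc (by
    intro A hA
    obtain ⟨B, hB, rfl⟩ := isOpen_induced_iff.1 hA
    rw [image_domRestrict]
    exact ho _ inter_subset_right (hB.inter hO)) hO).symm

section

variable {X F : Type*} [TopologicalSpace X] [TopologicalSpace F] [Nonempty F]
    {Y : F → X} {O : Set F} (hO : IsOpen O) (hinj : InjOn Y O) (hc : ContinuousOn Y O)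
    (ho : ∀ O' ⊆ O, IsOpen O' → IsOpen (Y '' O'))

theorem chartOfParametrization_apply {e : F} (he : e ∈ O) :
    chartOfParametrization Y O hO hinj hc ho (Y e) = e :=
  (chartOfParametrization Y O hO hinj hc ho).right_inv he

end

variable {n : ℕ} [NeZero n] {M : Type*} [TopologicalSpace M] [ChartedSpace (EuclideanHalfSpace n) M]
  {U : TopologicalSpace.Opens M} [MulAction Circle U] {f : M → ℝ} {V : Set M} {x₀ : M}
  {K : Type} [NormedAddCommGroup K] [NormedSpace ℝ K]

namespace SliceModel

variable (S : SliceModel n U f V x₀ K)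

/-- The parametrization of the cut space. -/
def param (p : K × ℂ) : CutSpace n U := twistMap n U (S.X p, p.2)

/-- The coordinates of a point of the hypersurface `f x = ‖z‖ ^ 2`. -/
def coord (q : M × ℂ) : K × ℂ := (S.proj q, (Circle.exp (S.time q) : ℂ) * q.2)

theorem coord_slice {p : K × ℂ} (hp : p ∈ bidisc K S.radius) : S.coord (S.X p, p.2) = p := by
  simp [coord, S.time_slice p hp, S.proj_slice p hp]

theorem contMDiffOn_coord :
    ContMDiffOn ((𝓡∂ n).prod 𝓘(ℝ, ℂ)) 𝓘(ℝ, K × ℂ) ∞ S.coord S.N := by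
  refine S.smooth_proj.prodMk_space ?_
  have h1 : ContDiff ℝ ∞ fun p : ℝ × ℂ ↦ Complex.exp (p.1 * Complex.I) * p.2 :=
    (((Complex.ofRealCLM.contDiff.comp contDiff_fst).mul contDiff_const).cexp).mul contDiff_snd
  have h2 := h1.contMDiff.comp_contMDiffOn
    (S.smooth_time.prodMk_space (contMDiff_snd.contMDiffOn (s := S.N)))
  refine h2.congr fun q hq ↦ ?_
  simp [Circle.coe_exp]

variable [IsManifold (𝓡∂ n) ∞ M] (hU : IsFreeActionNearBoundary n U)
  (hf : IsInvariantBoundaryDefining n U f)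
include hU hf

theorem twistMap_eq_param {q : M × ℂ} (hq : q ∈ S.N) (h : f q.1 = ‖q.2‖ ^ 2) :
    twistMap n U q = S.param (S.coord q) := by
  have h1 := S.proj_mem q hq
  have h2 := twistMap_act hU hf (Circle.exp (S.time q))⁻¹ (x := S.X (S.proj q, q.2))
    (w := Circle.exp (S.time q) * q.2) (by
      rw [S.level _ h1, norm_mul, Circle.norm_coe, one_mul])
  rw [inv_inv, ← S.reconstruct q hq h, ← mul_assoc, ← Circle.coe_mul, inv_mul_cancel,
    Circle.coe_one, one_mul] at h2
  rw [param, coord]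
  simp only
  rw [S.rotate _ h1 (Circle.exp (S.time q))]
  exact h2

variable (hV : IsInvariantNhd n U V) (hfV : ∀ a, ∀ x ∈ V, f (act U a x) = f x)
include hV hfV

theorem injOn_param : InjOn S.param (bidisc K S.radius) := by
  rintro ⟨k, ζ⟩ hp ⟨k', ζ'⟩ hp' h
  obtain ⟨a, h1, h2⟩ := exists_of_twistMap_eq hU hf hV hfV (S.mem _ hp) (S.mem _ hp')
    (S.level _ hp) (S.level _ hp') h
  simp only at h2
  subst h2
  have hp2 : (k', ζ) ∈ bidisc K S.radius := (circle_mul_mem_bidisc a).1 hp'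
  rw [S.rotate _ hp2 a] at h1
  obtain ⟨h3, rfl⟩ := S.free k k' ζ a⁻¹ hp hp2 h1
  rw [inv_eq_one] at h3
  simp [h3]

theorem continuousOn_param : ContinuousOn S.param (bidisc K S.radius) := by
  intro p hp
  have h1 : ContinuousAt S.X p := S.smooth.continuousOn.continuousAt ((isOpen_bidisc _).mem_nhds hp)
  refine (ContinuousAt.comp (g := twistMap n U) (f := fun p : K × ℂ ↦ (S.X p, p.2)) ?_
    (h1.prodMk continuousAt_snd)).continuousWithinAt
  exact continuousAt_twistMap hU hf (hV.subset (S.mem p hp)) (S.level p hp)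

/-- Composed with a continuous local section of the twist map, `coord` is a continuous local inverse
of the parametrization, so points near one in the preimage also come from O. -/
theorem isOpen_image_param {O : Set (K × ℂ)} (hOb : O ⊆ bidisc K S.radius) (hO : IsOpen O) :
    IsOpen (S.param '' O) := by
  rw [← isQuotientMap_cutMap.isOpen_preimage, isOpen_iff_mem_nhds]
  rintro y ⟨p, hp, hpy⟩
  have hyV : y ∈ V := by
    rcases (cutMap_eq_iff_act hU).1 hpy with h | ⟨-, a, h⟩
    · rw [← h]
      exact hV.act_mem _ (S.mem p (hOb hp))
    · rw [h]
      exact hV.act_mem _ (hV.act_mem _ (S.mem p (hOb hp)))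
  have hsq : ∀ y', f y' = ‖((√(f y') : ℝ) : ℂ)‖ ^ 2 := fun y' ↦ by
    simp [Real.sq_sqrt (hf.nonneg y')]
  obtain ⟨a, h1, h2⟩ := exists_of_twistMap_eq hU hf hV hfV hyV (S.mem p (hOb hp)) (hsq y)
    (S.level p (hOb hp)) ((twistMap_ofReal y (Real.sqrt_nonneg _)).trans hpy.symm)
  -- The section y' ↦ (y', √(f y')) of the twist map, moved along the antidiagonal orbit so as to
  -- pass through the given slice point.
  set g : M → M × ℂ := fun y' ↦ (act U a⁻¹ y', a * (√(f y') : ℝ)) with hg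
  have hgy : g y = (S.X p, p.2) := by rw [hg, h1, h2]
  have hgc : ContinuousAt g y := by
    refine ContinuousAt.prodMk (continuousAt_act_comp hU continuousAt_const continuousAt_id
      (hV.subset hyV)) (continuousAt_const.mul ?_)
    exact (Complex.continuous_ofReal.comp
      (Real.continuous_sqrt.comp hf.smooth.continuous)).continuousAt
  have hN : ∀ᶠ y' in 𝓝 y, g y' ∈ S.N :=
    hgc.eventually (S.isOpen_N.mem_nhds (hgy ▸ S.mem_N p (hOb hp)))
  have hcc : ContinuousAt (fun y' ↦ S.coord (g y')) y := by
    refine ContinuousAt.comp (g := S.coord) ?_ hgc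
    rw [hgy]
    exact S.contMDiffOn_coord.continuousOn.continuousAt (S.isOpen_N.mem_nhds (S.mem_N p (hOb hp)))
  have hcO : ∀ᶠ y' in 𝓝 y, S.coord (g y') ∈ O := by
    refine hcc.eventually (hO.mem_nhds ?_)
    change S.coord (g y) ∈ O
    rwa [hgy, S.coord_slice (hOb hp)]
  filter_upwards [hN, hcO, hV.isOpen.mem_nhds hyV] with y' h3 h4 h5
  refine ⟨_, h4, ?_⟩
  have h6 : f (g y').1 = ‖(g y').2‖ ^ 2 := by
    simp only [hg, hfV a⁻¹ y' h5, norm_mul, Circle.norm_coe, one_mul]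
    exact hsq y'
  rw [← S.twistMap_eq_param hU hf h3 h6]
  exact (twistMap_act hU hf a (hsq y')).trans (twistMap_ofReal y' (Real.sqrt_nonneg _))

/-- The chart of the cut space at the image of a boundary point. -/
def chart : OpenPartialHomeomorph (CutSpace n U) (K × ℂ) :=
  chartOfParametrization S.param (bidisc K S.radius) (isOpen_bidisc _) (S.injOn_param hU hf hV hfV)
    (S.continuousOn_param hU hf hV hfV) (fun _ h1 h2 ↦ S.isOpen_image_param hU hf hV hfV h1 h2)

end SliceModel

/-! ### Charts over the interior -/

section Interior

variable [IsManifold (𝓡∂ n) ∞ M]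

/-- The interior part of the target of an extended chart. -/
def interiorTarget (n : ℕ) [NeZero n] {M : Type*} [TopologicalSpace M]
    [ChartedSpace (EuclideanHalfSpace n) M] (x : M) : Set (EuclideanSpace ℝ (Fin n)) :=
  (extChartAt (𝓡∂ n) x).target ∩ {y | 0 < y 0}

omit [IsManifold (𝓡∂ n) ∞ M] in
theorem isOpen_interiorTarget (x : M) : IsOpen (interiorTarget n x) := by
  have h1 : interiorTarget n x = (𝓡∂ n).symm ⁻¹' (chartAt (EuclideanHalfSpace n) x).target ∩
      {y | 0 < y 0} := by
    ext y
    simp only [interiorTarget, extChartAt_target, mem_inter_iff, mem_ofPred_eq, and_assoc,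
      mem_range_halfSpace]
    exact ⟨fun h ↦ ⟨h.1, h.2.2⟩, fun h ↦ ⟨h.1, h.2.le, h.2⟩⟩
  rw [h1]
  refine ((chartAt (EuclideanHalfSpace n) x).open_target.preimage (𝓡∂ n).continuous_symm).inter ?_
  exact isOpen_lt continuous_const (EuclideanSpace.proj (0 : Fin n) :
    EuclideanSpace ℝ (Fin n) →L[ℝ] ℝ).continuous

theorem symm_mem_interior {x : M} {y : EuclideanSpace ℝ (Fin n)} (hy : y ∈ interiorTarget n x) :
    (extChartAt (𝓡∂ n) x).symm y ∈ (𝓡∂ n).interior M := by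
  rw [mem_interior_iff_chart ((extChartAt (𝓡∂ n) x).map_target hy.1),
    (extChartAt (𝓡∂ n) x).right_inv hy.1]
  exact hy.2

variable (n U) in
/-- The parametrization of the interior of the cut space by a chart of `M`. -/
def interiorParam (x : M) (y : EuclideanSpace ℝ (Fin n)) : CutSpace n U :=
  cutMap n U ((extChartAt (𝓡∂ n) x).symm y)

variable (hU : IsFreeActionNearBoundary n U)
include hU

/-- The chart of the cut space at the image of an interior point. -/
def interiorChart (x : M) : OpenPartialHomeomorph (CutSpace n U) (EuclideanSpace ℝ (Fin n)) :=
  chartOfParametrization (interiorParam n U x) (interiorTarget n x) (isOpen_interiorTarget x)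
    (fun y hy y' hy' h ↦ (extChartAt (𝓡∂ n) x).symm.injOn hy.1 hy'.1
      (eq_of_cutMap_eq hU (symm_mem_interior hy) h))
    (continuous_cutMap.comp_continuousOn ((continuousOn_extChartAt_symm x).mono inter_subset_left))
    (fun O hO hOo ↦ by
      have h1 : interiorParam n U x '' O = cutMap n U '' ((extChartAt (𝓡∂ n) x).symm '' O) := by
        rw [image_image]; rfl
      rw [h1]
      refine isOpen_image_cutMap hU ?_ ?_
      · have h2 : (extChartAt (𝓡∂ n) x).symm '' O =
            (extChartAt (𝓡∂ n) x).source ∩ extChartAt (𝓡∂ n) x ⁻¹' O :=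
          (extChartAt (𝓡∂ n) x).symm_image_eq_source_inter_preimage
            (hO.trans inter_subset_left)
        rw [h2]
        exact (continuousOn_extChartAt x).isOpen_inter_preimage (isOpen_extChartAt_source x) hOo
      · rintro _ ⟨y, hy, rfl⟩
        exact symm_mem_interior (hO hy))

end Interior

end Chart

/-! ### Smoothness of a function near a point of the cut space -/

section Germ

open Set Filter

variable {n : ℕ} [NeZero n] {M : Type*} [TopologicalSpace M] [ChartedSpace (EuclideanHalfSpace n) M]
  {U : TopologicalSpace.Opens M} [MulAction Circle U]

variable (n U) in
/-- Near the point `q` of the hypersurface `f x = ‖z‖ ^ 2`, the pullback of `h` is the restriction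
of a smooth function. -/
def ExtendsSmoothly (f : M → ℝ) (h : CutSpace n U → ℝ) (q : M × ℂ) : Prop :=
  ∃ (O : Set (M × ℂ)) (G : M × ℂ → ℝ), IsOpen O ∧ q ∈ O ∧
    ContMDiffOn ((𝓡∂ n).prod 𝓘(ℝ, ℂ)) 𝓘(ℝ, ℝ) ∞ G O ∧
    ∀ p ∈ O, f p.1 = ‖p.2‖ ^ 2 → G p = h (twistMap n U p)

variable (n U) in
/-- The pullback of `h` to `M` is smooth near the point `x`. -/
def PullsBackSmoothly (h : CutSpace n U → ℝ) (x : M) : Prop :=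
  ∀ᶠ y in 𝓝 x, ContMDiffAt (𝓡∂ n) 𝓘(ℝ, ℝ) ∞ (fun z ↦ h (cutMap n U z)) y

variable (n U) in
/-- The function `h` is smooth near the point `p` of the cut space. -/
def SmoothNear (f : M → ℝ) (h : CutSpace n U → ℝ) (p : CutSpace n U) : Prop :=
  (∀ x ∈ (𝓡∂ n).interior M, cutMap n U x = p → PullsBackSmoothly n U h x) ∧
    ∀ x ∈ (𝓡∂ n).boundary M, cutMap n U x = p → ExtendsSmoothly n U f h (x, 0)

/-- Charts of `X` in which a local property of functions is the smoothness of the coordinate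
expression. -/
def IsChartFor {X F : Type*} [TopologicalSpace X] [NormedAddCommGroup F] [NormedSpace ℝ F]
    (P : (X → ℝ) → X → Prop) (ψ : OpenPartialHomeomorph X F) : Prop :=
  ∀ h, ∀ p ∈ ψ.source, P h p ↔ ∀ᶠ e in 𝓝 (ψ p), ContDiffAt ℝ ∞ (fun e ↦ h (ψ.symm e)) e

variable [IsManifold (𝓡∂ n) ∞ M] (hU : IsFreeActionNearBoundary n U) {f : M → ℝ}
  {h : CutSpace n U → ℝ}
include hU

theorem smoothNear_cutMap_iff {x : M} (hx : x ∈ (𝓡∂ n).interior M) :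
    SmoothNear n U f h (cutMap n U x) ↔ PullsBackSmoothly n U h x := by
  refine ⟨fun H ↦ H.1 x hx rfl, fun H ↦ ⟨fun y _ he ↦ ?_, fun y hy he ↦ ?_⟩⟩
  · rwa [← eq_of_cutMap_eq hU hx he.symm]
  · rw [← ModelWithCorners.compl_interior, ← eq_of_cutMap_eq hU hx he.symm] at hy
    exact absurd hx hy

variable (hf : IsInvariantBoundaryDefining n U f)
include hf

theorem contMDiffAt_sqrt_section (b : Circle) {y : M} (hy : y ∈ U) (h0 : f y ≠ 0) :
    ContMDiffAt (𝓡∂ n) ((𝓡∂ n).prod 𝓘(ℝ, ℂ)) ∞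
      (fun y ↦ (act U b⁻¹ y, (b : ℂ) * (√(f y) : ℝ))) y := by
  refine (contMDiffAt_act_const hU b⁻¹ hy).prodMk ?_
  have h1 : ContDiff ℝ ∞ (fun s : ℝ ↦ (b : ℂ) * s) := contDiff_const.mul Complex.ofRealCLM.contDiff
  exact h1.contMDiff.contMDiffAt.comp y
    ((Real.contDiffAt_sqrt h0).contMDiffAt.comp y hf.smooth.contMDiffAt)

variable {V : Set M} (hV : IsInvariantNhd n U V) (hfV : ∀ a, ∀ x ∈ V, f (act U a x) = f x)
include hV hfV

theorem ExtendsSmoothly.act {x : M} {w : ℂ} (hx : x ∈ V) (H : ExtendsSmoothly n U f h (x, w))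
    (a : Circle) : ExtendsSmoothly n U f h (SmoothCut.act U a⁻¹ x, a * w) := by
  obtain ⟨O, G, hO, hxO, hG, hGh⟩ := H
  set m : M × ℂ → M × ℂ := fun q ↦ (SmoothCut.act U a q.1, ((a⁻¹ : Circle) : ℂ) * q.2) with hm
  have hms : ContMDiffOn ((𝓡∂ n).prod 𝓘(ℝ, ℂ)) ((𝓡∂ n).prod 𝓘(ℝ, ℂ)) ∞ m (V ×ˢ univ) := by
    intro q hq
    refine ContMDiffAt.contMDiffWithinAt (ContMDiffAt.prodMk
      (contMDiffAt_act_comp hU contMDiffAt_const contMDiffAt_fst (hV.subset hq.1)) ?_)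
    exact (contDiff_const.mul contDiff_id : ContDiff ℝ ∞
      (fun s : ℂ ↦ ((a⁻¹ : Circle) : ℂ) * s)).contMDiff.contMDiffAt.comp q contMDiffAt_snd
  refine ⟨V ×ˢ univ ∩ m ⁻¹' O, fun q ↦ G (m q),
    hms.continuousOn.isOpen_inter_preimage (hV.isOpen.prod isOpen_univ) hO,
    ⟨⟨hV.act_mem _ hx, trivial⟩, ?_⟩, hG.comp (hms.mono inter_subset_left) inter_subset_right, ?_⟩
  · simp only [mem_preimage, hm, act_act_inv, ← mul_assoc, ← Circle.coe_mul, inv_mul_cancel,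
      Circle.coe_one, one_mul]
    exact hxO
  · rintro q ⟨⟨hqV, -⟩, hqO⟩ hq
    have h1 := twistMap_act hU hf a⁻¹ hq
    rw [inv_inv] at h1
    rw [← Prod.mk.eta (p := q), ← h1]
    refine hGh (m q) hqO ?_
    simp only [hm, hfV a _ hqV, norm_mul, Circle.norm_coe, one_mul, hq]

/-- Off z = 0 the two notions are exchanged by smooth maps: (x, z) ↦ phase(z)·x in one direction and
the section y ↦ (b⁻¹y, b√(f y)) in the other. -/
theorem extendsSmoothly_iff_pullsBackSmoothly {x : M} {w : ℂ} (hx : x ∈ V) (hxw : f x = ‖w‖ ^ 2)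
    (hw : w ≠ 0) :
    ExtendsSmoothly n U f h (x, w) ↔ PullsBackSmoothly n U h (act U (phase w) x) := by
  set b := phase w with hb
  set y := act U b x with hy
  have hyV : y ∈ V := hV.act_mem _ hx
  have hfy : f y = ‖w‖ ^ 2 := by rw [hy, hfV _ _ hx, hxw]
  have hfy0 : f y ≠ 0 := by rw [hfy]; positivity
  constructor
  · rintro ⟨O, G, hO, hxO, hG, hGh⟩
    set g : M → M × ℂ := fun y ↦ (act U b⁻¹ y, (b : ℂ) * (√(f y) : ℝ)) with hg
    have hgy : g y = (x, w) := by
      refine Prod.ext (by simp only [hg, hy, act_inv_act]) ?_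
      simp only [hg]
      rw [hfy, Real.sqrt_sq (norm_nonneg _), hb, phase_mul_norm]
    have h1 : ∀ᶠ y' in 𝓝 y, g y' ∈ O :=
      (contMDiffAt_sqrt_section hU hf b (hV.subset hyV) hfy0).continuousAt.eventually
        (hO.mem_nhds (by rw [← hg, hgy]; exact hxO))
    have h2 : ∀ᶠ y' in 𝓝 y, f y' ≠ 0 := hf.smooth.continuous.continuousAt.eventually_ne hfy0
    have h3 := h1.and (h2.and (hV.isOpen.mem_nhds hyV))
    filter_upwards [eventually_eventually_nhds.2 h3] with y' h4
    obtain ⟨h5, h6, h7⟩ := h4.self_of_nhds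
    refine (((hG.contMDiffAt (hO.mem_nhds h5)).comp y'
      (contMDiffAt_sqrt_section hU hf b (hV.subset h7) h6))).congr_of_eventuallyEq ?_
    filter_upwards [h4] with y'' h8
    have h9 : f y'' = ‖((√(f y'') : ℝ) : ℂ)‖ ^ 2 := by simp [Real.sq_sqrt (hf.nonneg y'')]
    refine Eq.symm ((hGh (g y'') h8.1 ?_).trans ?_)
    · simp only [hg, hfV b⁻¹ y'' h8.2.2, norm_mul, Circle.norm_coe, one_mul]
      exact h9
    · exact congrArg h ((twistMap_act hU hf b h9).trans (twistMap_ofReal y'' (Real.sqrt_nonneg _)))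
  · intro H
    obtain ⟨W, hW, hWo, hyW⟩ := mem_nhds_iff.1 H
    set m : M × ℂ → M := fun q ↦ act U (phase q.2) q.1 with hm
    have hms : ContMDiffOn ((𝓡∂ n).prod 𝓘(ℝ, ℂ)) (𝓡∂ n) ∞ m (V ×ˢ {0}ᶜ) := by
      intro q hq
      exact (contMDiffAt_act_comp hU (ContMDiffAt.comp (g := phase) q (contMDiffAt_phase hq.2)
        contMDiffAt_snd) contMDiffAt_fst (hV.subset hq.1)).contMDiffWithinAt
    refine ⟨V ×ˢ {0}ᶜ ∩ m ⁻¹' W, fun q ↦ h (cutMap n U (m q)),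
      hms.continuousOn.isOpen_inter_preimage (hV.isOpen.prod isOpen_compl_singleton) hWo,
      ⟨⟨hx, hw⟩, hyW⟩, ?_, fun q _ _ ↦ rfl⟩
    have h1 : ContMDiffOn (𝓡∂ n) 𝓘(ℝ, ℝ) ∞ (fun z ↦ h (cutMap n U z)) W :=
      fun z hz ↦ (show ContMDiffAt _ _ _ _ _ from hW hz).contMDiffWithinAt
    exact h1.comp (hms.mono inter_subset_left) inter_subset_right

theorem smoothNear_twistMap_iff {x : M} {w : ℂ} (hx : x ∈ V) (hxw : f x = ‖w‖ ^ 2) :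
    SmoothNear n U f h (twistMap n U (x, w)) ↔ ExtendsSmoothly n U f h (x, w) := by
  by_cases hw : w = 0
  · subst hw
    have hb : x ∈ (𝓡∂ n).boundary M := (hf.zero_iff x).1 (by simp [hxw])
    rw [twistMap_zero]
    refine ⟨fun H ↦ H.2 x hb rfl, fun H ↦ ⟨fun y hy he ↦ ?_, fun y hy he ↦ ?_⟩⟩
    · rw [eq_of_cutMap_eq hU hy he, ← ModelWithCorners.compl_boundary] at hy
      exact absurd hb hy
    · rcases (cutMap_eq_iff_act hU).1 he.symm with rfl | ⟨-, a, rfl⟩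
      · exact H
      · have := H.act hU hf hV hfV hx a⁻¹
        rwa [inv_inv, mul_zero] at this
  · rw [extendsSmoothly_iff_pullsBackSmoothly hU hf hV hfV hx hxw hw]
    refine smoothNear_cutMap_iff hU ((mem_interior_iff_pos hU hf).2 ?_)
    simp only
    rw [hfV _ _ hx, hxw]
    positivity

variable {x₀ : M} {K : Type} [NormedAddCommGroup K] [NormedSpace ℝ K]

/-- An extension G restricts to the slice. Conversely, a function smooth in the chart is extended by
composing it with `coord`, which is smooth on an open subset of M × ℂ. -/
theorem SliceModel.isChartFor (S : SliceModel n U f V x₀ K) :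
    IsChartFor (SmoothNear n U f) (S.chart hU hf hV hfV) := by
  rintro h _ ⟨p, hp, rfl⟩
  have h1 : S.chart hU hf hV hfV (S.param p) = p :=
    chartOfParametrization_apply _ _ _ _ hp
  change SmoothNear n U f h (S.param p) ↔
    ∀ᶠ e in 𝓝 (S.chart hU hf hV hfV (S.param p)), ContDiffAt ℝ ∞ (fun e ↦ h (S.param e)) e
  rw [h1, SliceModel.param, smoothNear_twistMap_iff hU hf hV hfV (S.mem p hp) (S.level p hp)]
  set j : K × ℂ → M × ℂ := fun e ↦ (S.X e, e.2) with hj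
  have hjs : ContMDiffOn 𝓘(ℝ, K × ℂ) ((𝓡∂ n).prod 𝓘(ℝ, ℂ)) ∞ j (bidisc K S.radius) :=
    S.smooth.prodMk contDiff_snd.contMDiff.contMDiffOn
  constructor
  · rintro ⟨O, G, hO, hpO, hG, hGh⟩
    have h2 : IsOpen (bidisc K S.radius ∩ j ⁻¹' O) :=
      hjs.continuousOn.isOpen_inter_preimage (isOpen_bidisc _) hO
    have h3 : ContDiffOn ℝ ∞ (fun e ↦ G (j e)) (bidisc K S.radius ∩ j ⁻¹' O) :=
      (hG.comp (hjs.mono inter_subset_left) inter_subset_right).contDiffOn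
    filter_upwards [h2.mem_nhds ⟨hp, hpO⟩] with e he
    refine (h3.contDiffAt (h2.mem_nhds he)).congr_of_eventuallyEq ?_
    filter_upwards [h2.mem_nhds he] with e' he'
    exact (hGh _ he'.2 (S.level e' he'.1)).symm
  · intro H
    obtain ⟨W, hW, hWo, hpW⟩ := mem_nhds_iff.1 H
    refine ⟨S.N ∩ S.coord ⁻¹' W, fun q ↦ h (S.param (S.coord q)),
      S.contMDiffOn_coord.continuousOn.isOpen_inter_preimage S.isOpen_N hWo,
      ⟨S.mem_N p hp, ?_⟩, ?_, fun q hq hfq ↦ ?_⟩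
    · rw [mem_preimage, S.coord_slice hp]
      exact hpW
    · have h2 : ContDiffOn ℝ ∞ (fun e ↦ h (S.param e)) W :=
        fun z hz ↦ (show ContDiffAt ℝ ∞ (fun e ↦ h (S.param e)) z from hW hz).contDiffWithinAt
      exact h2.contMDiffOn.comp (S.contMDiffOn_coord.mono inter_subset_left) inter_subset_right
    · simp only [S.twistMap_eq_param hU hf hq.1 hfq]

omit hf hV hfV in
theorem isChartFor_interiorChart (x : M) :
    IsChartFor (SmoothNear n U f) (interiorChart hU x) := by
  rintro h _ ⟨y, hy, rfl⟩
  have h1 : interiorChart hU x (interiorParam n U x y) = y :=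
    chartOfParametrization_apply _ _ _ _ hy
  change SmoothNear n U f h (interiorParam n U x y) ↔
    ∀ᶠ e in 𝓝 (interiorChart hU x (interiorParam n U x y)),
      ContDiffAt ℝ ∞ (fun e ↦ h (interiorParam n U x e)) e
  rw [h1, interiorParam, smoothNear_cutMap_iff hU (symm_mem_interior hy)]
  have hW := (isOpen_interiorTarget (n := n) x).mem_nhds hy
  have hs := (contMDiffOn_extChartAt_symm (I := 𝓡∂ n) (n := ∞) x)
  have hsy : ∀ y ∈ interiorTarget n x, ContMDiffAt 𝓘(ℝ, EuclideanSpace ℝ (Fin n)) (𝓡∂ n) ∞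
      (extChartAt (𝓡∂ n) x).symm y := fun y hy ↦
    (hs.mono inter_subset_left).contMDiffAt ((isOpen_interiorTarget (n := n) x).mem_nhds hy)
  have hsrc := (extChartAt (𝓡∂ n) x).map_target hy.1
  constructor
  · intro H
    filter_upwards [hW, (hsy y hy).continuousAt.eventually H] with e he h2
    exact (h2.comp e (hsy e he)).contDiffAt
  · intro H
    have h2 : ContinuousAt (extChartAt (𝓡∂ n) x) ((extChartAt (𝓡∂ n) x).symm y) :=
      continuousAt_extChartAt' hsrc
    have h3 := (extChartAt (𝓡∂ n) x).right_inv hy.1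
    have h4 : ∀ᶠ z in 𝓝 ((extChartAt (𝓡∂ n) x).symm y),
        ContDiffAt ℝ ∞ (fun e ↦ h (interiorParam n U x e)) (extChartAt (𝓡∂ n) x z) :=
      h2.eventually (by rwa [h3])
    have h5 := (isOpen_extChartAt_source (I := 𝓡∂ n) x).mem_nhds hsrc
    filter_upwards [h4, h5] with z hz hzs
    refine ContMDiffAt.congr_of_eventuallyEq
      (hz.contMDiffAt.comp z (contMDiffAt_extChartAt' (by simpa using hzs))) ?_
    filter_upwards [(isOpen_extChartAt_source (I := 𝓡∂ n) x).mem_nhds hzs] with z' hz'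
    simp only [Function.comp, interiorParam, (extChartAt (𝓡∂ n) x).left_inv hz']

end Germ

/-! ### Manifold structures determined by their smooth functions -/

section Structure

open Set Filter

theorem contDiffAt_of_forall_clm {A F : Type*} [NormedAddCommGroup A] [NormedSpace ℝ A]
    [NormedAddCommGroup F] [NormedSpace ℝ F] [FiniteDimensional ℝ F] {g : A → F} {a : A}
    (h : ∀ ℓ : F →L[ℝ] ℝ, ContDiffAt ℝ ∞ (fun x ↦ ℓ (g x)) a) : ContDiffAt ℝ ∞ g a := by
  set ε := toEuclidean (E := F)
  have : ContDiffAt ℝ ∞ (fun x ↦ ε (g x)) a := by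
    rw [contDiffAt_euclidean]
    intro i
    exact h ((EuclideanSpace.proj i : EuclideanSpace ℝ (Fin _) →L[ℝ] ℝ).comp
      (ε : F →L[ℝ] EuclideanSpace ℝ (Fin _)))
  simpa [Function.comp_def] using ε.symm.contDiff.contDiffAt.comp a this

variable {X : Type*} [TopologicalSpace X] {P : (X → ℝ) → X → Prop}
  {F : Type*} [NormedAddCommGroup F] [NormedSpace ℝ F]
  {F' : Type*} [NormedAddCommGroup F'] [NormedSpace ℝ F']

theorem IsChartFor.iff_symm {ψ : OpenPartialHomeomorph X F} (hψ : IsChartFor P ψ) {h : X → ℝ}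
    {e : F} (he : e ∈ ψ.target) :
    P h (ψ.symm e) ↔ ∀ᶠ e' in 𝓝 e, ContDiffAt ℝ ∞ (fun e ↦ h (ψ.symm e)) e' := by
  rw [hψ h _ (ψ.map_target he), ψ.right_inv he]

theorem IsChartFor.congr {ψ : OpenPartialHomeomorph X F} (hψ : IsChartFor P ψ) {h h' : X → ℝ}
    {p : X} (hp : p ∈ ψ.source) (hh : h =ᶠ[𝓝 p] h') (H : P h p) : P h' p := by
  rw [hψ _ p hp] at H ⊢
  have h1 : Tendsto ψ.symm (𝓝 (ψ p)) (𝓝 p) := by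
    have := ψ.symm.continuousAt (ψ.map_source hp)
    rwa [ContinuousAt, ψ.left_inv hp] at this
  have h2 := h1.eventually hh
  filter_upwards [H, eventually_eventually_nhds.2 h2] with e h3 h4
  exact h3.congr_of_eventuallyEq (h4.mono fun e' he' ↦ he'.symm)

theorem IsChartFor.trans {ψ : OpenPartialHomeomorph X F} (hψ : IsChartFor P ψ) (ε : F ≃L[ℝ] F') :
    IsChartFor P (ψ.transHomeomorph ε.toHomeomorph) := by
  intro h p hp
  rw [hψ h p hp]
  change _ ↔ ∀ᶠ e in 𝓝 (ε (ψ p)), ContDiffAt ℝ ∞ (fun e ↦ h (ψ.symm (ε.symm e))) e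
  constructor
  · intro H
    have h1 : Tendsto ε.symm (𝓝 (ε (ψ p))) (𝓝 (ψ p)) :=
      ε.symm.continuous.tendsto' _ _ (by simp)
    filter_upwards [h1.eventually H] with e he
    exact he.comp e ε.symm.contDiff.contDiffAt
  · intro H
    filter_upwards [(ε.continuous.tendsto (ψ p)).eventually H] with e he
    have := he.comp e ε.contDiff.contDiffAt
    simpa [Function.comp_def] using this

/-- Linear coordinates of one chart satisfy the local property P on its source, so they are smooth
in any other chart for P. -/
theorem IsChartFor.contDiffOn_symm_trans [FiniteDimensional ℝ F'] {ψ : OpenPartialHomeomorph X F}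
    (hψ : IsChartFor P ψ) {ψ' : OpenPartialHomeomorph X F'} (hψ' : IsChartFor P ψ') :
    ContDiffOn ℝ ∞ (ψ' ∘ ψ.symm) (ψ.symm ≫ₕ ψ').source := by
  intro e he
  rw [OpenPartialHomeomorph.trans_source] at he
  have he1 : e ∈ ψ.target := he.1
  have he2 : ψ.symm e ∈ ψ'.source := he.2
  refine (contDiffAt_of_forall_clm fun ℓ ↦ ?_).contDiffWithinAt
  have h1 : P (fun p ↦ ℓ (ψ' p)) (ψ.symm e) := by
    rw [hψ' _ _ he2]
    filter_upwards [ψ'.open_target.mem_nhds (ψ'.map_source he2)] with e' he'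
    refine ℓ.contDiff.contDiffAt.congr_of_eventuallyEq ?_
    filter_upwards [ψ'.open_target.mem_nhds he'] with e'' he''
    rw [ψ'.right_inv he'']
  exact ((hψ.iff_symm he1).1 h1).self_of_nhds

/-- The atlas consists of all charts for P, which are compatible by
`IsChartFor.contDiffOn_symm_trans`. -/
theorem exists_chartedSpace {m : ℕ}
    (hP : ∀ p, ∃ ψ : OpenPartialHomeomorph X (EuclideanSpace ℝ (Fin m)),
      p ∈ ψ.source ∧ IsChartFor P ψ) :
    ∃ _ : ChartedSpace (EuclideanSpace ℝ (Fin m)) X, IsManifold (𝓡 m) ∞ X ∧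
      ∀ h : X → ℝ, ContMDiff (𝓡 m) 𝓘(ℝ, ℝ) ∞ h ↔ ∀ p, P h p := by
  choose ψ hψs hψ using hP
  let C : ChartedSpace (EuclideanSpace ℝ (Fin m)) X :=
    { atlas := {ψ | IsChartFor P ψ}
      chartAt := ψ
      mem_chart_source := hψs
      chart_mem_atlas := hψ }
  have hM : IsManifold (𝓡 m) ∞ X := by
    refine isManifold_of_contDiffOn _ _ _ fun e e' he he' ↦ ?_
    simpa using (IsChartFor.contDiffOn_symm_trans (show IsChartFor P e from he)
      (show IsChartFor P e' from he'))
  refine ⟨C, hM, fun h ↦ ⟨fun H p ↦ ?_, fun H p ↦ ?_⟩⟩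
  · rw [hψ p h p (hψs p)]
    have h1 := H.comp_contMDiffOn (contMDiffOn_chart_symm (I := 𝓡 m) (x := p) (n := ∞))
    have h2 : ContDiffOn ℝ ∞ (fun e ↦ h ((ψ p).symm e)) (ψ p).target := h1.contDiffOn
    filter_upwards [(ψ p).open_target.mem_nhds ((ψ p).map_source (hψs p))] with e he
    exact h2.contDiffAt ((ψ p).open_target.mem_nhds he)
  · have h1 := ((hψ p h p (hψs p)).1 (H p)).self_of_nhds
    have h2 := (contMDiffOn_chart (I := 𝓡 m) (x := p) (n := ∞)).contMDiffAt
      ((ψ p).open_source.mem_nhds (hψs p))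
    refine (ContMDiffAt.comp p (show ContMDiffAt _ _ _ _ (chartAt (EuclideanSpace ℝ (Fin m)) p p)
      from h1.contMDiffAt) h2).congr_of_eventuallyEq ?_
    filter_upwards [(ψ p).open_source.mem_nhds (hψs p)] with q hq
    exact congrArg h ((ψ p).left_inv hq).symm

/-! ### An arbitrary structure with the prescribed smooth functions -/

section Smooth

variable {m : ℕ} [ChartedSpace (EuclideanSpace ℝ (Fin m)) X] [T2Space X] [IsManifold (𝓡 m) ∞ X]
  (hX : ∀ h : X → ℝ, ContMDiff (𝓡 m) 𝓘(ℝ, ℝ) ∞ h ↔ ∀ p, P h p)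
  [FiniteDimensional ℝ F] {ψ : OpenPartialHomeomorph X F} (hψ : IsChartFor P ψ)
include hX hψ

/-- A bump function makes the coordinates of the given structure into global smooth functions, to
which `hX` applies. -/
theorem IsChartFor.contMDiffOn_symm :
    ContMDiffOn 𝓘(ℝ, F) (𝓡 m) ∞ ψ.symm ψ.target := by
  intro e he
  apply ContMDiffAt.contMDiffWithinAt
  set p := ψ.symm e with hp
  have hps : p ∈ ψ.source := ψ.map_target he
  refine contMDiffAt_iff_target.2 ⟨ψ.symm.continuousAt he, ?_⟩
  refine ContDiffAt.contMDiffAt (contDiffAt_of_forall_clm fun ℓ ↦ ?_)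
  obtain ⟨χ⟩ : Nonempty (SmoothBumpFunction (𝓡 m) p) := inferInstance
  have h1 : ContMDiff (𝓡 m) 𝓘(ℝ, ℝ) ∞ (fun q ↦ χ q • ℓ (extChartAt (𝓡 m) p q)) :=
    χ.contMDiff_smul (ℓ.contMDiff.comp_contMDiffOn contMDiffOn_extChartAt)
  have h2 := (hX _).1 h1 p
  rw [hψ _ p hps] at h2
  replace h2 := h2.self_of_nhds
  rw [show ψ p = e from ψ.right_inv he] at h2
  refine h2.congr_of_eventuallyEq ?_
  filter_upwards [(ψ.symm.continuousAt he).eventually χ.eventuallyEq_one] with e' he'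
  simp only [Function.comp, he', Pi.one_apply, one_smul]
  rfl

/-- The coordinates of ψ, cut off by a bump function and extended by zero, satisfy P everywhere and
are therefore smooth for the given structure. -/
theorem IsChartFor.contMDiffOn
    (hP : ∀ p, ∃ ψ' : OpenPartialHomeomorph X (EuclideanSpace ℝ (Fin m)), p ∈ ψ'.source ∧ IsChartFor P ψ') :
    ContMDiffOn (𝓡 m) 𝓘(ℝ, F) ∞ ψ ψ.source := by
  intro p hp
  apply ContMDiffAt.contMDiffWithinAt
  obtain ⟨r, hr, hball⟩ := Metric.nhds_basis_closedBall.mem_iff.1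
    (ψ.open_target.mem_nhds (ψ.map_source hp))
  set ρ : ContDiffBump (ψ p) := ⟨r / 2, r, by positivity, by linarith⟩ with hρ
  have key : ∀ ℓ : F →L[ℝ] ℝ, ContMDiffAt (𝓡 m) 𝓘(ℝ, ℝ) ∞ (fun q ↦ ℓ (ψ q)) p := by
    intro ℓ
    classical
    set h : X → ℝ := ψ.source.indicator fun q ↦ ρ (ψ q) * ℓ (ψ q) with hh
    have hC : IsClosed (ψ.symm '' Metric.closedBall (ψ p) r) :=
      ((isCompact_closedBall _ _).image_of_continuousOn
        (ψ.symm.continuousOn.mono hball)).isClosed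
    have h1 : ∀ q, P h q := by
      intro q
      by_cases hq : q ∈ ψ.source
      · rw [hψ _ q hq]
        filter_upwards [ψ.open_target.mem_nhds (ψ.map_source hq)] with e he
        refine ((ρ.contDiff (n := ⊤)).mul ℓ.contDiff).contDiffAt.congr_of_eventuallyEq ?_
        filter_upwards [ψ.open_target.mem_nhds he] with e' he'
        rw [hh, indicator_of_mem (ψ.map_target he'), ψ.right_inv he']
      · obtain ⟨ψ', hq', hψ'⟩ := hP q
        -- The image of the closed ball is compact, hence closed as X is Hausdorff, so the extension
        -- vanishes near every point off the source.
        have h2 : (fun _ ↦ 0 : X → ℝ) =ᶠ[𝓝 q] h := by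
          filter_upwards [hC.isOpen_compl.mem_nhds (fun hqC ↦ hq (by
            obtain ⟨e, he, rfl⟩ := hqC
            exact ψ.map_target (hball he)))] with q' hq'
          by_cases hs : q' ∈ ψ.source
          · have : ρ (ψ q') = 0 := by
              refine ρ.zero_of_le_dist (le_of_not_ge fun hle ↦ hq' ⟨ψ q', ?_, ψ.left_inv hs⟩)
              exact Metric.mem_closedBall.2 hle
            rw [hh, indicator_of_mem hs, this, zero_mul]
          · rw [hh, indicator_of_notMem hs]
        refine hψ'.congr hq' h2 ?_
        rw [hψ' _ q hq']
        exact Eventually.of_forall fun e ↦ contDiffAt_const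
    refine ((hX h).2 h1 p).congr_of_eventuallyEq ?_
    filter_upwards [ψ.open_source.mem_nhds hp, (ψ.continuousAt hp).eventually ρ.eventuallyEq_one]
      with q hq h3
    rw [hh, indicator_of_mem hq, h3]
    simp
  set ε := (toEuclidean (E := F)).trans (EuclideanSpace.equiv (Fin (Module.finrank ℝ F)) ℝ)
  have h2 : ContMDiffAt (𝓡 m) 𝓘(ℝ, Fin (Module.finrank ℝ F) → ℝ) ∞ (fun q ↦ ε (ψ q)) p :=
    contMDiffAt_pi_space.2 fun i ↦ key ((ContinuousLinearMap.proj i).comp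
      (ε : F →L[ℝ] (Fin (Module.finrank ℝ F) → ℝ)))
  have h3 := ε.symm.contDiff.contMDiff.contMDiffAt.comp p h2
  simpa [Function.comp_def] using h3

end Smooth

end Structure

/-! ### The smooth functions on the cut space -/

section Global

open Set Filter

variable {n : ℕ} [NeZero n] {M : Type*} [TopologicalSpace M] [ChartedSpace (EuclideanHalfSpace n) M]
  {U : TopologicalSpace.Opens M} [MulAction Circle U] [IsManifold (𝓡∂ n) ∞ M]
  (hU : IsFreeActionNearBoundary n U) {f : M → ℝ}
  (hf : IsInvariantBoundaryDefining n U f) {h : CutSpace n U → ℝ}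
include hU hf

/-- The given `G` is itself the extension: its symmetry moves the phase of w from the first argument
to √(f x), where it restores w. -/
theorem smoothNear_of_mem_cutFunctions (hh : h ∈ cutFunctions n U f) (p : CutSpace n U) :
    SmoothNear n U f h p := by
  obtain ⟨h1, V', G, hV', hG, hGa, hGh⟩ := hh
  have hint : IsOpen ((𝓡∂ n).interior M) := (𝓡∂ n).isOpen_interior (n := ∞) (by simp)
  refine ⟨fun x hx _ ↦ ?_, fun x hx _ ↦ ?_⟩
  · filter_upwards [hint.mem_nhds hx] with y hy
    exact h1.contMDiffAt (hint.mem_nhds hy)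
  · obtain ⟨V, hV, hfV⟩ := hf.exists_nhd
    refine ⟨(V' ∩ V) ×ˢ univ, G, (hV'.isOpen.inter hV.isOpen).prod isOpen_univ,
      ⟨⟨hV'.boundary_subset hx, hV.boundary_subset hx⟩, trivial⟩,
      hG.mono (prod_mono inter_subset_left subset_rfl), ?_⟩
    rintro ⟨y, w⟩ ⟨⟨hy, hyV⟩, -⟩ hyw
    rw [twistMap, hGh _ (hV'.act_mem _ hy)]
    simp only at hyw ⊢
    rw [hfV _ _ hyV, hyw, Real.sqrt_sq (norm_nonneg _), act_of_mem _ (hV.subset hyV),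
      hGa (phase w) ⟨y, hV.subset hyV⟩ _ hy, phase_mul_norm]

variable [T2Space M]

theorem exists_chart (p : CutSpace n U) :
    ∃ ψ : OpenPartialHomeomorph (CutSpace n U) (EuclideanSpace ℝ (Fin n)),
      p ∈ ψ.source ∧ IsChartFor (SmoothNear n U f) ψ := by
  obtain ⟨x, rfl⟩ := surjective_cutMap p
  by_cases hx : x ∈ (𝓡∂ n).interior M
  · refine ⟨interiorChart hU x, ⟨extChartAt (𝓡∂ n) x x, ⟨mem_extChartAt_target x, ?_⟩, ?_⟩,
      isChartFor_interiorChart hU x⟩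
    · exact (mem_interior_iff_chart (mem_extChartAt_source x)).1 hx
    · exact congrArg (cutMap n U) (extChartAt_to_inv x)
  · rw [← mem_compl_iff, ModelWithCorners.compl_interior] at hx
    obtain ⟨V, hV, hfV⟩ := hf.exists_nhd
    obtain ⟨m, hm, ⟨S⟩⟩ := exists_sliceModel hU hf hV hfV hx
    have hr : Module.finrank ℝ (EuclideanSpace ℝ (Fin m) × ℂ) =
        Module.finrank ℝ (EuclideanSpace ℝ (Fin n)) := by
      rw [Module.finrank_prod, Complex.finrank_real_complex, finrank_euclideanSpace_fin,
        finrank_euclideanSpace_fin, hm]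
    refine ⟨(S.chart hU hf hV hfV).transHomeomorph
      (ContinuousLinearEquiv.ofFinrankEq hr).toHomeomorph, ⟨0, ?_, ?_⟩,
      (S.isChartFor hU hf hV hfV).trans _⟩
    · simp [mem_bidisc, S.radius_pos]
    · refine (congrArg (twistMap n U) ?_).trans (twistMap_zero x)
      rw [S.base]
      rfl

variable [SecondCountableTopology M]

/-- Local extensions are glued on M × ℂ by a partition of unity and then averaged over the
antidiagonal action. Averaging produces the symmetry of `G` and leaves the values on the
hypersurface unchanged, since the pulled back function is already invariant there. -/
theorem mem_cutFunctions_of_smoothNear (hh : ∀ p, SmoothNear n U f h p) :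
    h ∈ cutFunctions n U f := by
  have := sigmaCompact_of_halfSpace n M
  have := locallyCompact_of_halfSpace n M
  obtain ⟨V, hV, hfV⟩ := hf.exists_nhd
  refine ⟨fun x hx ↦ ((smoothNear_cutMap_iff hU hx).1 (hh _)).self_of_nhds.contMDiffWithinAt, ?_⟩
  obtain ⟨O, hO, hbO, hOV⟩ := normal_exists_closure_subset
    ((𝓡∂ n).isClosed_boundary (M := M) (n := ∞) (by simp)) hV.isOpen hV.boundary_subset
  obtain ⟨V₁, hV₁O, hV₁⟩ := exists_isInvariantNhd_subset hU hO hbO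
  have hV₁V : V₁ ⊆ V := (hV₁O.trans subset_closure).trans hOV
  set C : Set (M × ℂ) := {q | q.1 ∈ closure O ∧ f q.1 = ‖q.2‖ ^ 2} with hC
  have hCc : IsClosed C := (isClosed_closure.preimage continuous_fst).inter
    (isClosed_eq (hf.smooth.continuous.comp continuous_fst) (continuous_snd.norm.pow 2))
  -- The value is prescribed only on C. Using the closure of O makes C closed, so the glued function
  -- is unconstrained near every other point.
  set T : M × ℂ → Set ℝ := fun q ↦ {y | q ∈ C → y = h (twistMap n U q)} with hT
  have hconv : ∀ q, Convex ℝ (T q) := by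
    intro q
    by_cases hq : q ∈ C
    · simp only [hT, hq, true_imp_iff]
      exact convex_singleton _
    · simp only [hT, hq, false_imp_iff]
      exact convex_univ
  have hloc : ∀ q, ∃ W ∈ 𝓝 q, ∃ g : M × ℂ → ℝ,
      ContMDiffOn ((𝓡∂ n).prod 𝓘(ℝ, ℂ)) 𝓘(ℝ, ℝ) ∞ g W ∧ ∀ y ∈ W, g y ∈ T y := by
    intro q
    by_cases hq : q ∈ C
    · obtain ⟨W, G, hW, hqW, hG, hGh⟩ :=
        (smoothNear_twistMap_iff hU hf hV hfV (hOV hq.1) hq.2).1 (hh (twistMap n U q))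
      exact ⟨W, hW.mem_nhds hqW, G, hG, fun y hy hyC ↦ hGh y hy hyC.2⟩
    · exact ⟨Cᶜ, hCc.isOpen_compl.mem_nhds hq, fun _ ↦ 0, contMDiffOn_const,
        fun y hy hyC ↦ absurd hyC hy⟩
  obtain ⟨G₀, hG₀⟩ := exists_contMDiffMap_forall_mem_convex_of_local (n := ⊤)
    ((𝓡∂ n).prod 𝓘(ℝ, ℂ)) hconv hloc
  refine ⟨V₁, fun q ↦ ∫ t in (0 : ℝ)..1,
    G₀ (act U (circlePath t) q.1, ((circlePath t)⁻¹ : Circle) * q.2), hV₁, ?_, ?_, ?_⟩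
  · refine contMDiffOn_integral (I := (𝓡∂ n).prod 𝓘(ℝ, ℂ)) (hV₁.isOpen.prod isOpen_univ)
      (G := fun p : (M × ℂ) × ℝ ↦
        G₀ (act U (circlePath p.2) p.1.1, ((circlePath p.2)⁻¹ : Circle) * p.1.2)) ?_
    intro p hp
    refine ContMDiffAt.contMDiffWithinAt (G₀.contMDiff.contMDiffAt.comp p ?_)
    refine ContMDiffAt.prodMk (contMDiffAt_act_comp hU
      (contMDiff_circlePath.contMDiffAt.comp p contMDiffAt_snd)
      (contMDiffAt_fst.comp p contMDiffAt_fst) (hV₁.subset hp.1.1)) ?_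
    have h1 : ContDiff ℝ ∞ (fun r : ℝ × ℂ ↦ ((circlePath r.1)⁻¹ : Circle) * r.2) := by
      have : ∀ t, (((circlePath t)⁻¹ : Circle) : ℂ) =
          Complex.exp (((-(2 * Real.pi * t) : ℝ) : ℂ) * Complex.I) := fun t ↦ by
        rw [circlePath, ← Circle.exp_neg, Circle.coe_exp]
      simp only [this]
      exact ((Complex.ofRealCLM.contDiff.comp ((contDiff_const.mul contDiff_fst).neg)).mul
        contDiff_const).cexp.mul contDiff_snd
    have h2 : ContMDiff (((𝓡∂ n).prod 𝓘(ℝ, ℂ)).prod 𝓘(ℝ, ℝ)) 𝓘(ℝ, ℝ × ℂ) ∞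
        (fun p : (M × ℂ) × ℝ ↦ (p.2, p.1.2)) :=
      contMDiff_snd.prodMk_space (contMDiff_snd.comp contMDiff_fst)
    exact (h1.contMDiff.comp h2).contMDiffAt
  · intro a x z hx
    -- Replacing b by ba turns G₀(bx, b⁻¹az) into G₀(bax, b⁻¹z).
    have h1 := integral_circle_mul (fun b ↦ G₀ (act U b x, ((b⁻¹ : Circle) : ℂ) * (a * z))) a
    simp only
    rw [← h1]
    refine intervalIntegral.integral_congr fun t _ ↦ ?_
    rw [act_mul, act_of_mem a x.2, ← mul_assoc, ← Circle.coe_mul, mul_inv_rev, mul_comm a⁻¹,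
      inv_mul_cancel_right]
  · intro x hx
    have h1 : ∀ t, G₀ (act U (circlePath t) x, ((circlePath t)⁻¹ : Circle) * (√(f x) : ℝ)) =
        h (cutMap n U x) := by
      intro t
      have h2 : f x = ‖((√(f x) : ℝ) : ℂ)‖ ^ 2 := by simp [Real.sq_sqrt (hf.nonneg x)]
      have h3 := twistMap_act hU hf (circlePath t)⁻¹ h2
      rw [inv_inv, twistMap_ofReal _ (Real.sqrt_nonneg _)] at h3
      rw [← h3]
      refine hG₀ _ ⟨subset_closure (hV₁O (hV₁.act_mem _ hx)), ?_⟩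
      simp only [hfV _ _ (hV₁V hx), norm_mul, Circle.norm_coe, one_mul]
      exact h2
    simp only [h1]
    simp

theorem forall_smoothNear_iff : (∀ p, SmoothNear n U f h p) ↔ h ∈ cutFunctions n U f :=
  ⟨mem_cutFunctions_of_smoothNear hU hf, smoothNear_of_mem_cutFunctions hU hf⟩

omit hf in
theorem exists_cutManifold (hf : IsInvariantBoundaryDefining n U f) :
    ∃ _ : ChartedSpace (EuclideanSpace ℝ (Fin n)) (CutSpace n U), IsCutManifold n U f := by
  obtain ⟨C, hC, hs⟩ := exists_chartedSpace (exists_chart hU hf)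
  exact ⟨C, t2Space_cutSpace hU, secondCountable_cutSpace hU, hC, fun h ↦ by
    rw [hs, forall_smoothNear_iff hU hf]⟩

end Global

/-! ### Differential forms in charts -/

section FormCharts

open Set Filter

variable {E : Type*} [NormedAddCommGroup E] [NormedSpace ℝ E]
  {H : Type*} [TopologicalSpace H] {I : ModelWithCorners ℝ E H}
  {M : Type*} [TopologicalSpace M] [ChartedSpace H M]
  {E' : Type*} [NormedAddCommGroup E'] [NormedSpace ℝ E']
  {H' : Type*} [TopologicalSpace H'] {I' : ModelWithCorners ℝ E' H'}
  {M' : Type*} [TopologicalSpace M'] [ChartedSpace H' M']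
  {E'' : Type*} [NormedAddCommGroup E''] [NormedSpace ℝ E'']
  {H'' : Type*} [TopologicalSpace H''] {I'' : ModelWithCorners ℝ E'' H''}
  {M'' : Type*} [TopologicalSpace M''] [ChartedSpace H'' M'']
  {A : Type*} [NormedAddCommGroup A] [NormedSpace ℝ A]
  {B : Type*} [NormedAddCommGroup B] [NormedSpace ℝ B] {k : ℕ}

/-- The value of a form as an alternating form on the model space. -/
def FormField.val (β : FormField I M k) (x : M) : E [⋀^Fin k]→L[ℝ] ℝ := β x

variable (I I') in
/-- The derivative of a map between manifolds, as a linear map between the model spaces. -/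
def tderiv (g : M → M') (x : M) : E →L[ℝ] E' := mfderiv I I' g x

variable (I) in
/-- The derivative of the inverse of a chart, as a linear map of the model space. -/
def symmDeriv (x₀ : M) (y : E) : E →L[ℝ] E :=
  mfderivWithin 𝓘(ℝ, E) I (extChartAt I x₀).symm (range I) y

theorem tderiv_comp {g : M' → M''} {h : M → M'} {x : M} (hg : MDifferentiableAt I' I'' g (h x))
    (hh : MDifferentiableAt I I' h x) :
    tderiv I I'' (fun z ↦ g (h z)) x = (tderiv I' I'' g (h x)).comp (tderiv I I' h x) :=
  mfderiv_comp x hg hh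

theorem tderiv_congr {g h : M → M'} {x : M} (hgh : g =ᶠ[𝓝 x] h) :
    tderiv I I' g x = tderiv I I' h x :=
  hgh.mfderiv_eq

theorem tderiv_eq_id {g : M → M} {x : M} (hg : ∀ᶠ z in 𝓝 x, g z = z) :
    tderiv I I g x = ContinuousLinearMap.id ℝ E :=
  (tderiv_congr (h := id) hg).trans (mfderiv_id (I := I) (x := x))

theorem tderiv_eq_fderiv {g : A → B} {x : A} : tderiv 𝓘(ℝ, A) 𝓘(ℝ, B) g x = fderiv ℝ g x :=
  mfderiv_eq_fderiv

theorem pullbackAt_eq_iff {β : FormField I' M' k} {g : M → M'} {x : M} {α : FormField I M k} :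
    β.pullbackAt (I := I) g x = α x ↔
      (β.val (g x)).compContinuousLinearMap (tderiv I I' g x) = α.val x := Iff.rfl

theorem inChart_eq (β : FormField I M k) (x₀ : M) (y : E) : β.inChart x₀ y =
    (β.val ((extChartAt I x₀).symm y)).compContinuousLinearMap (symmDeriv I x₀ y) := rfl

section

variable [IsManifold I ∞ M]

theorem symmDeriv_comp_tderiv {x₀ q : M} (hq : q ∈ (extChartAt I x₀).source) :
    (symmDeriv I x₀ (extChartAt I x₀ q)).comp (tderiv I 𝓘(ℝ, E) (extChartAt I x₀) q) =
      ContinuousLinearMap.id ℝ E := by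
  have : IsManifold I 1 M := IsManifold.of_le (n := ∞) (by simp)
  exact mfderivWithin_extChartAt_symm_comp_mfderiv_extChartAt' hq

theorem mdifferentiableAt_chart {x₀ q : M} (hq : q ∈ (extChartAt I x₀).source) :
    MDifferentiableAt I 𝓘(ℝ, E) (extChartAt I x₀) q :=
  (contMDiffAt_extChartAt' (n := ∞) (by simpa using hq)).mdifferentiableAt (by simp)

/-- The derivative of a map, from its expression in a chart of the target. -/
theorem symmDeriv_fderiv {g : A → M} {p : A} (hg : MDifferentiableAt 𝓘(ℝ, A) I g p) {x₀ : M}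
    (hp : g p ∈ (extChartAt I x₀).source) :
    (symmDeriv I x₀ (extChartAt I x₀ (g p))).comp (fderiv ℝ (fun z ↦ extChartAt I x₀ (g z)) p) =
      tderiv 𝓘(ℝ, A) I g p := by
  rw [← tderiv_eq_fderiv, tderiv_comp (mdifferentiableAt_chart hp) hg,
    ← ContinuousLinearMap.comp_assoc, symmDeriv_comp_tderiv hp, ContinuousLinearMap.id_comp]

theorem inChart_apply_chart (β : FormField I M k) {x₀ q : M} (hq : q ∈ (extChartAt I x₀).source)
    (v : Fin k → E) :
    β.inChart x₀ (extChartAt I x₀ q) v =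
      β.val q (fun i ↦ symmDeriv I x₀ (extChartAt I x₀ q) (v i)) := by
  rw [inChart_eq, (extChartAt I x₀).left_inv hq]
  rfl

theorem eq_of_inChart_eq {β β' : FormField I M k} {q : M}
    (h : β.inChart q (extChartAt I q q) = β'.inChart q (extChartAt I q q)) : β q = β' q := by
  have hq := mem_extChartAt_source (I := I) q
  refine ContinuousAlternatingMap.ext (f := β.val q) (g := β'.val q) fun v ↦ ?_
  have h1 := congrArg (fun α : E [⋀^Fin k]→L[ℝ] ℝ ↦
    α (fun i ↦ tderiv I 𝓘(ℝ, E) (extChartAt I q) q (v i))) h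
  simp only [inChart_apply_chart _ hq] at h1
  have h2 : ∀ w : E, symmDeriv I q (extChartAt I q q) (tderiv I 𝓘(ℝ, E) (extChartAt I q) q w) = w :=
    fun w ↦ congrArg (fun l : E →L[ℝ] E ↦ l w) (symmDeriv_comp_tderiv hq)
  simpa only [h2] using h1

end

end FormCharts

/-! ### Gluing forms on a manifold without boundary -/

section Glue

open Set Filter

variable {m : ℕ} {X : Type*} [TopologicalSpace X] [ChartedSpace (EuclideanSpace ℝ (Fin m)) X]
  [IsManifold (𝓡 m) ∞ X] {k : ℕ}

/-- Smoothness of a form on an open subset of a manifold without boundary. -/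
def FormField.SmoothOn (α : FormField (𝓡 m) X k) (O : Set X) : Prop :=
  ∀ x₀ : X, ContDiffOn ℝ ∞ (α.inChart x₀)
    ((extChartAt (𝓡 m) x₀).target ∩ (extChartAt (𝓡 m) x₀).symm ⁻¹' O)

omit [IsManifold (𝓡 m) ∞ X] in
theorem isOpen_chart_preimage (x₀ : X) {O : Set X} (hO : IsOpen O) :
    IsOpen ((extChartAt (𝓡 m) x₀).target ∩ (extChartAt (𝓡 m) x₀).symm ⁻¹' O) :=
  (continuousOn_extChartAt_symm x₀).isOpen_inter_preimage (isOpen_extChartAt_target x₀) hO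

theorem FormField.SmoothOn.eqOn {α α' : FormField (𝓡 m) X k} {O D : Set X} (hα : α.SmoothOn O)
    (hα' : α'.SmoothOn O) (hO : IsOpen O) (hD : Dense D) (h : ∀ q ∈ D ∩ O, α q = α' q) {q : X}
    (hq : q ∈ O) : α q = α' q := by
  apply eq_of_inChart_eq
  set φ := extChartAt (𝓡 m) q with hφ
  have hφq : φ q ∈ φ.target ∩ φ.symm ⁻¹' O :=
    ⟨mem_extChartAt_target q, by rw [mem_preimage, hφ, extChartAt_to_inv]; exact hq⟩
  have hn := (isOpen_chart_preimage q hO).mem_nhds hφq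
  have h1 := ((hα q).continuousOn.continuousAt hn).tendsto
  have h2 := ((hα' q).continuousOn.continuousAt hn).tendsto
  refine tendsto_nhds_unique_of_frequently_eq h1 h2 ?_
  have h3 : ∃ᶠ z in 𝓝 q, z ∈ D := mem_closure_iff_frequently.1 (hD q)
  have h4 : ∃ᶠ z in 𝓝 q, z ∈ D ∧ z ∈ O ∩ φ.source :=
    h3.and_eventually (inter_mem (hO.mem_nhds hq) (extChartAt_source_mem_nhds q))
  refine (continuousAt_extChartAt q).frequently (h4.mono fun z hz ↦ ?_)
  rw [inChart_eq, inChart_eq, φ.left_inv hz.2.2]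
  exact congrArg (fun κ : EuclideanSpace ℝ (Fin m) [⋀^Fin k]→L[ℝ] ℝ ↦
    κ.compContinuousLinearMap (symmDeriv (𝓡 m) q (φ z))) (h z ⟨hz.1, hz.2.1⟩)

/-- The pullback of a smooth form on a vector space is smooth. -/
theorem smoothOn_pullback {F : Type*} [NormedAddCommGroup F] [NormedSpace ℝ F]
    {ψ : X → F} {O : Set X} (hO : IsOpen O) (hψ : ContMDiffOn (𝓡 m) 𝓘(ℝ, F) ∞ ψ O)
    {γ : F → F [⋀^Fin k]→L[ℝ] ℝ} {W : Set F} (hγ : ContDiffOn ℝ ∞ γ W) (hW : MapsTo ψ O W) :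
    FormField.SmoothOn (m := m) (k := k) (X := X)
      (fun q ↦ (γ (ψ q)).compContinuousLinearMap (tderiv (𝓡 m) 𝓘(ℝ, F) ψ q)) O := by
  intro x₀
  set φ := extChartAt (𝓡 m) x₀ with hφ
  set S := φ.target ∩ φ.symm ⁻¹' O with hS
  have hSo : IsOpen S := isOpen_chart_preimage x₀ hO
  have hs : ContMDiffOn 𝓘(ℝ, EuclideanSpace ℝ (Fin m)) (𝓡 m) ∞ φ.symm S :=
    (contMDiffOn_extChartAt_symm x₀).mono inter_subset_left
  have hg : ContDiffOn ℝ ∞ (fun y ↦ ψ (φ.symm y)) S := (hψ.comp hs fun y hy ↦ hy.2).contDiffOn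
  have h1 : ContDiffOn ℝ ∞ (fun y ↦ (γ (ψ (φ.symm y))).compContinuousLinearMap
      (fderiv ℝ (fun y ↦ ψ (φ.symm y)) y)) S :=
    contDiffOn_alternating_comp (hγ.comp hg fun y hy ↦ hW hy.2)
      (hg.fderiv_of_isOpen hSo (m := ∞) (by simp))
  refine h1.congr fun y hy ↦ ?_
  have h2 : MDifferentiableAt (𝓡 m) 𝓘(ℝ, F) ψ (φ.symm y) :=
    (hψ.contMDiffAt (hO.mem_nhds hy.2)).mdifferentiableAt (by simp)
  have h3 : MDifferentiableAt 𝓘(ℝ, EuclideanSpace ℝ (Fin m)) (𝓡 m) φ.symm y :=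
    (hs.contMDiffAt (hSo.mem_nhds hy)).mdifferentiableAt (by simp)
  have h4 : symmDeriv (𝓡 m) x₀ y = tderiv 𝓘(ℝ, EuclideanSpace ℝ (Fin m)) (𝓡 m) φ.symm y := by
    rw [symmDeriv, tderiv, show range (𝓡 m) = univ from by simp, mfderivWithin_univ]
  rw [inChart_eq, h4, ← tderiv_eq_fderiv, tderiv_comp h2 h3]
  rfl

variable {E : Type*} [NormedAddCommGroup E] [NormedSpace ℝ E]
  {H : Type*} [TopologicalSpace H] {I : ModelWithCorners ℝ E H}
  {M : Type*} [TopologicalSpace M] [ChartedSpace H M]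

/-- Surjectivity of the differential makes the pullback determine a form on c(D), and density
extends this by continuity. The local forms thus agree on overlaps. -/
theorem existsUnique_form {c : M → X} {D : Set M} (hdense : Dense (c '' D))
    (hsurj : ∀ x ∈ D, Function.Surjective (tderiv I (𝓡 m) c x)) {β : FormField I M k}
    (hloc : ∀ p : X, ∃ (O : Set X) (α : FormField (𝓡 m) X k), IsOpen O ∧ p ∈ O ∧ α.SmoothOn O ∧
      ∀ x ∈ D, c x ∈ O → α.pullbackAt (I := I) c x = β x) :
    ∃! γ : DifferentialForm (𝓡 m) X k, ∀ x ∈ D, γ.toFun.pullbackAt (I := I) c x = β x := by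
  have hcancel : ∀ (α α' : FormField (𝓡 m) X k), ∀ x ∈ D,
      α.pullbackAt (I := I) c x = α'.pullbackAt (I := I) c x → α (c x) = α' (c x) := by
    intro α α' x hx h
    refine ContinuousAlternatingMap.ext (f := α.val (c x)) (g := α'.val (c x)) fun v ↦ ?_
    choose w hw using fun i ↦ hsurj x hx (v i)
    have h1 : (α.val (c x)).compContinuousLinearMap (tderiv I (𝓡 m) c x) =
      (α'.val (c x)).compContinuousLinearMap (tderiv I (𝓡 m) c x) := h
    have h2 := congrArg (fun κ : E [⋀^Fin k]→L[ℝ] ℝ ↦ κ w) h1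
    have h3 : (fun i ↦ tderiv I (𝓡 m) c x (w i)) = v := funext hw
    simpa only [ContinuousAlternatingMap.compContinuousLinearMap_apply, Function.comp_def, h3]
      using h2
  choose O α hO hpO hα hpull using hloc
  have key : ∀ p, ∀ q ∈ O p, α q q = α p q := by
    intro p q hq
    have h1 : ∀ r ∈ c '' D ∩ (O p ∩ O q), α q r = α p r := by
      rintro _ ⟨⟨x, hx, rfl⟩, hr⟩
      exact hcancel _ _ x hx ((hpull q x hx hr.2).trans (hpull p x hx hr.1).symm)
    exact FormField.SmoothOn.eqOn (O := O p ∩ O q)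
      (fun x₀ ↦ (hα q x₀).mono fun y hy ↦ ⟨hy.1, hy.2.2⟩)
      (fun x₀ ↦ (hα p x₀).mono fun y hy ↦ ⟨hy.1, hy.2.1⟩) ((hO p).inter (hO q)) hdense h1
      ⟨hq, hpO q⟩
  -- At each q the form chosen for q itself is used; by `key` it coincides near p with the single
  -- smooth form chosen for p.
  refine ⟨⟨fun q ↦ α q q, fun x₀ y hy ↦ ContDiffAt.contDiffWithinAt ?_⟩, fun x hx ↦ ?_,
    fun γ hγ ↦ ?_⟩
  · set p := (extChartAt (𝓡 m) x₀).symm y with hp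
    have hn := (isOpen_chart_preimage x₀ (hO p)).mem_nhds (⟨hy, hpO p⟩ :
      y ∈ (extChartAt (𝓡 m) x₀).target ∩ (extChartAt (𝓡 m) x₀).symm ⁻¹' (O p))
    refine ((hα p x₀).contDiffAt hn).congr_of_eventuallyEq ?_
    filter_upwards [hn] with z hz
    exact congrArg (fun κ : EuclideanSpace ℝ (Fin m) [⋀^Fin k]→L[ℝ] ℝ ↦
      κ.compContinuousLinearMap (symmDeriv (𝓡 m) x₀ z)) (key p _ hz.2)
  · exact hpull (c x) x hx (hpO _)
  · obtain ⟨γ, hγs⟩ := γ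
    congr 1
    funext q
    refine FormField.SmoothOn.eqOn (O := O q) (fun x₀ ↦ (hγs x₀).mono inter_subset_left) (hα q)
      (hO q) hdense ?_ (hpO q)
    rintro _ ⟨⟨x, hx, rfl⟩, hr⟩
    exact hcancel _ _ x hx ((hγ x hx).trans (hpull q x hx hr).symm)

end Glue

/-! ### The quotient map on the interior -/

section Interior

open Set Filter

variable {n : ℕ} [NeZero n] {M : Type*} [TopologicalSpace M] [ChartedSpace (EuclideanHalfSpace n) M]
  {U : TopologicalSpace.Opens M} [MulAction Circle U] [IsManifold (𝓡∂ n) ∞ M]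

variable (n M) in
theorem dense_interior : Dense ((𝓡∂ n).interior M) := by
  intro x
  by_cases hx : x ∈ (𝓡∂ n).interior M
  · exact subset_closure hx
  · rw [← mem_compl_iff, ModelWithCorners.compl_interior] at hx
    have hx0 := (mem_boundary_iff_chart (mem_extChartAt_source (I := 𝓡∂ n) x)).1 hx
    have hcurve : Tendsto (fun t : ℝ ↦ extChartAt (𝓡∂ n) x x + t • inward n) (𝓝[>] 0)
        (𝓝[range (𝓡∂ n)] (extChartAt (𝓡∂ n) x x)) := by
      refine tendsto_nhdsWithin_iff.2 ⟨?_, ?_⟩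
      · exact ((by fun_prop : Continuous fun t : ℝ ↦ extChartAt (𝓡∂ n) x x +
          t • inward n).tendsto' _ _ (by simp)).mono_left nhdsWithin_le_nhds
      · filter_upwards [self_mem_nhdsWithin] with t ht
        rw [mem_range_halfSpace]
        have h0 : (0 : ℝ) < t := ht
        simpa only [PiLp.add_apply, PiLp.smul_apply, smul_eq_mul, hx0, zero_add, inward_zero,
          mul_one] using h0.le
    refine mem_closure_of_tendsto ((tendsto_ray x (inward n)).mono_left
      (nhdsWithin_le_nhds (s := Ioi 0))) ?_
    filter_upwards [hcurve.eventually (extChartAt_target_mem_nhdsWithin x), self_mem_nhdsWithin]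
      with t ht ht0
    rw [mem_interior_iff_chart ((extChartAt (𝓡∂ n) x).map_target ht),
      (extChartAt (𝓡∂ n) x).right_inv ht]
    have h0 : (0 : ℝ) < t := ht0
    simpa only [PiLp.add_apply, PiLp.smul_apply, smul_eq_mul, hx0, zero_add, inward_zero,
      mul_one] using h0

variable (hU : IsFreeActionNearBoundary n U)
include hU

theorem dense_cutMap_interior : Dense (cutMap n U '' (𝓡∂ n).interior M) :=
  (surjective_cutMap.denseRange).dense_image continuous_cutMap (dense_interior n M)

variable {f : M → ℝ} (hf : IsInvariantBoundaryDefining n U f) [T2Space M]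
  [SecondCountableTopology M] [ChartedSpace (EuclideanSpace ℝ (Fin n)) (CutSpace n U)]
  (hC : IsCutManifold n U f)
include hf hC

theorem contMDiff_iff_smoothNear (h : CutSpace n U → ℝ) :
    ContMDiff (𝓡 n) 𝓘(ℝ, ℝ) ∞ h ↔ ∀ p, SmoothNear n U f h p :=
  (hC.smooth_iff h).trans (forall_smoothNear_iff hU hf).symm

theorem contMDiffOn_chart_symm_of_isChartFor {F : Type*} [NormedAddCommGroup F] [NormedSpace ℝ F]
    [FiniteDimensional ℝ F] {ψ : OpenPartialHomeomorph (CutSpace n U) F}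
    (hψ : IsChartFor (SmoothNear n U f) ψ) : ContMDiffOn 𝓘(ℝ, F) (𝓡 n) ∞ ψ.symm ψ.target :=
  have := hC.t2
  have := hC.isManifold
  hψ.contMDiffOn_symm (contMDiff_iff_smoothNear hU hf hC)

theorem contMDiffOn_of_isChartFor {F : Type*} [NormedAddCommGroup F] [NormedSpace ℝ F]
    [FiniteDimensional ℝ F] {ψ : OpenPartialHomeomorph (CutSpace n U) F}
    (hψ : IsChartFor (SmoothNear n U f) ψ) : ContMDiffOn (𝓡 n) 𝓘(ℝ, F) ∞ ψ ψ.source :=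
  have := hC.t2
  have := hC.isManifold
  hψ.contMDiffOn (contMDiff_iff_smoothNear hU hf hC) (exists_chart hU hf)

omit hf hC [ChartedSpace (EuclideanSpace ℝ (Fin n)) (CutSpace n U)] in
theorem interiorChart_cutMap {x₀ x : M} (hx : x ∈ (𝓡∂ n).interior M)
    (hs : x ∈ (extChartAt (𝓡∂ n) x₀).source) :
    cutMap n U x ∈ (interiorChart hU x₀).source ∧
      interiorChart hU x₀ (cutMap n U x) = extChartAt (𝓡∂ n) x₀ x := by
  have h1 : extChartAt (𝓡∂ n) x₀ x ∈ interiorTarget n x₀ :=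
    ⟨(extChartAt (𝓡∂ n) x₀).map_source hs, (mem_interior_iff_chart hs).1 hx⟩
  have h2 : interiorParam n U x₀ (extChartAt (𝓡∂ n) x₀ x) = cutMap n U x :=
    congrArg (cutMap n U) ((extChartAt (𝓡∂ n) x₀).left_inv hs)
  rw [← h2]
  exact ⟨⟨_, h1, rfl⟩, chartOfParametrization_apply _ _ _ _ h1⟩

theorem contMDiffAt_cutMap {x : M} (hx : x ∈ (𝓡∂ n).interior M) :
    ContMDiffAt (𝓡∂ n) (𝓡 n) ∞ (cutMap n U) x := by
  have hψ := contMDiffOn_chart_symm_of_isChartFor hU hf hC (isChartFor_interiorChart hU (f := f) x)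
  have hs := mem_extChartAt_source (I := 𝓡∂ n) x
  obtain ⟨h1, h2⟩ := interiorChart_cutMap hU hx hs
  have h3 : extChartAt (𝓡∂ n) x x ∈ (interiorChart hU x).target :=
    h2 ▸ (interiorChart hU x).map_source h1
  have h4 := (hψ.contMDiffAt ((interiorChart hU x).open_target.mem_nhds h3)).comp x
    (contMDiffAt_extChartAt (I := 𝓡∂ n) (n := ∞) (x := x))
  refine h4.congr_of_eventuallyEq ?_
  filter_upwards [extChartAt_source_mem_nhds (I := 𝓡∂ n) x] with z hz
  exact congrArg (cutMap n U) ((extChartAt (𝓡∂ n) x).left_inv hz).symm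

theorem mdifferentiableAt_cutMap {x : M} (hx : x ∈ (𝓡∂ n).interior M) :
    MDifferentiableAt (𝓡∂ n) (𝓡 n) (cutMap n U) x :=
  (contMDiffAt_cutMap hU hf hC hx).mdifferentiableAt (by simp)

theorem tderiv_interiorChart_comp {x₀ x : M} (hx : x ∈ (𝓡∂ n).interior M)
    (hs : x ∈ (extChartAt (𝓡∂ n) x₀).source) :
    (tderiv (𝓡 n) 𝓘(ℝ, EuclideanSpace ℝ (Fin n)) (interiorChart hU x₀) (cutMap n U x)).comp
      (tderiv (𝓡∂ n) (𝓡 n) (cutMap n U) x) =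
      tderiv (𝓡∂ n) 𝓘(ℝ, EuclideanSpace ℝ (Fin n)) (extChartAt (𝓡∂ n) x₀) x := by
  have hint : IsOpen ((𝓡∂ n).interior M) := (𝓡∂ n).isOpen_interior (n := ∞) (by simp)
  have h1 := (contMDiffOn_of_isChartFor hU hf hC (isChartFor_interiorChart hU (f := f)
    x₀)).contMDiffAt ((interiorChart hU x₀).open_source.mem_nhds (interiorChart_cutMap hU hx hs).1)
  rw [← tderiv_comp (h1.mdifferentiableAt (by simp)) (mdifferentiableAt_cutMap hU hf hC hx)]
  refine tderiv_congr ?_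
  filter_upwards [hint.mem_nhds hx, (isOpen_extChartAt_source x₀).mem_nhds hs] with z hz hzs
  exact (interiorChart_cutMap hU hz hzs).2

/-- The inverse chart of M composed with the chart of the cut space is a differentiable local
section of c. -/
theorem surjective_tderiv_cutMap {x : M} (hx : x ∈ (𝓡∂ n).interior M) :
    Function.Surjective (tderiv (𝓡∂ n) (𝓡 n) (cutMap n U) x) := by
  have hs := mem_extChartAt_source (I := 𝓡∂ n) x
  obtain ⟨h1, h2⟩ := interiorChart_cutMap hU hx hs
  set ψ := interiorChart hU x with hψ
  have h3 := (contMDiffOn_of_isChartFor hU hf hC (isChartFor_interiorChart hU (f := f)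
    x)).contMDiffAt (ψ.open_source.mem_nhds h1)
  have h4 : extChartAt (𝓡∂ n) x x ∈ interiorTarget n x := h2 ▸ ψ.map_source h1
  have h5 : ContMDiffAt 𝓘(ℝ, EuclideanSpace ℝ (Fin n)) (𝓡∂ n) ∞
      (extChartAt (𝓡∂ n) x).symm (ψ (cutMap n U x)) := by
    rw [h2]
    exact ((contMDiffOn_extChartAt_symm x).mono inter_subset_left).contMDiffAt
      ((isOpen_interiorTarget x).mem_nhds h4)
  have h6 := (h5.comp (cutMap n U x) h3).mdifferentiableAt (by simp)
  have h7 : (extChartAt (𝓡∂ n) x).symm (ψ (cutMap n U x)) = x := by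
    rw [h2, extChartAt_to_inv]
  have h8 : MDifferentiableAt (𝓡∂ n) (𝓡 n) (cutMap n U)
      ((extChartAt (𝓡∂ n) x).symm (ψ (cutMap n U x))) := by
    rw [h7]
    exact mdifferentiableAt_cutMap hU hf hC hx
  have h9 := tderiv_comp (h := fun z ↦ (extChartAt (𝓡∂ n) x).symm (ψ z)) h8 h6
  rw [tderiv_eq_id] at h9
  · simp only [h7] at h9
    intro v
    exact ⟨_, (congrArg (fun l : EuclideanSpace ℝ (Fin n) →L[ℝ] EuclideanSpace ℝ (Fin n) ↦ l v)
      h9).symm⟩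
  · filter_upwards [ψ.open_source.mem_nhds h1] with z hz
    exact ψ.left_inv hz

/-- The coordinate expression of β serves on both sides, because c is the identity in the chart of M
and the chart it induces. -/
theorem exists_form_near_interior {k : ℕ} (β : DifferentialForm (𝓡∂ n) M k) {x₀ : M}
    (hx₀ : x₀ ∈ (𝓡∂ n).interior M) :
    ∃ (O : Set (CutSpace n U)) (α : FormField (𝓡 n) (CutSpace n U) k), IsOpen O ∧
      cutMap n U x₀ ∈ O ∧ α.SmoothOn O ∧ ∀ x ∈ (𝓡∂ n).interior M, cutMap n U x ∈ O →
        α.pullbackAt (I := 𝓡∂ n) (cutMap n U) x = β.toFun x := by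
  have := hC.isManifold
  set ψ := interiorChart hU x₀ with hψ
  refine ⟨ψ.source, _, ψ.open_source,
    (interiorChart_cutMap hU hx₀ (mem_extChartAt_source x₀)).1,
    smoothOn_pullback ψ.open_source
      (contMDiffOn_of_isChartFor hU hf hC (isChartFor_interiorChart hU (f := f) x₀))
      (γ := β.toFun.inChart x₀) (W := interiorTarget n x₀) ((β.smooth' x₀).mono inter_subset_left)
      (fun p hp ↦ ψ.map_source hp), fun x hx hxO ↦ ?_⟩
  obtain ⟨y, hy, hyx⟩ := hxO
  have hxy : x = (extChartAt (𝓡∂ n) x₀).symm y := eq_of_cutMap_eq hU hx hyx.symm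
  have hs : x ∈ (extChartAt (𝓡∂ n) x₀).source := hxy ▸ (extChartAt (𝓡∂ n) x₀).map_target hy.1
  refine pullbackAt_eq_iff.2 (ContinuousAlternatingMap.ext fun v ↦ ?_)
  have h1 : ∀ w : EuclideanSpace ℝ (Fin n),
      tderiv (𝓡 n) 𝓘(ℝ, EuclideanSpace ℝ (Fin n)) ψ (cutMap n U x)
        (tderiv (𝓡∂ n) (𝓡 n) (cutMap n U) x w) =
      tderiv (𝓡∂ n) 𝓘(ℝ, EuclideanSpace ℝ (Fin n)) (extChartAt (𝓡∂ n) x₀) x w := fun w ↦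
    congrArg (fun l : EuclideanSpace ℝ (Fin n) →L[ℝ] EuclideanSpace ℝ (Fin n) ↦ l w)
      (tderiv_interiorChart_comp hU hf hC hx hs)
  have h2 : ∀ w : EuclideanSpace ℝ (Fin n), symmDeriv (𝓡∂ n) x₀ (extChartAt (𝓡∂ n) x₀ x)
      (tderiv (𝓡∂ n) 𝓘(ℝ, EuclideanSpace ℝ (Fin n)) (extChartAt (𝓡∂ n) x₀) x w) = w := fun w ↦
    congrArg (fun l : EuclideanSpace ℝ (Fin n) →L[ℝ] EuclideanSpace ℝ (Fin n) ↦ l w)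
      (symmDeriv_comp_tderiv hs)
  change β.toFun.inChart x₀ (ψ (cutMap n U x)) (fun i ↦
    tderiv (𝓡 n) 𝓘(ℝ, EuclideanSpace ℝ (Fin n)) ψ (cutMap n U x)
      (tderiv (𝓡∂ n) (𝓡 n) (cutMap n U) x (v i))) = β.toFun.val x v
  simp only [h1]
  rw [(interiorChart_cutMap hU hx hs).2, inChart_apply_chart _ hs]
  simp only [h2]

end Interior

/-! ### The form on the cut space near the image of the boundary -/

section Boundary

open Set Filter

/-- The derivative of the relative angle is dθ. -/
theorem hasFDerivAt_log_im {ζ : ℂ} (hζ : ζ ≠ 0) :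
    ∃ L : ℂ →L[ℝ] ℝ, HasFDerivAt (fun z : ℂ ↦ (Complex.log (z * ζ⁻¹)).im) L ζ ∧
      ∀ w, L w = angular ζ w := by
  have h1 : HasDerivAt (fun z : ℂ ↦ z * ζ⁻¹) ζ⁻¹ ζ := by
    simpa using (hasDerivAt_id ζ).mul_const ζ⁻¹
  have h2 : HasDerivAt (fun z : ℂ ↦ Complex.log (z * ζ⁻¹)) (ζ⁻¹ / (ζ * ζ⁻¹)) ζ :=
    h1.clog (by rw [mul_inv_cancel₀ hζ]; exact Complex.one_mem_slitPlane)
  rw [mul_inv_cancel₀ hζ, div_one] at h2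
  refine ⟨_, Complex.imCLM.hasFDerivAt.comp ζ (h2.hasFDerivAt.restrictScalars ℝ), fun w ↦ ?_⟩
  simp [angular, Complex.mul_im, Complex.inv_re, Complex.inv_im]
  ring

variable {n : ℕ} [NeZero n] {M : Type*} [TopologicalSpace M] [ChartedSpace (EuclideanHalfSpace n) M]
  {U : TopologicalSpace.Opens M} [MulAction Circle U] [IsManifold (𝓡∂ n) ∞ M]

theorem tderiv_mem_boundaryTangent {A : Type*} [NormedAddCommGroup A] [NormedSpace ℝ A] {g : A → M}
    {p : A} (hg : MDifferentiableAt 𝓘(ℝ, A) (𝓡∂ n) g p)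
    (hb : ∀ᶠ z in 𝓝 p, g z ∈ (𝓡∂ n).boundary M) (v : A) :
    tderiv 𝓘(ℝ, A) (𝓡∂ n) g p v ∈ boundaryTangent n (g p) := by
  have h1 : MDifferentiableAt (𝓡∂ n) 𝓘(ℝ, ℝ) (fun y ↦ extChartAt (𝓡∂ n) (g p) y 0) (g p) :=
    (mdifferentiableAt_chart_zero (mem_extChartAt_source (g p))).mdifferentiableAt (by simp)
  have h2 := tderiv_comp h1 hg
  rw [tderiv_congr (h := fun _ ↦ (0 : ℝ)) (by
    filter_upwards [hb, hg.continuousAt.eventually (extChartAt_source_mem_nhds (I := 𝓡∂ n) (g p))] with z hz hzs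
    exact (mem_boundary_iff_chart hzs).1 hz), tderiv_eq_fderiv] at h2
  have h3 := congrArg (fun l : A →L[ℝ] ℝ ↦ l v) h2
  simp only [fderiv_fun_const] at h3
  exact h3.symm

theorem mem_boundaryTangent_of_eq {x y : M} (h : y = x) {v w : EuclideanSpace ℝ (Fin n)} (hw : w = v)
    (hv : v ∈ boundaryTangent n y) : w ∈ boundaryTangent n x := by
  subst h hw
  exact hv

namespace SliceModel

variable {f : M → ℝ} {V : Set M} {x₀ : M} {K : Type} [NormedAddCommGroup K] [NormedSpace ℝ K]
  (S : SliceModel n U f V x₀ K)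

/-- The slice in the chart around the base point. -/
def local_X (p : K × ℂ) : EuclideanSpace ℝ (Fin n) := extChartAt (𝓡∂ n) x₀ (S.X p)

/-- The flow of the slice in the chart around the base point. -/
def flow (q : ℝ × (K × ℂ)) : EuclideanSpace ℝ (Fin n) :=
  extChartAt (𝓡∂ n) x₀ (act U (Circle.exp q.1) (S.X q.2))

/-- The generator of the action, along the slice, in the chart around the base point. -/
def velocity (p : K × ℂ) : EuclideanSpace ℝ (Fin n) := fderiv ℝ S.flow (0, p) (1, 0)

theorem contDiffOn_local_X : ContDiffOn ℝ ∞ S.local_X (bidisc K S.radius) :=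
  ((contMDiffOn_extChartAt (x := x₀)).comp S.smooth
    fun p hp ↦ by simpa using S.mem_source p hp).contDiffOn

theorem mdifferentiableAt_X {p : K × ℂ} (hp : p ∈ bidisc K S.radius) :
    MDifferentiableAt 𝓘(ℝ, K × ℂ) (𝓡∂ n) S.X p :=
  (S.smooth.contMDiffAt ((isOpen_bidisc _).mem_nhds hp)).mdifferentiableAt (by simp)

theorem symmDeriv_fderiv_local_X {p : K × ℂ} (hp : p ∈ bidisc K S.radius) :
    (symmDeriv (𝓡∂ n) x₀ (S.local_X p)).comp (fderiv ℝ S.local_X p) =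
      tderiv 𝓘(ℝ, K × ℂ) (𝓡∂ n) S.X p :=
  symmDeriv_fderiv (S.mdifferentiableAt_X hp) (S.mem_source p hp)

variable (hU : IsFreeActionNearBoundary n U) (hVU : V ⊆ U)
include hU hVU

theorem exists_contDiffOn_flow : ∃ W : Set (ℝ × (K × ℂ)), IsOpen W ∧
    (∀ p ∈ bidisc K S.radius, (0, p) ∈ W) ∧ ContDiffOn ℝ ∞ S.flow W := by
  have h1 : ContMDiffOn 𝓘(ℝ, ℝ × (K × ℂ)) (𝓡∂ n) ∞
      (fun q : ℝ × (K × ℂ) ↦ act U (Circle.exp q.1) (S.X q.2)) (univ ×ˢ bidisc K S.radius) := by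
    intro q hq
    refine contMDiffWithinAt_act_comp hU ?_ ?_ (hVU (S.mem _ hq.2))
    · exact (contMDiff_circleExp.comp contDiff_fst.contMDiff).contMDiffAt.contMDiffWithinAt
    · exact (S.smooth q.2 hq.2).comp q contDiff_snd.contMDiff.contMDiffAt.contMDiffWithinAt
        (fun q' hq' ↦ hq'.2)
  refine ⟨_, h1.continuousOn.isOpen_inter_preimage (isOpen_univ.prod (isOpen_bidisc _))
    (isOpen_extChartAt_source (I := 𝓡∂ n) x₀), fun p hp ↦ ⟨⟨trivial, hp⟩, ?_⟩, ?_⟩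
  · simpa [act_one] using S.mem_source p hp
  · exact ((contMDiffOn_extChartAt (x := x₀)).comp (h1.mono inter_subset_left)
      fun q hq ↦ by simpa using hq.2).contDiffOn

theorem differentiableAt_flow {p : K × ℂ} (hp : p ∈ bidisc K S.radius) :
    DifferentiableAt ℝ S.flow (0, p) := by
  obtain ⟨W, hW, hpW, hs⟩ := S.exists_contDiffOn_flow hU hVU
  exact (hs.contDiffAt (hW.mem_nhds (hpW p hp))).differentiableAt (by simp)

theorem contDiffOn_velocity : ContDiffOn ℝ ∞ S.velocity (bidisc K S.radius) := by
  obtain ⟨W, hW, hpW, hs⟩ := S.exists_contDiffOn_flow hU hVU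
  exact ((hs.fderiv_of_isOpen hW (m := ∞) (by simp)).comp
    (contDiff_const.prodMk contDiff_id).contDiffOn hpW).clm_apply contDiffOn_const

theorem hasDerivAt_flow {p : K × ℂ} (hp : p ∈ bidisc K S.radius) :
    HasDerivAt (fun t : ℝ ↦ S.flow (t, p)) (S.velocity p) 0 := by
  have h1 : HasDerivAt (fun s : ℝ ↦ (s, p)) (1, 0) 0 :=
    (hasDerivAt_id (0 : ℝ)).prodMk (hasDerivAt_const _ _)
  exact HasFDerivAt.comp_hasDerivAt (0 : ℝ) (f := fun s : ℝ ↦ (s, p))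
    (S.differentiableAt_flow hU hVU hp).hasFDerivAt h1

theorem fderiv_flow_apply {p : K × ℂ} (hp : p ∈ bidisc K S.radius) (s : ℝ) (v : K × ℂ) :
    fderiv ℝ S.flow (0, p) (s, v) = fderiv ℝ S.local_X p v + s • S.velocity p := by
  have h1 : HasFDerivAt (fun p : K × ℂ ↦ ((0 : ℝ), p)) (ContinuousLinearMap.inr ℝ ℝ (K × ℂ)) p :=
    (ContinuousLinearMap.inr ℝ ℝ (K × ℂ)).hasFDerivAt
  have h2 := HasFDerivAt.comp p (f := fun p : K × ℂ ↦ ((0 : ℝ), p))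
    (S.differentiableAt_flow hU hVU hp).hasFDerivAt h1
  have h3 : (S.flow ∘ fun p : K × ℂ ↦ ((0 : ℝ), p)) = S.local_X := by
    funext p
    simp [flow, local_X, act_one]
  rw [h3] at h2
  have h4 : (s, v) = s • ((1 : ℝ), (0 : K × ℂ)) + (0, v) := by simp
  rw [h4, map_add, map_smul, h2.fderiv, add_comm]
  rfl

theorem velocity_rotate (a : Circle) {p : K × ℂ} (hp : p ∈ bidisc K S.radius) :
    S.velocity (p.1, a * p.2) = S.velocity p := by
  have h1 := S.hasDerivAt_flow hU hVU hp
  have h2 := S.hasDerivAt_flow hU hVU (p := (p.1, a * p.2)) ((circle_mul_mem_bidisc a).2 hp)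
  refine h2.unique ?_
  have : (fun t : ℝ ↦ S.flow (t, (p.1, a * p.2))) = fun t ↦ S.flow (t, p) := by
    funext t
    simp only [flow, S.rotate p hp a]
  rwa [this]

theorem symmDeriv_velocity {p : K × ℂ} (hp : p ∈ bidisc K S.radius) :
    symmDeriv (𝓡∂ n) x₀ (S.local_X p) (S.velocity p) =
      tderiv 𝓘(ℝ, ℝ) (𝓡∂ n) (fun t : ℝ ↦ act U (Circle.exp t) (S.X p)) 0 1 := by
  have h0 : act U (Circle.exp 0) (S.X p) = S.X p := by simp [act_one]
  have h1 := symmDeriv_fderiv (x₀ := x₀) (g := fun t : ℝ ↦ act U (Circle.exp t) (S.X p)) (p := 0)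
    ((contMDiff_orbit hU (hVU (S.mem p hp))).mdifferentiable (by simp) 0)
    (by simp only [h0]; exact S.mem_source p hp)
  rw [← h1]
  have h2 : fderiv ℝ (fun t : ℝ ↦ S.flow (t, p)) 0 1 = S.velocity p :=
    (S.hasDerivAt_flow hU hVU hp).deriv
  simp only [h0]
  exact congrArg (symmDeriv (𝓡∂ n) x₀ (S.local_X p)) h2.symm

/-- The derivative, in the chart, of the slice turned by the phase. -/
theorem fderiv_turn {p : K × ℂ} (hp : p ∈ bidisc K S.radius) (h0 : p.2 ≠ 0) (v : K × ℂ) :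
    fderiv ℝ (fun q : K × ℂ ↦ S.flow ((Complex.log (q.2 * p.2⁻¹)).im, q)) p v =
      fderiv ℝ S.local_X p v + angular p.2 v.2 • S.velocity p := by
  obtain ⟨L, hL, hLa⟩ := hasFDerivAt_log_im h0
  have h1 : HasFDerivAt (fun q : K × ℂ ↦ ((Complex.log (q.2 * p.2⁻¹)).im, q))
      ((L.comp (ContinuousLinearMap.snd ℝ K ℂ)).prod (ContinuousLinearMap.id ℝ (K × ℂ))) p :=
    (HasFDerivAt.comp p (g := fun z : ℂ ↦ (Complex.log (z * p.2⁻¹)).im) hL hasFDerivAt_snd).prodMk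
      (hasFDerivAt_id p)
  have h2 : ((Complex.log (p.2 * p.2⁻¹)).im, p) = (0, p) := by simp [h0]
  have h3 : HasFDerivAt S.flow (fderiv ℝ S.flow (0, p)) ((Complex.log (p.2 * p.2⁻¹)).im, p) := by
    rw [h2]
    exact (S.differentiableAt_flow hU hVU hp).hasFDerivAt
  have h4 := HasFDerivAt.comp p (f := fun q : K × ℂ ↦ ((Complex.log (q.2 * p.2⁻¹)).im, q)) h3 h1
  have h5 := h4.fderiv
  simp only [Function.comp_def] at h5
  rw [h5]
  change fderiv ℝ S.flow (0, p) (L v.2, v) = _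
  rw [S.fderiv_flow_apply hU hVU hp, hLa]

variable (hf : IsInvariantBoundaryDefining n U f)
include hf

/-- Over ζ = 0 the slice lies in the boundary, so its derivatives along K are boundary vectors and
the velocity is the generator. This supplies the hypothesis `hor` of `exists_form_extension`. -/
theorem horizontal {k : ℕ} {β : FormField (𝓡∂ n) M k} (hβ : IsBasicOnBoundary U β) {κ : K}
    (hκ : (κ, (0 : ℂ)) ∈ bidisc K S.radius) (w : Fin k → EuclideanSpace ℝ (Fin n))
    (hw : ∀ i, w i = S.velocity (κ, 0) ∨ ∃ u, w i = fderiv ℝ S.local_X (κ, 0) (u, 0))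
    (hi : ∃ i, w i = S.velocity (κ, 0)) : β.inChart x₀ (S.local_X (κ, 0)) w = 0 := by
  set x := S.X (κ, 0) with hx
  have hb : ∀ κ', (κ', (0 : ℂ)) ∈ bidisc K S.radius → S.X (κ', 0) ∈ (𝓡∂ n).boundary M := by
    intro κ' hκ'
    rw [← hf.zero_iff, S.level _ hκ']
    simp
  have hxU : x ∈ U := hVU (S.mem _ hκ)
  have h0 : act U (Circle.exp 0) x = x := by simp [act_one]
  rw [local_X, inChart_apply_chart _ (S.mem_source _ hκ)]
  have hgen : symmDeriv (𝓡∂ n) x₀ (S.local_X (κ, 0)) (S.velocity (κ, 0)) = generator n U x :=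
    S.symmDeriv_velocity hU hVU hκ
  refine hβ.horizontal x (hb κ hκ) _ (fun i ↦ ?_) ?_
  · rcases hw i with h | ⟨u, h⟩
    · have h1 := tderiv_mem_boundaryTangent ((contMDiff_orbit hU hxU).mdifferentiable (by simp) 0)
        (Eventually.of_forall fun t ↦ (act_mem_boundary hU (Circle.exp t)).2 (hb κ hκ)) (1 : ℝ)
      exact mem_boundaryTangent_of_eq h0 ((congrArg _ h).trans (S.symmDeriv_velocity hU hVU hκ)) h1
    · have h1 : MDifferentiableAt 𝓘(ℝ, K) 𝓘(ℝ, K × ℂ) (fun κ' : K ↦ (κ', (0 : ℂ))) κ :=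
        (contDiff_id.prodMk contDiff_const : ContDiff ℝ ∞ fun κ' : K ↦
          (κ', (0 : ℂ))).contMDiff.mdifferentiable (by simp) κ
      have h2 := tderiv_comp (h := fun κ' : K ↦ (κ', (0 : ℂ))) (S.mdifferentiableAt_X hκ) h1
      have h3 : tderiv 𝓘(ℝ, K) 𝓘(ℝ, K × ℂ) (fun κ' : K ↦ (κ', (0 : ℂ))) κ u = (u, 0) := by
        rw [tderiv_eq_fderiv, (show HasFDerivAt (fun κ' : K ↦ (κ', (0 : ℂ)))
          (ContinuousLinearMap.inl ℝ K ℂ) κ from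
            (ContinuousLinearMap.inl ℝ K ℂ).hasFDerivAt).fderiv]
        rfl
      have h4 := congrArg (fun l : K →L[ℝ] EuclideanSpace ℝ (Fin n) ↦ l u) h2
      simp only [ContinuousLinearMap.comp_apply, h3] at h4
      have h5 := congrArg (fun l : K × ℂ →L[ℝ] EuclideanSpace ℝ (Fin n) ↦ l (u, 0))
        (S.symmDeriv_fderiv_local_X hκ)
      simp only [ContinuousLinearMap.comp_apply] at h5
      have hn : ∀ᶠ κ' in 𝓝 κ, S.X (κ', 0) ∈ (𝓡∂ n).boundary M := by
        filter_upwards [(by fun_prop : Continuous fun κ' : K ↦ (κ', (0 : ℂ))).continuousAt.eventually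
          ((isOpen_bidisc S.radius).mem_nhds hκ)] with κ' hκ' using hb κ' hκ'
      have h6 := tderiv_mem_boundaryTangent (g := fun κ' : K ↦ S.X (κ', 0))
        ((S.mdifferentiableAt_X hκ).comp κ h1) hn u
      exact mem_boundaryTangent_of_eq hx.symm ((congrArg _ h).trans (h5.trans h4.symm)) h6
  · obtain ⟨i, hi⟩ := hi
    exact ⟨i, (congrArg _ hi).trans hgen⟩

end SliceModel

end Boundary

/-! ### Forms in a slice chart -/

section BoundaryForm

open Set Filter

variable {n : ℕ} [NeZero n] {M : Type*} [TopologicalSpace M] [ChartedSpace (EuclideanHalfSpace n) M]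
  {U : TopologicalSpace.Opens M} [MulAction Circle U] [IsManifold (𝓡∂ n) ∞ M]

namespace SliceModel

variable {f : M → ℝ} {V : Set M} {x₀ : M} {K : Type} [NormedAddCommGroup K] [NormedSpace ℝ K]
  (S : SliceModel n U f V x₀ K)

/-- The slice, turned by the phase relative to the point `p`. -/
def turn (p q : K × ℂ) : M := act U (Circle.exp (Complex.log (q.2 * p.2⁻¹)).im) (S.X q)

theorem turn_self {p : K × ℂ} (h0 : p.2 ≠ 0) : S.turn p p = S.X p := by
  simp [turn, h0, act_one]

/-- The varying phase of q is split into the constant phase of p and a small relative angle, so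
invariance of the form is needed for one group element at a time. -/
theorem act_turn {p q : K × ℂ} (hp : p.2 ≠ 0) (hq : q.2 ≠ 0) :
    act U (phase p.2) (S.turn p q) = act U (phase q.2) (S.X q) := by
  rw [turn, ← act_mul, phase_eq_exp_mul hp hq, mul_comm]

variable (hU : IsFreeActionNearBoundary n U) (hVU : V ⊆ U)
include hU hVU

theorem mdifferentiableAt_turn {p : K × ℂ} (hp : p ∈ bidisc K S.radius) (h0 : p.2 ≠ 0) :
    MDifferentiableAt 𝓘(ℝ, K × ℂ) (𝓡∂ n) (S.turn p) p := by
  have h1 : ContDiffAt ℝ ∞ (fun q : K × ℂ ↦ (Complex.log (q.2 * p.2⁻¹)).im) p := by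
    have h2 : ContDiffAt ℝ ∞ Complex.log (p.2 * p.2⁻¹) :=
      (Complex.contDiffAt_log (by simp [h0])).restrict_scalars ℝ
    exact Complex.imCLM.contDiff.contDiffAt.comp p
      (h2.comp p (contDiff_snd.mul contDiff_const).contDiffAt)
  exact (contMDiffAt_act_comp hU (contMDiff_circleExp.contMDiffAt.comp p h1.contMDiffAt)
    (S.smooth.contMDiffAt ((isOpen_bidisc _).mem_nhds hp)) (hVU (S.mem p hp))).mdifferentiableAt
    (by simp)

theorem tderiv_turn {p : K × ℂ} (hp : p ∈ bidisc K S.radius) (h0 : p.2 ≠ 0) (v : K × ℂ) :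
    tderiv 𝓘(ℝ, K × ℂ) (𝓡∂ n) (S.turn p) p v = symmDeriv (𝓡∂ n) x₀ (S.local_X p)
      (fderiv ℝ S.local_X p v + angular p.2 v.2 • S.velocity p) := by
  have h1 := symmDeriv_fderiv (x₀ := x₀) (S.mdifferentiableAt_turn hU hVU hp h0)
    (by rw [S.turn_self h0]; exact S.mem_source p hp)
  rw [← h1, S.turn_self h0, ← S.fderiv_turn hU hVU hp h0]
  rfl

end SliceModel

variable [T2Space M] [SecondCountableTopology M]
  [ChartedSpace (EuclideanSpace ℝ (Fin n)) (CutSpace n U)]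
  (hU : IsFreeActionNearBoundary n U) {f : M → ℝ} (hf : IsInvariantBoundaryDefining n U f)
  (hC : IsCutManifold n U f) {V : Set M} (hV : IsInvariantNhd n U V)
  (hfV : ∀ a, ∀ x ∈ V, f (act U a x) = f x)
include hU hf hC hV hfV

/-- At an interior point, the tangent vectors are recovered from their images in a chart of the
cut space. -/
theorem SliceModel.tderiv_turn_chart {x₀ : M} {K : Type} [NormedAddCommGroup K] [NormedSpace ℝ K]
    [FiniteDimensional ℝ K] (S : SliceModel n U f V x₀ K) {x : M} (hx : x ∈ (𝓡∂ n).interior M)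
    (hs : cutMap n U x ∈ (S.chart hU hf hV hfV).source) {p : K × ℂ}
    (hp : S.chart hU hf hV hfV (cutMap n U x) = p) :
    p ∈ bidisc K S.radius ∧ p.2 ≠ 0 ∧ x = act U (phase p.2) (S.X p) ∧
    ∀ v : EuclideanSpace ℝ (Fin n), tderiv (𝓡∂ n) (𝓡∂ n) (act U (phase p.2)) (S.X p)
      (tderiv 𝓘(ℝ, K × ℂ) (𝓡∂ n) (S.turn p) p
        (tderiv (𝓡 n) 𝓘(ℝ, K × ℂ) (S.chart hU hf hV hfV) (cutMap n U x)
          (tderiv (𝓡∂ n) (𝓡 n) (cutMap n U) x v))) = v := by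
  subst hp
  set ψ := S.chart hU hf hV hfV with hψ
  set p := ψ (cutMap n U x) with hp
  have hrec : ∀ z ∈ (𝓡∂ n).interior M, cutMap n U z ∈ ψ.source →
      z = act U (phase (ψ (cutMap n U z)).2) (S.X (ψ (cutMap n U z))) := fun z hz hzs ↦
    eq_of_cutMap_eq hU hz (ψ.left_inv hzs).symm
  have hpb : p ∈ bidisc K S.radius := ψ.map_source hs
  have hxp := hrec x hx hs
  have hp0 : p.2 ≠ 0 := by
    intro h
    have h1 := (mem_interior_iff_pos hU hf).1 hx
    rw [hxp, hfV _ _ (S.mem _ hpb), S.level _ hpb, h] at h1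
    simp at h1
  refine ⟨hpb, hp0, hxp, fun v ↦ ?_⟩
  have hdψ : MDifferentiableAt (𝓡 n) 𝓘(ℝ, K × ℂ) ψ (cutMap n U x) :=
    ((contMDiffOn_of_isChartFor hU hf hC (S.isChartFor hU hf hV hfV)).contMDiffAt
      (ψ.open_source.mem_nhds hs)).mdifferentiableAt (by simp)
  have hdc := mdifferentiableAt_cutMap hU hf hC hx
  have hdψc : MDifferentiableAt (𝓡∂ n) 𝓘(ℝ, K × ℂ) (fun z ↦ ψ (cutMap n U z)) x := hdψ.comp x hdc
  have hdJ := S.mdifferentiableAt_turn hU hV.subset hpb hp0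
  have hda : MDifferentiableAt (𝓡∂ n) (𝓡∂ n) (act U (phase p.2)) (S.turn p p) := by
    rw [S.turn_self hp0]
    exact (contMDiffAt_act_const hU _ (hV.subset (S.mem _ hpb))).mdifferentiableAt (by simp)
  -- Near x the identity factors as c, the chart, the turned slice and a fixed translation; the
  -- claim is the chain rule for this factorization.
  have hid : ∀ᶠ z in 𝓝 x, act U (phase p.2) (S.turn p (ψ (cutMap n U z))) = z := by
    have hint : IsOpen ((𝓡∂ n).interior M) := (𝓡∂ n).isOpen_interior (n := ∞) (by simp)
    filter_upwards [hint.mem_nhds hx,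
      hdc.continuousAt.eventually (ψ.open_source.mem_nhds hs),
      (continuous_snd.continuousAt.comp hdψc.continuousAt).eventually_ne hp0] with z hz hzs hz0
    rw [S.act_turn hp0 hz0]
    exact (hrec z hz hzs).symm
  have h1 := tderiv_eq_id (I := 𝓡∂ n) hid
  rw [tderiv_comp (g := act U (phase p.2)) (h := fun z ↦ S.turn p (ψ (cutMap n U z))) hda
    (hdJ.comp x hdψc), tderiv_comp (h := fun z ↦ ψ (cutMap n U z)) hdJ hdψc,
    tderiv_comp (h := cutMap n U) hdψ hdc, ← hp, S.turn_self hp0] at h1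
  exact congrArg (fun l : EuclideanSpace ℝ (Fin n) →L[ℝ] EuclideanSpace ℝ (Fin n) ↦ l v) h1

omit hV hfV in
-- The extension over ζ = 0 given by `exists_form_extension` is pulled back by the slice chart. Over
-- the interior it recovers β by invariance under the phase of ζ and `SliceModel.tderiv_turn_chart`.
theorem exists_form_near_boundary {k : ℕ} (β : DifferentialForm (𝓡∂ n) M k)
    (hβ : IsBasicOnBoundary U β.toFun) (hβi : IsInvariantNearBoundary U β.toFun) {x₀ : M}
    (hx₀ : x₀ ∈ (𝓡∂ n).boundary M) :
    ∃ (O : Set (CutSpace n U)) (α : FormField (𝓡 n) (CutSpace n U) k), IsOpen O ∧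
      cutMap n U x₀ ∈ O ∧ α.SmoothOn O ∧ ∀ x ∈ (𝓡∂ n).interior M, cutMap n U x ∈ O →
        α.pullbackAt (I := 𝓡∂ n) (cutMap n U) x = β.toFun x := by
  have := hC.isManifold
  -- The slice is taken inside a neighbourhood on which both f and β are invariant.
  obtain ⟨V₀, hV₀, hfV₀⟩ := hf.exists_nhd
  obtain ⟨V₁, hV₁, hβV⟩ := hβi
  have hV := hV₀.inter hV₁
  have hfV : ∀ a, ∀ x ∈ V₀ ∩ V₁, f (act U a x) = f x := fun a x hx ↦ hfV₀ a x hx.1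
  obtain ⟨m, -, ⟨S⟩⟩ := exists_sliceModel hU hf hV hfV hx₀
  have hmem : ∀ p ∈ bidisc _ S.radius, S.local_X p ∈ (extChartAt (𝓡∂ n) x₀).target := fun p hp ↦
    (extChartAt (𝓡∂ n) x₀).map_source (S.mem_source p hp)
  have hXi : ∀ (a : Circle) k ζ, (k, ζ) ∈ bidisc _ S.radius →
      S.local_X (k, a * ζ) = S.local_X (k, ζ) := fun a k ζ h ↦
    congrArg (extChartAt (𝓡∂ n) x₀) (S.rotate _ h a)
  obtain ⟨γ, hγ, hγe⟩ := exists_form_extension (η := fun p ↦ β.toFun.inChart x₀ (S.local_X p))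
    ((β.smooth' x₀).comp S.contDiffOn_local_X hmem) S.contDiffOn_local_X
    (S.contDiffOn_velocity hU hV.subset) (fun a k ζ h ↦ by rw [hXi a k ζ h]) hXi
    (fun a k ζ h ↦ S.velocity_rotate hU hV.subset a h)
    (fun κ hκ w hw hi ↦ S.horizontal hU hV.subset hf hβ hκ w hw hi)
  set ψ := S.chart hU hf hV hfV with hψ
  have h0 : (0 : EuclideanSpace ℝ (Fin m) × ℂ) ∈ bidisc _ S.radius := by
    simpa [mem_bidisc] using S.radius_pos
  refine ⟨ψ.source, _, ψ.open_source, ⟨0, h0, ?_⟩,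
    smoothOn_pullback ψ.open_source (contMDiffOn_of_isChartFor hU hf hC (S.isChartFor hU hf hV hfV))
      hγ (fun p hp ↦ ψ.map_source hp), fun x hx hxO ↦ ?_⟩
  · exact (twistMap_zero _).trans (congrArg _ S.base)
  obtain ⟨hp, hp0, hxp, hv⟩ := S.tderiv_turn_chart hU hf hC hV hfV hx hxO rfl
  set p := ψ (cutMap n U x) with hpd
  refine pullbackAt_eq_iff.2 (ContinuousAlternatingMap.ext fun v ↦ ?_)
  change γ p (fun i ↦ tderiv (𝓡 n) 𝓘(ℝ, EuclideanSpace ℝ (Fin m) × ℂ) ψ (cutMap n U x)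
      (tderiv (𝓡∂ n) (𝓡 n) (cutMap n U) x (v i))) = β.toFun.val x v
  -- Invariance under the single element phase(ζ) moves the evaluation of β from x to the slice
  -- point.
  have h1 := pullbackAt_eq_iff.1 (hβV (phase p.2) (S.X p) (S.mem p hp).2)
  have h2 := congrArg (fun l : EuclideanSpace ℝ (Fin n) [⋀^Fin k]→L[ℝ] ℝ ↦
    l fun i ↦ tderiv 𝓘(ℝ, EuclideanSpace ℝ (Fin m) × ℂ) (𝓡∂ n) (S.turn p) p
      (tderiv (𝓡 n) 𝓘(ℝ, EuclideanSpace ℝ (Fin m) × ℂ) ψ (cutMap n U x)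
        (tderiv (𝓡∂ n) (𝓡 n) (cutMap n U) x (v i)))) h1
  simp only [ContinuousAlternatingMap.compContinuousLinearMap_apply, Function.comp_def] at h2
  rw [← hxp, funext fun i ↦ hv (v i)] at h2
  rw [hγe p hp hp0, h2, SliceModel.local_X, inChart_apply_chart _ (S.mem_source p hp)]
  exact congrArg _ (funext fun i ↦ (S.tderiv_turn hU hV.subset hp hp0 _).symm)

end BoundaryForm

end SmoothCut

end

/-! ### The theorem -/

theorem mainTheorem4 {n : ℕ} [NeZero n] {M : Type*} [TopologicalSpace M] [T2Space M]
    [SecondCountableTopology M] [ChartedSpace (EuclideanHalfSpace n) M]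
    [IsManifold (𝓡∂ n) ∞ M]
    (U : TopologicalSpace.Opens M) [MulAction Circle U]
    (hU : SmoothCut.IsFreeActionNearBoundary n U) :
    (∃ f : M → ℝ, SmoothCut.IsInvariantBoundaryDefining n U f) ∧
    ∀ f : M → ℝ, SmoothCut.IsInvariantBoundaryDefining n U f →
      (∃ _ : ChartedSpace (EuclideanSpace ℝ (Fin n)) (SmoothCut.CutSpace n U),
        SmoothCut.IsCutManifold n U f) ∧
      ∀ _ : ChartedSpace (EuclideanSpace ℝ (Fin n)) (SmoothCut.CutSpace n U),
        SmoothCut.IsCutManifold n U f →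
        ContMDiffOn (𝓡∂ n) (𝓡 n) ∞ (SmoothCut.cutMap n U) ((𝓡∂ n).interior M) ∧
        ∀ (k : ℕ) (β : SmoothCut.DifferentialForm (𝓡∂ n) M k),
          SmoothCut.IsBasicOnBoundary U β.toFun →
          SmoothCut.IsInvariantNearBoundary U β.toFun →
          ∃! γ : SmoothCut.DifferentialForm (𝓡 n) (SmoothCut.CutSpace n U) k,
            ∀ x ∈ (𝓡∂ n).interior M,
              γ.toFun.pullbackAt (I := 𝓡∂ n) (SmoothCut.cutMap n U) x = β.toFun x := by
  refine ⟨SmoothCut.exists_isInvariantBoundaryDefining hU, fun f hf ↦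
    ⟨SmoothCut.exists_cutManifold hU hf, fun _ hC ↦
      ⟨fun x hx ↦ (SmoothCut.contMDiffAt_cutMap hU hf hC hx).contMDiffWithinAt,
        fun k β hβ hβi ↦ ?_⟩⟩⟩
  have := hC.isManifold
  refine SmoothCut.existsUnique_form (SmoothCut.dense_cutMap_interior hU)
    (fun x hx ↦ SmoothCut.surjective_tderiv_cutMap hU hf hC hx) fun p ↦ ?_
  obtain ⟨x, rfl⟩ := SmoothCut.surjective_cutMap p
  by_cases hx : x ∈ (𝓡∂ n).interior M
  · exact SmoothCut.exists_form_near_interior hU hf hC β hx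
  · rw [← Set.mem_compl_iff, ModelWithCorners.compl_interior] at hx
    exact SmoothCut.exists_form_near_boundary hU hf hC β hβ hβi hx
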